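/- There is a single deterministic algorithm with the following property. Let $N$ be a composite natural number, $p$ a prime factor of $N$, and $b$ a real number with $p<b\le N/5$. Let $m,r$ be natural numbers with $2\le m<p$ and $r=p \bmod m$, and put $d=\lceil (b/m)^{1/2}\rceil$. Given $N$, $\lceil b\rceil$, $m$ and $r$ (but not $p$), the algorithm finds a nontrivial factor of $N$ in $\mathcal{O}(d^{1+\epsilon})$ arithmetic operations for every $\epsilon>0$, where the implied constant depends only on $\epsilon$. More precisely, for $1\le n\le d$ put $b_n=mdn+r$ and $s_n=mn$. Then: 1. $\{b_n:1\le n\le d\}$ and $\{s_n:1\le n\le d\}$ are disjoint subsets of $\{0,\dots,N-1\}$, and there are $i,j\in\{1,\dots,d\}$ and a prime factor $p'$ of $N$ such that $b_i\equiv s_j \pmod{p'}$. 2. Let $f_i=X-b_i$, $g=\prod_{i=1}^d f_i$, $y_j=g(s_j)\bmod N$, $G_j=\gcd(y_j,N)$ and $H_{i,j}=\gcd(f_i(s_j),N)$. Consider the following procedure: find the least $j\in\{1,\dots,d\}$ with $G_j\ne 1$ (if there is none, report error A); if $G_j<N$, print $G_j$; if $G_j=N$, find the least $i\in\{1,\dots,d\}$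 with $1<H_{i,j}<N$ (if there is none, report error B) and print $H_{i,j}$. This procedure prints a number $F$ with $F\mid N$ and $1<F<N$. 3. There are one fixed program for a random access machine and one integer $k$, both independent of all of the above data, such that for every $\epsilon>0$ there is a constant $C=C(\epsilon)$ for which the following holds for all $N,p,b,m,r$ as above: on input $(N,\lceil b\rceil,m,r)$ the program prints the number $F$ of part 2 after at most $C\,d^{1+\epsilon}$ steps, at most $2d$ of which are gcd computations. Here the machine works with words, that is, natural numbers smaller than $N^k$ (so of $\mathcal{O}(\log N)$ bits), and each of the following is one step: addition, truncated subtraction, multiplication, division with remainder and gcd of words, setting a register to a constant, copying a register, reading or writing an indirectly addressed memory cell, comparing two registers, and calling a procedure. -/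

import Mathlib

/-! ## Word RAM programs with a step count

Registers and memory cells hold natural numbers.  All words occurring in a computation are below
a word bound `W`; in the theorem `W = N ^ k` with `k` fixed, i.e. words have `O(log N)` bits. -/

namespace WordRAM

/-- Arithmetic instructions on words (`sub` is truncated subtraction, `div` and `mod` are
quotient and remainder of the division with remainder). -/
inductive Op
  | add | sub | mul | div | mod | gcd
  deriving DecidableEq

/-- The value computed by an arithmetic instruction. -/
def Op.eval : Op → ℕ → ℕ → ℕ
  | .add, x, y => x + y
  | .sub, x, y => x - y
  | .mul, x, y => x * y
  | .div, x, y => x / y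
  | .mod, x, y => x % y
  | .gcd, x, y => Nat.gcd x y

/-- Commands. Registers are named by numerals that are fixed in the program text; memory is
addressed indirectly, through the contents of a register. -/
inductive Cmd
  /-- Do nothing. -/
  | skip
  /-- `R x := c`. -/
  | const (x c : ℕ)
  /-- `R x := R y`. -/
  | move (x y : ℕ)
  /-- `R x := o (R y) (R z)`. -/
  | arith (o : Op) (x y z : ℕ)
  /-- `R x := M [R y]`. -/
  | load (x y : ℕ)
  /-- `M [R x] := R y`. -/
  | store (x y : ℕ)
  /-- Sequential composition. -/
  | seq (c₁ c₂ : Cmd)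
  /-- If `R x < R y` then `c₁` else `c₂`. -/
  | ifLt (x y : ℕ) (c₁ c₂ : Cmd)
  /-- While `R x < R y` do `c`. -/
  | whileLt (x y : ℕ) (c : Cmd)
  /-- Call of the parameterless, possibly recursive, procedure number `f`. -/
  | call (f : ℕ)

/-- A program: a main command and finitely many procedures. -/
structure Program where
  main : Cmd
  procs : List Cmd

/-- Contents of the registers and of the memory. -/
structure State where
  reg : ℕ → ℕ
  mem : ℕ → ℕ

/-- Write `v` into register `x`. -/
def State.setReg (σ : State) (x v : ℕ) : State :=
  { σ with reg := Function.update σ.reg x v }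

/-- Write `v` into memory cell `a`. -/
def State.setMem (σ : State) (a v : ℕ) : State :=
  { σ with mem := Function.update σ.mem a v }

/-- `Exec W P c σ σ' t g`: with the procedures `P` and word bound `W`, the command `c` started in
state `σ` terminates in state `σ'` after `t` steps, `g` of which are `gcd` instructions. Every
instruction, test and procedure call is one step. There is no rule for an instruction whose result
is not below `W`: such a computation is stuck, and has no final state. -/
inductive Exec (W : ℕ) (P : List Cmd) : Cmd → State → State → ℕ → ℕ → Prop
  | skip (σ : State) : Exec W P .skip σ σ 1 0
  | const (σ : State) (x c : ℕ) (h : c < W) : Exec W P (.const x c) σ (σ.setReg x c) 1 0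
  | move (σ : State) (x y : ℕ) : Exec W P (.move x y) σ (σ.setReg x (σ.reg y)) 1 0
  | arith (σ : State) (o : Op) (x y z : ℕ) (h : o.eval (σ.reg y) (σ.reg z) < W) :
      Exec W P (.arith o x y z) σ (σ.setReg x (o.eval (σ.reg y) (σ.reg z))) 1
        (if o = .gcd then 1 else 0)
  | load (σ : State) (x y : ℕ) : Exec W P (.load x y) σ (σ.setReg x (σ.mem (σ.reg y))) 1 0
  | store (σ : State) (x y : ℕ) :
      Exec W P (.store x y) σ (σ.setMem (σ.reg x) (σ.reg y)) 1 0
  | seq {c₁ c₂ : Cmd} {σ σ₁ σ₂ : State} {t₁ t₂ g₁ g₂ : ℕ}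
      (h₁ : Exec W P c₁ σ σ₁ t₁ g₁) (h₂ : Exec W P c₂ σ₁ σ₂ t₂ g₂) :
      Exec W P (.seq c₁ c₂) σ σ₂ (t₁ + t₂) (g₁ + g₂)
  | ifTrue {x y : ℕ} {c₁ c₂ : Cmd} {σ σ' : State} {t g : ℕ} (hlt : σ.reg x < σ.reg y)
      (h : Exec W P c₁ σ σ' t g) : Exec W P (.ifLt x y c₁ c₂) σ σ' (t + 1) g
  | ifFalse {x y : ℕ} {c₁ c₂ : Cmd} {σ σ' : State} {t g : ℕ} (hle : σ.reg y ≤ σ.reg x)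
      (h : Exec W P c₂ σ σ' t g) : Exec W P (.ifLt x y c₁ c₂) σ σ' (t + 1) g
  | whileTrue {x y : ℕ} {c : Cmd} {σ σ₁ σ₂ : State} {t₁ t₂ g₁ g₂ : ℕ}
      (hlt : σ.reg x < σ.reg y) (h₁ : Exec W P c σ σ₁ t₁ g₁)
      (h₂ : Exec W P (.whileLt x y c) σ₁ σ₂ t₂ g₂) :
      Exec W P (.whileLt x y c) σ σ₂ (t₁ + t₂ + 1) (g₁ + g₂)
  | whileFalse {x y : ℕ} {c : Cmd} {σ : State} (hle : σ.reg y ≤ σ.reg x) :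
      Exec W P (.whileLt x y c) σ σ 1 0
  | call {f : ℕ} {c : Cmd} {σ σ' : State} {t g : ℕ} (hf : P[f]? = some c)
      (h : Exec W P c σ σ' t g) : Exec W P (.call f) σ σ' (t + 1) g

/-- Final state and step counts of a command are determined by the initial state. -/
theorem Exec.deterministic {W : ℕ} {P : List Cmd} {c : Cmd} {σ σ₁ σ₂ : State} {t₁ t₂ g₁ g₂ : ℕ}
    (h₁ : Exec W P c σ σ₁ t₁ g₁) (h₂ : Exec W P c σ σ₂ t₂ g₂) :
    σ₁ = σ₂ ∧ t₁ = t₂ ∧ g₁ = g₂ := by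
  induction h₁ generalizing σ₂ t₂ g₂ with
  | skip | const | move | arith | load | store => cases h₂; simp
  | seq _ _ ih₁ ih₂ =>
    cases h₂ with
    | seq a b =>
      obtain ⟨rfl, rfl, rfl⟩ := ih₁ a
      obtain ⟨rfl, rfl, rfl⟩ := ih₂ b
      simp
  | ifTrue hlt _ ih =>
    cases h₂ with
    | ifTrue _ a => obtain ⟨rfl, rfl, rfl⟩ := ih a; simp
    | ifFalse hle a => omega
  | ifFalse hle _ ih =>
    cases h₂ with
    | ifTrue hlt a => omega
    | ifFalse _ a => obtain ⟨rfl, rfl, rfl⟩ := ih a; simp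
  | whileTrue hlt _ _ ih₁ ih₂ =>
    cases h₂ with
    | whileTrue _ a b =>
      obtain ⟨rfl, rfl, rfl⟩ := ih₁ a
      obtain ⟨rfl, rfl, rfl⟩ := ih₂ b
      simp
    | whileFalse hle => omega
  | whileFalse hle =>
    cases h₂ with
    | whileTrue hlt a b => omega
    | whileFalse _ => simp
  | call hf _ ih =>
    cases h₂ with
    | call hf' a =>
      obtain rfl : _ = _ := Option.some.inj (hf.symm.trans hf')
      obtain ⟨rfl, rfl, rfl⟩ := ih a
      simp

/-- The initial state: the input words are in registers `0, 1, 2, …`; all other registers and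
the whole memory are `0`. -/
def initState (input : List ℕ) : State where
  reg i := input.getD i 0
  mem _ := 0

/-- With word bound `W`, the program `Q` started on `input` halts with `out` in register `0`, after
`t` steps, `g` of which are `gcd` instructions. -/
def Program.Outputs (Q : Program) (W : ℕ) (input : List ℕ) (out t g : ℕ) : Prop :=
  ∃ σ' : State, Exec W Q.procs Q.main (initState input) σ' t g ∧ σ'.reg 0 = out

end WordRAM

/-! ## The factorization algorithm -/

namespace DigitFactoring

/-- Two families `b_1, …, b_d` and `s_1, …, s_d` in `{0, …, N - 1}` with disjoint sets of values
such that, if `N` is composite, `b_i ≡ s_j` modulo some prime factor of `N` for some `i`, `j`. -/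
structure IsSolution (N d : ℕ) (b s : ℕ → ℕ) : Prop where
  b_lt : ∀ n ∈ Finset.Icc 1 d, b n < N
  s_lt : ∀ n ∈ Finset.Icc 1 d, s n < N
  disjoint : Disjoint (b '' Set.Icc 1 d) (s '' Set.Icc 1 d)
  collision : 1 < N → ¬ N.Prime → ∃ i ∈ Finset.Icc 1 d, ∃ j ∈ Finset.Icc 1 d,
    ∃ p : ℕ, p.Prime ∧ p ∣ N ∧ b i ≡ s j [MOD p]

/-- What the factorization algorithm prints. -/
inductive Outcome
  | factor (F : ℕ)
  | errorA
  | errorB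

section Algorithm

variable (N d : ℕ) (f : ℕ → Polynomial ℤ) (s : ℕ → ℕ)

/-- `y_n = g(s_n) mod N`, where `g = f_1 ⋯ f_d`. -/
noncomputable def yVal (n : ℕ) : ℤ :=
  ((∏ i ∈ Finset.Icc 1 d, f i).eval (s n : ℤ)) % (N : ℤ)

/-- `G_j = gcd(y_j, N)`. -/
noncomputable def gcdG (j : ℕ) : ℕ := Int.gcd (yVal N d f s j) N

/-- `H_i = gcd(f_i(s_j), N)`. -/
noncomputable def gcdH (j i : ℕ) : ℕ := Int.gcd ((f i).eval (s j : ℤ)) N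

/-- The second search, for the first `i ∈ {1, …, d}` with `1 < H_i < N`. -/
noncomputable def searchH (j : ℕ) : Outcome :=
  match (List.range' 1 d).find? (fun i => decide (1 < gcdH N f s j i ∧ gcdH N f s j i < N)) with
  | none => .errorB
  | some i => .factor (gcdH N f s j i)

/-- The algorithm with polynomials `f_1, …, f_d` and points `s_1, …, s_d`: find the first
`j ∈ {1, …, d}` with `G_j ≠ 1`; print `G_j` if it is smaller than `N`, and otherwise continue
with the search through the `H_i` for this `j`. -/
noncomputable def algorithm : Outcome :=
  match (List.range' 1 d).find? (fun j => decide (gcdG N d f s j ≠ 1)) with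
  | none => .errorA
  | some j => if gcdG N d f s j < N then .factor (gcdG N d f s j) else searchH N d f s j

end Algorithm

end DigitFactoring

namespace WordRAM

/-! ## A small language of expressions and loops on top of the machine -/

/-! Correctness. Write `p = m * q + r` with `q < d ^ 2` and expand `q` in base `d`. Moving the lower
digit to the other side gives `b_i = s_j + p` for some `i`, `j` (`exists_digits`). Since `b ≤ N /
5`, all `b_i` and `s_j` lie below `N`, and they are distinct because `m` does not divide `p`. Hence
`p` divides `g(s_j)` for some `j`, and the first search succeeds. If it ends with `G_j = N`, then
`p` divides some `f_i(s_j)`; all these numbers are nonzero and smaller than `N` in absolute value,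
so the first `H_i > 1` is a proper factor.

Cost. All `g(s_j)` modulo `N` are needed in about `d` steps. Each is a product of `d` values of a
linear function along a progression of difference `d` (`gcd_eq_of_cast_eq_apProd`). A product of `h`
such values is a polynomial of degree at most `h` in the starting point, so a table of values
determines it, and `apProd_add` doubles `h` once the table can be shifted. Interpolation would need
inverses of factorials modulo `N`. Instead, `coeff_kernel_mul` reads the shifted table off a product
of power series whose kernel consists of binomial coefficients; the kernel table is itself moved by
the same lemma.

Multiplication. Put `H = 2 ^ l`, `K = 2 * H`. Polynomials of length `K ^ l` are cut into `H ^ l`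
blocks of `H` words, viewed in `(ℤ/M)[y]/(y ^ K + 1)`, where powers of `y` are roots of unity acting
by rotation of words. Then `l` levels of naive transforms of length `K` reduce the product to
products of ring elements (`BlockProd.backward`, `blockProd_one`, `recombine`). The inverse
transforms leave a factor `K ^ l`; with `M = N * K ^ l` it can be divided out exactly, although `2`
need not be a unit modulo `N`. With `l` least such that `d < 2 ^ (l * l)`, the overhead over `d` is
a fixed power of `2 ^ l`, which is `d ^ o(1)` (`factorCost_le`, `two_pow_le_rpow`). -/

/-- Variables of the language, and sixteen unbounded arrays. -/
@[ext] structure Store where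
  v : ℕ → ℕ
  arr : Fin 16 → ℕ → ℕ

/-- Variables live in the even registers; the arrays are interleaved in the memory. -/
def State.store (σ : State) : Store where
  v x := σ.reg (2 * x)
  arr a i := σ.mem (16 * i + a)

/-- All values in the store are smaller than `B`. -/
def Store.Bdd (h : Store) (B : ℕ) : Prop :=
  (∀ x, h.v x < B) ∧ ∀ a i, h.arr a i < B

/-- Arithmetic expressions. -/
inductive Expr
  | lit (c : ℕ)
  | var (x : ℕ)
  | arr (a : Fin 16) (e : Expr)
  | bin (o : Op) (e₁ e₂ : Expr)

namespace Expr

instance : Add Expr := ⟨bin .add⟩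
instance : Sub Expr := ⟨bin .sub⟩
instance : Mul Expr := ⟨bin .mul⟩
instance : Div Expr := ⟨bin .div⟩
instance : Mod Expr := ⟨bin .mod⟩
instance (c : ℕ) : OfNat Expr c := ⟨lit c⟩

/-- The value of an expression. -/
def eval : Expr → Store → ℕ
  | lit c, _ => c
  | var x, h => h.v x
  | arr a e, h => h.arr a (e.eval h)
  | bin o e₁ e₂, h => o.eval (e₁.eval h) (e₂.eval h)

@[simp] theorem eval_zero (h : Store) : eval (0 : Expr) h = 0 := rfl
@[simp] theorem eval_one (h : Store) : eval (1 : Expr) h = 1 := rfl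
@[simp] theorem eval_two (h : Store) : eval (2 : Expr) h = 2 := rfl
@[simp] theorem eval_var (x : ℕ) (h : Store) : eval (var x) h = h.v x := rfl
@[simp] theorem eval_arr (a : Fin 16) (e : Expr) (h : Store) :
    eval (arr a e) h = h.arr a (e.eval h) := rfl
@[simp] theorem eval_add (a b : Expr) (h : Store) : eval (a + b) h = eval a h + eval b h := rfl
@[simp] theorem eval_sub (a b : Expr) (h : Store) : eval (a - b) h = eval a h - eval b h := rfl
@[simp] theorem eval_mul (a b : Expr) (h : Store) : eval (a * b) h = eval a h * eval b h := rfl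
@[simp] theorem eval_div (a b : Expr) (h : Store) : eval (a / b) h = eval a h / eval b h := rfl
@[simp] theorem eval_mod (a b : Expr) (h : Store) : eval (a % b) h = eval a h % eval b h := rfl
@[simp] theorem eval_gcd (a b : Expr) (h : Store) :
    eval (bin .gcd a b) h = Nat.gcd (eval a h) (eval b h) := rfl

/-- Number of steps of the evaluation. -/
def cost : Expr → ℕ
  | lit _ => 1
  | var _ => 1
  | arr _ e => e.cost + 5
  | bin _ e₁ e₂ => e₁.cost + e₂.cost + 1

/-- Number of gcd computations in the evaluation. -/
def gcds : Expr → ℕ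
  | lit _ => 0
  | var _ => 0
  | arr _ e => e.gcds
  | bin o e₁ e₂ => e₁.gcds + e₂.gcds + if o = .gcd then 1 else 0

/-- If all values in the store are below `N ^ A`, then all values in an evaluation of `e` are
below `N ^ e.size A`. -/
def size (A : ℕ) : Expr → ℕ
  | lit c => c
  | var _ => A
  | arr _ e => A + 16 + e.size A
  | bin _ e₁ e₂ => e₁.size A + e₂.size A + 1

/-- Machine code leaving the value of the expression in register `2 * k + 1`. -/
def compile : Expr → ℕ → Cmd
  | lit c, k => .const (2 * k + 1) c
  | var x, k => .move (2 * k + 1) (2 * x)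
  | arr a e, k => .seq (e.compile k) (.seq (.const (2 * k + 3) 16)
      (.seq (.arith .mul (2 * k + 1) (2 * k + 1) (2 * k + 3)) (.seq (.const (2 * k + 3) a)
      (.seq (.arith .add (2 * k + 1) (2 * k + 1) (2 * k + 3)) (.load (2 * k + 1) (2 * k + 1))))))
  | bin o e₁ e₂, k => .seq (e₁.compile k) (.seq (e₂.compile (k + 1))
      (.arith o (2 * k + 1) (2 * k + 1) (2 * k + 3)))

end Expr

/-! ### Evaluation of expressions within the word bound -/

theorem Op.eval_lt {N : ℕ} (hN : 1 < N) (o : Op) {x y a b : ℕ} (hx : x < N ^ a) (hy : y < N ^ b) :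
    o.eval x y < N ^ (a + b + 1) := by
  have ha : 1 ≤ N ^ a := Nat.one_le_pow _ _ (by omega)
  have hb : 1 ≤ N ^ b := Nat.one_le_pow _ _ (by omega)
  have h1 : N ^ a * 1 ≤ N ^ a * N ^ b := Nat.mul_le_mul_left _ hb
  have h2 : 1 * N ^ b ≤ N ^ a * N ^ b := Nat.mul_le_mul_right _ ha
  have h3 : N ^ a * N ^ b * 2 ≤ N ^ (a + b + 1) := by
    rw [pow_succ, pow_add]; exact Nat.mul_le_mul_left _ hN
  cases o with
  | add => simp only [Op.eval]; omega
  | sub => simp only [Op.eval]; omega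
  | mul =>
    simp only [Op.eval]
    have := Nat.mul_lt_mul'' hx hy
    omega
  | div => simp only [Op.eval]; have := Nat.div_le_self x y; omega
  | mod => simp only [Op.eval]; have := Nat.mod_le x y; omega
  | gcd =>
    simp only [Op.eval]
    rcases Nat.eq_zero_or_pos x with rfl | h
    · simp; omega
    · have := Nat.gcd_le_left y h; omega

theorem State.store_setReg_odd (σ : State) (k v : ℕ) :
    (σ.setReg (2 * k + 1) v).store = σ.store := by
  have : ∀ x, 2 * x ≠ 2 * k + 1 := by omega
  simp [State.store, State.setReg, this]

theorem State.store_setReg_even (σ : State) (x v : ℕ) :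
    (σ.setReg (2 * x) v).store = ⟨Function.update σ.store.v x v, σ.store.arr⟩ := by
  ext y
  · simp only [State.store, State.setReg, Function.update_apply]
    simp
  · rfl

theorem State.store_setMem (σ : State) (a : Fin 16) (i v : ℕ) :
    (σ.setMem (16 * i + a) v).store =
      ⟨σ.store.v, Function.update σ.store.arr a (Function.update (σ.store.arr a) i v)⟩ := by
  ext y j
  · rfl
  · simp only [State.store, State.setMem, Function.update_apply]
    by_cases hy : y = a
    · subst hy
      by_cases hj : j = i <;> simp [hj]
    · have : 16 * j + (y : ℕ) ≠ 16 * i + a := by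
        intro h
        apply hy
        ext
        omega
      simp [hy, this]

/-- Scratch values live in odd registers from `2 * k + 1` on, so variables are untouched and a
pending left operand survives the evaluation of the right one at level `k + 1`. The size bound is
proved together with the execution, since an instruction whose result is too large would be stuck.
-/
theorem Expr.exec_compile {N A K : ℕ} (hN : 1 < N) (hK : 16 ≤ K) (P : List Cmd) (e : Expr) (k : ℕ)
    (σ : State) (hb : σ.store.Bdd (N ^ A)) (hs : e.size A ≤ K) :
    e.eval σ.store < N ^ e.size A ∧
    ∃ σ', Exec (N ^ K) P (e.compile k) σ σ' e.cost e.gcds ∧ σ'.store = σ.store ∧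
      σ'.reg (2 * k + 1) = e.eval σ.store ∧ ∀ j < k, σ'.reg (2 * j + 1) = σ.reg (2 * j + 1) := by
  have hpow : ∀ {a b : ℕ}, a ≤ b → N ^ a ≤ N ^ b := fun h => Nat.pow_le_pow_right (by omega) h
  have hlit : ∀ c : ℕ, c < N ^ c := fun c => Nat.lt_pow_self hN
  have hreg : ∀ (σ : State) (j x v : ℕ), x ≠ j → (σ.setReg x v).reg j = σ.reg j := by
    intro σ j x v h; simp [State.setReg, h.symm]
  have hreg' : ∀ (σ : State) (x v : ℕ), (σ.setReg x v).reg x = v := by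
    intro σ x v; simp [State.setReg]
  induction e generalizing k σ with
  | lit c =>
    refine ⟨hlit c, _, .const _ _ _ ((hlit c).trans_le (hpow hs)), State.store_setReg_odd _ _ _,
      hreg' _ _ _, fun j hj => hreg _ _ _ _ (by omega)⟩
  | var x =>
    refine ⟨hb.1 x, _, .move _ _ _, State.store_setReg_odd _ _ _,
      hreg' _ _ _, fun j hj => hreg _ _ _ _ (by omega)⟩
  | arr a e ih =>
    simp only [size] at hs
    obtain ⟨h1, σ₁, hE, hst, hr, hj⟩ := ih k σ hb (by omega)
    refine ⟨(hb.2 a _).trans_le (hpow (by simp only [size]; omega)), ?_⟩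
    have e16 : (2 * k + 3 : ℕ) ≠ 2 * k + 1 := by omega
    -- Addresses have the form `16 * i + a` with `a < 16`; as only `N ≥ 2` is known, this costs four
    -- powers of `N`.
    have h16 : 16 ≤ N ^ 4 := by
      calc 16 = 2 ^ 4 := by norm_num
        _ ≤ N ^ 4 := Nat.pow_le_pow_left hN 4
    have hm : 16 * e.eval σ.store + 15 < N ^ (e.size A + 4) := by
      rw [pow_add]
      have : (e.eval σ.store + 1) * 16 ≤ N ^ e.size A * N ^ 4 := Nat.mul_le_mul h1 h16
      omega
    have hm' := hm.trans_le (hpow (show e.size A + 4 ≤ K by omega))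
    have ha := a.isLt
    refine ⟨_, .seq hE (.seq (.const _ _ 16 ((hlit 16).trans_le (hpow hK)))
      (.seq (.arith _ _ _ _ _ ?_) (.seq (.const _ _ a ?_) (.seq (.arith _ _ _ _ _ ?_)
      (.load _ _ _))))), ?_, ?_, ?_⟩
    · simp only [Op.eval, hreg', hreg _ _ _ _ e16, hr]; omega
    · exact (hlit a).trans_le (hpow (by omega))
    · simp only [Op.eval, hreg', hreg _ _ _ _ e16, hr]; omega
    · simp only [show 2 * k + 3 = 2 * (k + 1) + 1 by ring, State.store_setReg_odd, hst]
    · simp only [Op.eval, hreg', hreg _ _ _ _ e16, hr]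
      rw [mul_comm _ 16]
      exact congrFun (congrFun (congrArg Store.arr hst) a) _
    · intro j hjk
      rw [hreg _ _ _ _ (by omega), hreg _ _ _ _ (by omega), hreg _ _ _ _ (by omega),
        hreg _ _ _ _ (by omega), hreg _ _ _ _ (by omega), hj j hjk]
  | bin o e₁ e₂ ih₁ ih₂ =>
    simp only [size] at hs
    obtain ⟨h1, σ₁, hE, hst, hr, hj⟩ := ih₁ k σ hb (by omega)
    obtain ⟨h2, σ₂, hE', hst', hr', hj'⟩ := ih₂ (k + 1) σ₁ (by rwa [hst]) (by omega)
    rw [hst] at h2 hst' hr'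
    have hlt := Op.eval_lt hN o h1 h2
    refine ⟨hlt, ?_⟩
    have hr1 : σ₂.reg (2 * k + 1) = e₁.eval σ.store := by rw [hj' k (by omega), hr]
    have hr2 : σ₂.reg (2 * k + 3) = e₂.eval σ.store := hr'
    have key := Exec.arith (W := N ^ K) (P := P) σ₂ o (2 * k + 1) (2 * k + 1) (2 * k + 3)
      (by rw [hr1, hr2]; exact hlt.trans_le (hpow (by omega)))
    have := Exec.seq hE (Exec.seq hE' key)
    refine ⟨σ₂.setReg (2 * k + 1) (o.eval (σ₂.reg (2 * k + 1)) (σ₂.reg (2 * k + 3))),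
      ?_, ?_, ?_, ?_⟩
    · have hg : (bin o e₁ e₂).gcds = e₁.gcds + (e₂.gcds + if o = .gcd then 1 else 0) := by
        simp only [gcds, add_assoc]
      rw [hg]
      exact this
    · rw [State.store_setReg_odd, hst']
    · rw [hreg', hr1, hr2]; rfl
    · intro j hjk
      rw [hreg _ _ _ _ (by omega), hj' j (by omega), hj j hjk]

/-! ### A program logic counting steps and gcds -/

/-- `wp N A K c T G Q h`: from every bounded store `h`, the command `c` reaches a bounded store with
`Q`, within `T` steps and `G` gcd computations. -/
def wp (N A K : ℕ) (c : Cmd) (T G : ℕ) (Q : Store → Prop) (h : Store) : Prop :=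
  ∀ σ : State, σ.store = h → h.Bdd (N ^ A) → ∃ σ' t g, Exec (N ^ K) [] c σ σ' t g ∧ t ≤ T ∧ g ≤ G ∧
    σ'.store.Bdd (N ^ A) ∧ Q σ'.store

theorem Exec.arith_of_eq {W : ℕ} {P : List Cmd} {σ : State} {o : Op} {x y z a b : ℕ}
    (hy : σ.reg y = a) (hz : σ.reg z = b) (h : o.eval a b < W) (ho : o ≠ .gcd) :
    Exec W P (.arith o x y z) σ (σ.setReg x (o.eval a b)) 1 0 := by
  subst hy hz
  have := Exec.arith (P := P) σ o x y z h
  rwa [if_neg ho] at this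

theorem Exec.store_of_eq {W : ℕ} {P : List Cmd} {σ : State} {x y a v : ℕ}
    (hx : σ.reg x = a) (hy : σ.reg y = v) :
    Exec W P (.store x y) σ (σ.setMem a v) 1 0 := by
  subst hx hy
  exact .store _ _ _

section wp

variable {N A K : ℕ}

theorem wp_bdd {c : Cmd} {T G : ℕ} {Q : Store → Prop} {h : Store}
    (H : h.Bdd (N ^ A) → wp N A K c T G Q h) : wp N A K c T G Q h :=
  fun σ hσ hb => H hb σ hσ hb

theorem wp_mono {c : Cmd} {T G T' G' : ℕ} {Q Q' : Store → Prop} {h : Store}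
    (H : wp N A K c T G Q h) (hT : T ≤ T') (hG : G ≤ G') (hQ : ∀ h', Q h' → Q' h') :
    wp N A K c T' G' Q' h := by
  intro σ hσ hb
  obtain ⟨σ', t, g, h1, h2, h3, h4, h5⟩ := H σ hσ hb
  exact ⟨σ', t, g, h1, h2.trans hT, h3.trans hG, h4, hQ _ h5⟩

theorem wp_seq {c₁ c₂ : Cmd} {T₁ G₁ T₂ G₂ : ℕ} {Q : Store → Prop} {h : Store}
    (H : wp N A K c₁ T₁ G₁ (wp N A K c₂ T₂ G₂ Q) h) :
    wp N A K (.seq c₁ c₂) (T₁ + T₂) (G₁ + G₂) Q h := by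
  intro σ hσ hb
  obtain ⟨σ', t, g, h1, h2, h3, h4, h5⟩ := H σ hσ hb
  obtain ⟨σ'', t', g', h1', h2', h3', h4', h5'⟩ := h5 σ' rfl h4
  exact ⟨σ'', _, _, .seq h1 h1', by omega, by omega, h4', h5'⟩

/-- `x := e`. -/
def asg (x : ℕ) (e : Expr) : Cmd := .seq (e.compile 0) (.move (2 * x) 1)

/-- `a[i] := e`. -/
def sto (a : Fin 16) (i e : Expr) : Cmd :=
  .seq (i.compile 0) (.seq (e.compile 1) (.seq (.const 5 16) (.seq (.arith .mul 1 1 5)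
    (.seq (.const 5 a) (.seq (.arith .add 1 1 5) (.store 1 3))))))

/-- `while e₁ < e₂ do c`. -/
def whl (e₁ e₂ : Expr) (c : Cmd) : Cmd :=
  .seq (e₁.compile 0) (.seq (e₂.compile 1) (.whileLt 1 3 (.seq c (.seq (e₁.compile 0)
    (e₂.compile 1)))))

theorem wp_asg (hN : 1 < N) (hK : 16 ≤ K) {x : ℕ} {e : Expr} {Q : Store → Prop} {h : Store}
    (hs : e.size A ≤ K) (hlt : e.eval h < N ^ A)
    (H : Q ⟨Function.update h.v x (e.eval h), h.arr⟩) :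
    wp N A K (asg x e) (e.cost + 1) e.gcds Q h := by
  rintro σ rfl hb
  obtain ⟨-, σ', hE, hst, hr, -⟩ := e.exec_compile hN hK [] 0 σ hb hs
  have hst2 : (σ'.setReg (2 * x) (σ'.reg 1)).store =
      ⟨Function.update σ.store.v x (e.eval σ.store), σ.store.arr⟩ := by
    rw [State.store_setReg_even, hst, ← hr]
  refine ⟨_, _, _, .seq hE (.move _ _ _), le_rfl, le_rfl, ?_, ?_⟩
  · rw [hst2]
    refine ⟨fun y => ?_, hb.2⟩
    by_cases hy : y = x
    · subst hy; simpa using hlt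
    · simpa [hy] using hb.1 y
  · rwa [hst2]

theorem wp_sto (hN : 1 < N) (hK : 16 ≤ K) {a : Fin 16} {i e : Expr} {Q : Store → Prop} {h : Store}
    (hi : i.size A + 4 ≤ K) (hs : e.size A ≤ K) (hlt : e.eval h < N ^ A)
    (H : Q ⟨h.v, Function.update h.arr a
      (Function.update (h.arr a) (i.eval h) (e.eval h))⟩) :
    wp N A K (sto a i e) (i.cost + e.cost + 5) (i.gcds + e.gcds) Q h := by
  rintro σ rfl hb
  obtain ⟨hil, σ₁, hE, hst, hr, -⟩ := i.exec_compile hN hK [] 0 σ hb (by omega)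
  obtain ⟨-, σ₂, hE', hst', hr', hj'⟩ := e.exec_compile hN hK [] 1 σ₁ (by rwa [hst]) hs
  rw [hst] at hst' hr'
  have hr1 : σ₂.reg 1 = i.eval σ.store := by
    have := hj' 0 (by omega)
    simp only [mul_zero, zero_add] at this hr
    rw [this, hr]
  have hr2 : σ₂.reg 3 = e.eval σ.store := hr'
  have hpow : ∀ {a b : ℕ}, a ≤ b → N ^ a ≤ N ^ b := fun h => Nat.pow_le_pow_right (by omega) h
  have h16 : 16 ≤ N ^ 4 := by
    calc 16 = 2 ^ 4 := by norm_num
      _ ≤ N ^ 4 := Nat.pow_le_pow_left hN 4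
  have hm : 16 * i.eval σ.store + 15 < N ^ (i.size A + 4) := by
    rw [pow_add]
    have : (i.eval σ.store + 1) * 16 ≤ N ^ i.size A * N ^ 4 := Nat.mul_le_mul hil h16
    omega
  have hm' := hm.trans_le (hpow hi)
  have ha := a.isLt
  have hc : 16 < N ^ K := (Nat.lt_pow_self hN).trans_le (hpow hK)
  have r1 : (σ₂.setReg 5 16).reg 1 = i.eval σ.store := by simp [State.setReg, hr1]
  have r5 : (σ₂.setReg 5 16).reg 5 = 16 := by simp [State.setReg]
  have key := Exec.seq (.const σ₂ 5 16 hc) (.seq (Exec.arith_of_eq (P := []) (o := .mul) (x := 1) r1 r5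
    (show i.eval σ.store * 16 < N ^ K by omega) (by simp)) (.seq (.const _ 5 a (by omega))
    (.seq (Exec.arith_of_eq (o := .add) (x := 1) (y := 1) (z := 5) (a := i.eval σ.store * 16) (b := a)
      (by simp [State.setReg, Op.eval]) (by simp [State.setReg])
      (show i.eval σ.store * 16 + a < N ^ K by omega) (by simp))
    (Exec.store_of_eq (x := 1) (y := 3) (a := 16 * i.eval σ.store + a) (v := e.eval σ.store)
      (by simp [State.setReg, Op.eval, mul_comm]) (by simp [State.setReg, hr2])))))
  refine ⟨_, _, _, .seq hE (.seq hE' key), by omega, by omega, ?_⟩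
  rw [State.store_setMem, State.store_setReg_odd _ 0, State.store_setReg_odd _ 2,
    State.store_setReg_odd _ 0, State.store_setReg_odd _ 2, hst']
  refine ⟨⟨hb.1, fun b j => ?_⟩, H⟩
  by_cases h1 : b = a
  · subst h1
    by_cases h2 : j = i.eval σ.store
    · simpa [h2] using hlt
    · simpa [h2] using hb.2 _ _
  · simpa [h1] using hb.2 _ _

/-- The index of the invariant bounds the number of iterations still to come: a successful test
forces it to be a successor, so termination and cost follow from one induction. The tests are
evaluated anew after each iteration because the body may overwrite registers `1` and `3`. -/
theorem wp_whl (hN : 1 < N) (hK : 16 ≤ K) {e₁ e₂ : Expr} {c : Cmd} {T G : ℕ} {Q : Store → Prop}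
    (I : ℕ → Store → Prop) (n : ℕ) {h : Store}
    (hs₁ : e₁.size A ≤ K) (hs₂ : e₂.size A ≤ K) (hg₁ : e₁.gcds = 0) (hg₂ : e₂.gcds = 0)
    (h0 : I n h)
    (hbody : ∀ n h, I n h → e₁.eval h < e₂.eval h → ∃ n', n = n' + 1 ∧ wp N A K c T G (I n') h)
    (hend : ∀ n h, I n h → e₂.eval h ≤ e₁.eval h → Q h) :
    wp N A K (whl e₁ e₂ c) ((n + 1) * (T + e₁.cost + e₂.cost + 1)) (n * G) Q h := by
  have tests : ∀ σ : State, σ.store.Bdd (N ^ A) → ∃ σm σ',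
      Exec (N ^ K) [] (e₁.compile 0) σ σm e₁.cost 0 ∧
      Exec (N ^ K) [] (e₂.compile 1) σm σ' e₂.cost 0 ∧ σ'.store = σ.store ∧
      σ'.reg 1 = e₁.eval σ.store ∧ σ'.reg 3 = e₂.eval σ.store := by
    intro σ hb
    obtain ⟨-, σ₁, hE, hst, hr, -⟩ := e₁.exec_compile hN hK [] 0 σ hb hs₁
    obtain ⟨-, σ₂, hE', hst', hr', hj'⟩ := e₂.exec_compile hN hK [] 1 σ₁ (by rwa [hst]) hs₂
    rw [hst] at hst' hr'
    rw [hg₁] at hE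
    rw [hg₂] at hE'
    refine ⟨σ₁, σ₂, hE, hE', hst', ?_, hr'⟩
    · have := hj' 0 (by omega)
      simp only [mul_zero, zero_add] at this hr
      rw [this, hr]
  have loop : ∀ n (h : Store) (σ : State), I n h → σ.store = h → h.Bdd (N ^ A) →
      σ.reg 1 = e₁.eval h → σ.reg 3 = e₂.eval h → ∃ σ' t g, Exec (N ^ K) []
        (.whileLt 1 3 (.seq c (.seq (e₁.compile 0) (e₂.compile 1)))) σ σ' t g ∧
        t ≤ n * (T + e₁.cost + e₂.cost + 1) + 1 ∧ g ≤ n * G ∧ σ'.store.Bdd (N ^ A) ∧ Q σ'.store := by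
    intro n
    induction n with
    | zero =>
      rintro h σ hI rfl hb h1 h3
      by_cases hlt : e₁.eval σ.store < e₂.eval σ.store
      · obtain ⟨n', h', -⟩ := hbody 0 _ hI hlt
        omega
      · exact ⟨σ, _, _, .whileFalse (by rw [h1, h3]; omega), by omega, by omega, hb,
          hend _ _ hI (by omega)⟩
    | succ n ih =>
      rintro h σ hI rfl hb h1 h3
      by_cases hlt : e₁.eval σ.store < e₂.eval σ.store
      · obtain ⟨n', h', hwp⟩ := hbody _ _ hI hlt
        obtain rfl : n = n' := by omega
        obtain ⟨σ₁, t, g, hE, ht, hg, hb₁, hI₁⟩ := hwp σ rfl hb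
        obtain ⟨σm, σ₂, hEm, hE₂, hst₂, hr1, hr3⟩ := tests σ₁ hb₁
        rw [← hst₂] at hr1 hr3 hI₁ hb₁
        obtain ⟨σ₃, t', g', hE₃, ht', hg', hb₃, hQ⟩ := ih _ σ₂ hI₁ rfl hb₁ hr1 hr3
        refine ⟨σ₃, _, _, .whileTrue (by rw [h1, h3]; exact hlt) (.seq hE (.seq hEm hE₂)) hE₃, ?_, ?_, hb₃, hQ⟩
        · rw [add_mul]; omega
        · rw [add_mul]; omega
      · exact ⟨σ, _, _, .whileFalse (by rw [h1, h3]; omega), by omega, by omega, hb,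
          hend _ _ hI (by omega)⟩
  rintro σ rfl hb
  obtain ⟨σm, σ₁, hEm, hE, hst, hr1, hr3⟩ := tests σ hb
  rw [← hst] at hr1 hr3 h0 hb
  obtain ⟨σ', t, g, hE', ht, hg, hb', hQ⟩ := loop n _ σ₁ h0 rfl hb hr1 hr3
  refine ⟨σ', _, _, .seq hEm (.seq hE hE'), ?_, ?_, hb', hQ⟩
  · rw [add_mul]; omega
  · omega

/-! ### Tables of sums -/

/-- `for i < U do a[i] := (∑ j < V, e) mod r`, with `i` in variable `14`, `j` in variable `15`
and `r` the value of the variable `md`. -/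
def sumTo (a : Fin 16) (U V : Expr) (md : ℕ) (e : Expr) : Cmd :=
  .seq (whl (.var 14) U (.seq
    (whl (.var 15) V (.seq (asg 16 ((.var 16 + e) % .var md)) (asg 15 (.var 15 + 1))))
    (.seq (sto a (.var 14) (.var 16)) (.seq (asg 15 0) (.seq (asg 16 0)
      (asg 14 (.var 14 + 1))))))) (asg 14 0)

/-- The store during the execution of `sumTo`. -/
def Store.during (h : Store) (a : Fin 16) (z k acc : ℕ) (B : ℕ → ℕ) : Store :=
  ⟨fun y => if y = 14 then z else if y = 15 then k else if y = 16 then acc else h.v y,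
    Function.update h.arr a B⟩

/-- All table computations below have this shape, so the double loop is verified once. Since `hU`,
`hV` and `he` quantify over the accumulator and the contents `B` of the target array, the
expressions may not depend on what is being written. The loop variables are zero before and after,
which makes the net effect a change of a single array. -/
theorem wp_sumTo (hN : 1 < N) {a : Fin 16} {U V : Expr} {md : ℕ} {e : Expr}
    {Q : Store → Prop} {h : Store} (u w : ℕ) (τ : ℕ → ℕ → ℕ) (T : ℕ)
    (hK : U.size A + V.size A + e.size A + 2 * A + 20 ≤ K)
    (hgU : U.gcds = 0) (hgV : V.gcds = 0) (hge : e.gcds = 0) (hmd : md < 14) (hmd0 : 0 < h.v md)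
    (h14 : h.v 14 = 0) (h15 : h.v 15 = 0) (h16 : h.v 16 = 0)
    (hU : ∀ z k acc B, U.eval (h.during a z k acc B) = u)
    (hV : ∀ z k acc B, V.eval (h.during a z k acc B) = w)
    (he : ∀ z < u, ∀ k < w, ∀ acc B, e.eval (h.during a z k acc B) = τ z k)
    (hu : u < N ^ A) (hw : w < N ^ A)
    (hT : (u + 1) * (w + 1) * (U.cost + V.cost + e.cost + 40) ≤ T)
    (H : Q ⟨h.v, Function.update h.arr a fun z =>
      if z < u then (∑ k ∈ Finset.range w, τ z k) % h.v md else h.arr a z⟩) :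
    wp N A K (sumTo a U V md e) T 0 Q h := by
  apply wp_bdd
  intro hb
  have hK' : 16 ≤ K := by omega
  have hpos : 0 < N ^ A := Nat.pow_pos (by omega)
  have during_eq : ∀ {v : ℕ → ℕ} {B : ℕ → ℕ} {z k acc : ℕ}, v 14 = z → v 15 = k → v 16 = acc →
      (∀ y, y ≠ 14 → y ≠ 15 → y ≠ 16 → v y = h.v y) →
      (⟨v, Function.update h.arr a B⟩ : Store) = h.during a z k acc B := by
    intro v B z k acc h1 h2 h3 h4
    simp only [Store.during, Store.mk.injEq, and_true]
    funext y
    split_ifs with e1 e2 e3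
    · rw [e1, h1]
    · rw [e2, h2]
    · rw [e3, h3]
    · exact h4 y e1 e2 e3
  have hmdv : ∀ z k acc B, (h.during a z k acc B).v md = h.v md := by
    intro z k acc B
    simp [Store.during, show md ≠ 14 by omega, show md ≠ 15 by omega, show md ≠ 16 by omega]
  have hinit : h = h.during a 0 0 0 (h.arr a) := by
    rw [← during_eq h14 h15 h16 (fun _ _ _ _ => rfl), Function.update_eq_self]
  set S : ℕ → ℕ := fun z => (∑ k ∈ Finset.range w, τ z k) % h.v md with hS
  have inner : ∀ z < u, ∀ B (Q' : Store → Prop), Q' (h.during a z w (S z) B) →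
      wp N A K (whl (.var 15) V (.seq (asg 16 ((.var 16 + e) % .var md)) (asg 15 (.var 15 + 1))))
        ((w + 1) * (V.cost + e.cost + 13)) 0 Q' (h.during a z 0 0 B) := by
    intro z hz B Q' hQ'
    refine wp_mono (wp_whl hN hK' (G := 0) (T := (e.cost + 5) + 4) (Q := Q') (fun n h' => ∃ k, k + n = w ∧
      h' = h.during a z k ((∑ j ∈ Finset.range k, τ z j) % h.v md) B) w ?_ (by omega) rfl hgV
      ⟨0, by omega, by simp⟩ ?_ ?_) ?_ (by omega) (fun _ h => h)
    · simp only [Expr.size]; omega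
    · rintro n h' ⟨k, hk, rfl⟩ hlt
      rw [hV] at hlt
      have hlt' : k < w := by simpa [Store.during] using hlt
      obtain ⟨n', rfl⟩ : ∃ n', n = n' + 1 := ⟨n - 1, by omega⟩
      refine ⟨n', rfl, ?_⟩
      have hval : ((.var 16 + e) % .var md : Expr).eval
          (h.during a z k ((∑ j ∈ Finset.range k, τ z j) % h.v md) B) =
          (∑ j ∈ Finset.range (k + 1), τ z j) % h.v md := by
        simp only [Expr.eval_mod, Expr.eval_add, he z hz k hlt', Expr.eval_var, hmdv]
        simp only [Store.during]
        rw [Finset.sum_range_succ]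
        simp
      refine wp_mono (wp_seq (wp_asg hN hK' (e := (.var 16 + e) % .var md) ?_ ?_ (wp_asg hN hK'
        (e := .var 15 + 1) ?_ ?_ ?_))) ?_ ?_ (fun _ h => h)
      · change A + e.size A + 1 + A + 1 ≤ K; omega
      · rw [hval]; exact (Nat.mod_lt _ hmd0).trans (hb.1 md)
      · change A + 1 + 1 ≤ K; omega
      · simp [Store.during]; omega
      · refine ⟨k + 1, by omega, ?_⟩
        rw [hval]
        apply during_eq
        · simp [Store.during]
        · simp [Store.during]
        · simp [Store.during]
        · intro y h1 h2 h3
          simp [Store.during, h1, h2, h3]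
      · change (1 + e.cost + 1 + 1 + 1 + 1) + (1 + 1 + 1 + 1) ≤ _; omega
      · change 0 + e.gcds + 0 + 0 + 0 + 0 ≤ 0; omega
    · rintro n h' ⟨k, hk, rfl⟩ hle
      rw [hV] at hle
      have hle' : w ≤ k := by simpa [Store.during] using hle
      obtain rfl : k = w := by omega
      exact hQ'
    · apply Nat.mul_le_mul_left
      simp only [Expr.cost]; omega
  set B : ℕ → ℕ → ℕ := fun m z => if z < m then S z else h.arr a z with hB
  refine wp_mono (wp_seq (wp_whl hN hK' (G := 0) (T := (w + 1) * (V.cost + e.cost + 13) + (7 + (2 + (2 + 4))))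
    (Q := wp N A K (asg 14 0) 2 0 Q)
    (fun n h' => ∃ z, z + n = u ∧ h' = h.during a z 0 0 (B z)) u ?_ (by omega) rfl hgU
    ⟨0, by omega, ?_⟩ ?_ ?_)) ?_ (by omega) (fun _ h => h)
  · simp only [Expr.size]; omega
  · have : B 0 = h.arr a := by funext z; simp [hB]
    rw [this]
    exact hinit
  · rintro n h' ⟨z, hz, rfl⟩ hlt
    rw [hU] at hlt
    have hlt' : z < u := by simpa [Store.during] using hlt
    obtain ⟨n', rfl⟩ : ∃ n', n = n' + 1 := ⟨n - 1, by omega⟩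
    refine ⟨n', rfl, ?_⟩
    refine wp_mono (wp_seq (inner z hlt' _ _ (wp_seq (wp_sto hN hK' (a := a) (i := .var 14) (e := .var 16) ?_ ?_ ?_
      (wp_seq (wp_asg hN hK' (e := 0) ?_ ?_ (wp_seq (wp_asg hN hK' (e := 0) ?_ ?_ (wp_asg hN hK'
        (e := .var 14 + 1) ?_ ?_ ?_))))))))) le_rfl le_rfl (fun _ h => h)
    · change A + 4 ≤ K; omega
    · change A ≤ K; omega
    · simpa [Store.during, hS] using (Nat.mod_lt _ hmd0).trans (hb.1 md)
    · change 0 ≤ K; omega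
    · exact hpos
    · change 0 ≤ K; omega
    · exact hpos
    · change A + 1 + 1 ≤ K; omega
    · simp [Store.during]; omega
    · refine ⟨z + 1, by omega, ?_⟩
      have hBz : Function.update (B z) z (S z) = B (z + 1) := by
        funext y
        simp only [hB, Function.update_apply]
        by_cases hy : y = z
        · simp [hy]
        · simp only [hy, if_false]
          congr 1
          simp only [eq_iff_iff]; omega
      rw [← hBz]
      simp only [Store.during, Function.update_self, Function.update_idem, Expr.eval_var, if_true]
      apply during_eq
      · simp
      · simp
      · simp
      · intro y h1 h2 h3
        simp [h1, h2, h3]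
  · rintro n h' ⟨z, hz, rfl⟩ hle
    rw [hU] at hle
    have hle' : u ≤ z := by simpa [Store.during] using hle
    obtain rfl : z = u := by omega
    refine wp_asg hN hK' (e := 0) (Nat.zero_le _) hpos ?_
    have hv : Function.update (h.during a z 0 0 (B z)).v 14 (Expr.eval 0 (h.during a z 0 0 (B z))) =
        h.v := ?_
    · rw [hv]; exact H
    funext y
    simp only [Store.during, Function.update_apply, Expr.eval_zero]
    split_ifs with e1 e2 e3
    · rw [e1, h14]
    · rw [e2, h15]
    · rw [e3, h16]
    · rfl
  · refine le_trans ?_ hT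
    change (u + 1) * ((w + 1) * (V.cost + e.cost + 13) + (7 + (2 + (2 + 4))) + 1 + U.cost + 1) + 2 ≤ _
    have h1 : (w + 1) * (V.cost + e.cost + 13) + (7 + (2 + (2 + 4))) + 1 + U.cost + 1 + 2 ≤
      (w + 1) * (U.cost + V.cost + e.cost + 40) := by
      have : (w + 1) * (U.cost + V.cost + e.cost + 40) =
        (w + 1) * (V.cost + e.cost + 13) + w * (U.cost + 27) + U.cost + 27 := by ring
      omega
    calc _ ≤ (u + 1) * ((w + 1) * (V.cost + e.cost + 13) + (7 + (2 + (2 + 4))) + 1 + U.cost + 1 + 2)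
          := by rw [Nat.mul_add (u + 1) _ 2]; omega
      _ ≤ _ := by rw [mul_assoc]; exact Nat.mul_le_mul_left _ h1

end wp

end WordRAM

/-! ## Multiplication of polynomials by iterated transforms of short length -/

namespace BlockTransform

open Polynomial

section Semiring

variable {R : Type*} [CommSemiring R]

/-- The polynomial with coefficients `w 0, …, w (n - 1)`. -/
noncomputable def arrPoly (n : ℕ) (w : ℕ → R) : R[X] := ∑ i ∈ Finset.range n, C (w i) * X ^ i

theorem coeff_arrPoly (n : ℕ) (w : ℕ → R) (i : ℕ) :
    (arrPoly n w).coeff i = if i < n then w i else 0 := by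
  simp [arrPoly, coeff_C_mul, coeff_X_pow]

theorem arrPoly_congr {n : ℕ} {w w' : ℕ → R} (h : ∀ i < n, w i = w' i) :
    arrPoly n w = arrPoly n w' :=
  Finset.sum_congr rfl fun i hi => by rw [h i (Finset.mem_range.1 hi)]

theorem arrPoly_inj {n : ℕ} {w w' : ℕ → R} (h : arrPoly n w = arrPoly n w') {i : ℕ} (hi : i < n) :
    w i = w' i := by
  have := congrArg (fun p => p.coeff i) h
  simpa [coeff_arrPoly, hi] using this

theorem arrPoly_zero (n : ℕ) : arrPoly n (fun _ => (0 : R)) = 0 := by simp [arrPoly]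

theorem arrPoly_add (n : ℕ) (w w' : ℕ → R) :
    arrPoly n (fun i => w i + w' i) = arrPoly n w + arrPoly n w' := by
  simp [arrPoly, add_mul, Finset.sum_add_distrib]

theorem arrPoly_sum {ι : Type*} (s : Finset ι) (n : ℕ) (w : ι → ℕ → R) :
    arrPoly n (fun i => ∑ k ∈ s, w k i) = ∑ k ∈ s, arrPoly n (w k) := by
  simp only [arrPoly, map_sum, Finset.sum_mul]
  exact Finset.sum_comm

theorem arrPoly_C_mul (n : ℕ) (c : R) (w : ℕ → R) :
    arrPoly n (fun i => c * w i) = C c * arrPoly n w := by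
  simp [arrPoly, Finset.mul_sum, mul_assoc]

theorem arrPoly_mul_len (H q : ℕ) (w : ℕ → R) :
    arrPoly (H * q) w = ∑ i ∈ Finset.range H, X ^ (i * q) * arrPoly q fun x => w (i * q + x) := by
  induction H with
  | zero => simp [arrPoly]
  | succ H ih =>
    rw [Finset.sum_range_succ, ← ih, add_mul, one_mul, arrPoly, Finset.sum_range_add, arrPoly, arrPoly,
      Finset.mul_sum]
    congr 1
    refine Finset.sum_congr rfl fun i _ => ?_
    rw [pow_add]; ring

theorem arrPoly_two_mul (q : ℕ) (w : ℕ → R) :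
    arrPoly (2 * q) w = arrPoly q w + X ^ q * arrPoly q fun x => w (q + x) := by
  rw [arrPoly_mul_len]
  simp [Finset.sum_range_succ]

theorem arrPoly_map {S : Type*} [CommSemiring S] (f : R →+* S) (n : ℕ) (w : ℕ → R) :
    (arrPoly n w).map f = arrPoly n fun i => f (w i) := by
  simp [arrPoly, Polynomial.map_sum]

theorem degree_arrPoly_lt (n : ℕ) (w : ℕ → R) : (arrPoly n w).degree < n := by
  rw [degree_lt_iff_coeff_zero]
  intro m hm
  rw [coeff_arrPoly, if_neg (by omega)]

/-- Adding up `U` overlapping blocks of length `2 * q` at distance `q`, the last of which has length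
`q` only. -/
theorem arrPoly_overlap {U q : ℕ} (hq : 0 < q) (β : ℕ → ℕ → R)
    (hβ : ∀ x < q, β (U - 1) (q + x) = 0) :
    arrPoly (U * q) (fun z => β (z / q) (z % q) + β ((z / q + (U - 1)) % U) (q + z % q)) =
      ∑ u ∈ Finset.range U, X ^ (u * q) * arrPoly (2 * q) (β u) := by
  rcases U with _ | U
  · simp [arrPoly]
  rw [arrPoly_mul_len]
  have h1 : ∀ u, arrPoly q (fun x => β ((u * q + x) / q) ((u * q + x) % q) +
      β (((u * q + x) / q + (U + 1 - 1)) % (U + 1)) (q + (u * q + x) % q)) =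
      arrPoly q (β u) + arrPoly q fun x => β ((u + U) % (U + 1)) (q + x) := by
    intro u
    rw [← arrPoly_add]
    refine arrPoly_congr fun x hx => ?_
    rw [mul_comm u q, Nat.mul_add_div hq, Nat.mul_add_mod, Nat.div_eq_of_lt hx, Nat.mod_eq_of_lt hx]
    simp
  simp only [h1, arrPoly_two_mul, mul_add, Finset.sum_add_distrib]
  congr 1
  -- The upper half of block `u` lands at position `u + 1`. The cyclic index sends the upper half of
  -- the last block to position `0`, where it vanishes by `hβ`.
  rw [Finset.sum_range_succ', Finset.sum_range_succ]
  have h0 : (arrPoly q fun x => β U (q + x)) = 0 := by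
    rw [← arrPoly_zero]
    exact arrPoly_congr fun x hx => hβ x hx
  rw [show (0 + U) % (U + 1) = U by rw [zero_add]; exact Nat.mod_eq_of_lt (by omega), h0]
  simp only [mul_zero, add_zero]
  refine Finset.sum_congr rfl fun u hu => ?_
  have hu' := Finset.mem_range.1 hu
  rw [show (u + 1 + U) % (U + 1) = u by
    rw [show u + 1 + U = u + (U + 1) by ring, Nat.add_mod_right]; exact Nat.mod_eq_of_lt (by omega)]
  rw [← mul_assoc, ← pow_add, add_mul, one_mul]

end Semiring

/-! ### Transforms of length `K` acting on blocks -/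

section Ring

variable {R : Type*} [CommRing R]

/-- A power-of-two order root of `-1` is a principal root of unity. -/
theorem sum_pow_eq_zero (l : ℕ) (θ : R) (hθ : θ ^ 2 ^ l = -1) (e : ℕ) (he : ¬ 2 ^ (l + 1) ∣ e) :
    ∑ k ∈ Finset.range (2 ^ (l + 1)), θ ^ (k * e) = 0 := by
  induction l generalizing θ e with
  | zero =>
    have : Odd e := by
      rw [← Nat.not_even_iff_odd, even_iff_two_dvd]; simpa using he
    simp only [pow_zero, pow_one] at hθ
    simp [Finset.sum_range_succ, hθ, this.neg_one_pow]
  | succ l ih =>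
    rcases Nat.even_or_odd e with ⟨f, rfl⟩ | hodd
    · have h2 : (θ ^ 2) ^ 2 ^ l = -1 := by rw [← pow_mul, ← pow_succ', hθ]
      have := ih (θ ^ 2) h2 f (fun h => he (by
        rw [pow_succ, ← two_mul, mul_comm]; exact Nat.mul_dvd_mul_left 2 h))
      have hp : ∀ k, θ ^ (k * (f + f)) = (θ ^ 2) ^ (k * f) := by
        intro k; rw [← pow_mul]; congr 1; ring
      rw [pow_succ, mul_two, Finset.sum_range_add]
      simp only [hp]
      rw [this, zero_add, ← this]
      refine Finset.sum_congr rfl fun k _ => ?_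
      rw [add_mul, pow_add]
      have : (θ ^ 2) ^ (2 ^ (l + 1) * f) = 1 := by
        rw [pow_mul, pow_succ 2 l, pow_mul, h2]; simp
      rw [this, one_mul]
    · rw [pow_succ, mul_two, Finset.sum_range_add, ← Finset.sum_add_distrib]
      refine Finset.sum_eq_zero fun k _ => ?_
      rw [add_mul, pow_add, pow_mul θ (2 ^ (l + 1)), hθ, hodd.neg_one_pow]
      ring

/-- One forward pass: every block of length `H * q` is replaced by `K` blocks of length `q`. -/
def forward (θ : R) (H K q : ℕ) (a : ℕ → R) (j : ℕ) : R :=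
  ∑ i ∈ Finset.range H, θ ^ (j / q % K * (K - i)) * a (j / q / K * (H * q) + i * q + j % q)

/-- One backward pass: `K` blocks of length `2 * q` are combined into one block of length
`K * q`. -/
def backward (θ : R) (K q : ℕ) (b : ℕ → R) (j : ℕ) : R :=
  ∑ k ∈ Finset.range K,
    (θ ^ (k * (j % (K * q) / q)) * b ((j / (K * q) * K + k) * (2 * q) + j % (K * q) % q) +
    θ ^ (k * (j % (K * q) / q + (K - 1))) *
      b ((j / (K * q) * K + k) * (2 * q) + q + j % (K * q) % q))

/-- The blocks of length `2 * q` of `b` are `c` times the products of the blocks of length `q` of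
`a` and `g`. -/
def BlockProd (c : R) (q nb : ℕ) (a g b : ℕ → R) : Prop :=
  ∀ blk < nb, arrPoly (2 * q) (fun x => b (blk * (2 * q) + x)) =
    C c * (arrPoly q (fun x => a (blk * q + x)) * arrPoly q (fun x => g (blk * q + x)))

/-- Unnormalised Fourier inversion: summing over `k` first leaves the sum of `θ ^ (k * (u - i -
j))`, which is `K` or `0`. As `i + j < 2 * H = K`, different values of `i + j` are not identified
modulo `K`, so the cyclic convolution is the true product. -/
theorem transform_product {θ : R} {H K : ℕ} (hK : K = 2 * H) (hθ : θ ^ K = 1)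
    (hsum : ∀ e, ¬ K ∣ e → ∑ k ∈ Finset.range K, θ ^ (k * e) = 0) (a g : ℕ → R[X]) {u : ℕ}
    (hu : u < K) :
    ∑ k ∈ Finset.range K, C (θ ^ (k * u)) * ((∑ i ∈ Finset.range H, C (θ ^ (k * (K - i))) * a i) *
      ∑ j ∈ Finset.range H, C (θ ^ (k * (K - j))) * g j) =
    C (K : R) * ∑ i ∈ Finset.range H, ∑ j ∈ Finset.range H, if i + j = u then a i * g j else 0 := by
  have h1 : ∀ k, C (θ ^ (k * u)) * ((∑ i ∈ Finset.range H, C (θ ^ (k * (K - i))) * a i) *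
      ∑ j ∈ Finset.range H, C (θ ^ (k * (K - j))) * g j) =
      ∑ i ∈ Finset.range H, ∑ j ∈ Finset.range H,
        C (θ ^ (k * (u + (K - i) + (K - j)))) * (a i * g j) := by
    intro k
    rw [Finset.sum_mul_sum, Finset.mul_sum]
    refine Finset.sum_congr rfl fun i _ => ?_
    rw [Finset.mul_sum]
    refine Finset.sum_congr rfl fun j _ => ?_
    rw [mul_add, mul_add, pow_add, pow_add, C_mul, C_mul]
    ring
  simp only [h1]
  rw [Finset.sum_comm, Finset.mul_sum]
  refine Finset.sum_congr rfl fun i hi => ?_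
  rw [Finset.sum_comm, Finset.mul_sum]
  refine Finset.sum_congr rfl fun j hj => ?_
  rw [← Finset.sum_mul, ← map_sum]
  have hi' := Finset.mem_range.1 hi
  have hj' := Finset.mem_range.1 hj
  split_ifs with h
  · congr 2
    have : u + (K - i) + (K - j) = K * 2 := by omega
    rw [this]
    simp [mul_comm _ (K * 2), mul_assoc, pow_mul, hθ]
  · rw [hsum, C_0, zero_mul, mul_zero]
    rintro ⟨m, hm⟩
    apply h
    -- The exponent lies strictly between `K` and `3 * K`, because `i, j < H` and `u < K`.
    have h2 : m = 2 := by
      have l1 : K * 1 < K * m := by omega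
      have l2 : K * m < K * 3 := by omega
      have := Nat.lt_of_mul_lt_mul_left l1
      have := Nat.lt_of_mul_lt_mul_left l2
      omega
    subst h2
    omega

/-- One level of the recursion. A block of length `H * q` is a polynomial of length `H` in `X ^ q`,
and the forward pass evaluates it at `K` powers of `θ`. Transforming the products of the values back
gives the coefficients of the product; they have length `2 * q` and are added up at distance `q`.
The price is one more factor `K`. -/
theorem BlockProd.backward {θ : R} {H K q nb : ℕ} (hK : K = 2 * H) (hH : 0 < H) (hq : 0 < q)
    (hθ : θ ^ K = 1) (hsum : ∀ e, ¬ K ∣ e → ∑ k ∈ Finset.range K, θ ^ (k * e) = 0) {c : R}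
    {a g b : ℕ → R}
    (h : BlockProd c q (nb * K) (forward θ H K q a) (forward θ H K q g) b) :
    BlockProd (c * K) (H * q) nb a g (backward θ K q b) := by
  intro blk hblk
  have hK0 : 0 < K := by omega
  have hKq : 0 < K * q := Nat.mul_pos hK0 hq
  set β : ℕ → ℕ → R := fun u x => ∑ k ∈ Finset.range K, θ ^ (k * u) * b ((blk * K + k) * (2 * q) + x)
    with hβ
  have fwd : ∀ (a : ℕ → R), ∀ k < K, arrPoly q (fun x => forward θ H K q a ((blk * K + k) * q + x)) =
      ∑ i ∈ Finset.range H, C (θ ^ (k * (K - i))) *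
        arrPoly q fun x => a (blk * (H * q) + (i * q + x)) := by
    intro a k hk
    simp only [← arrPoly_C_mul]
    rw [← arrPoly_sum]
    refine arrPoly_congr fun x hx => ?_
    rw [forward, mul_comm (blk * K + k) q, Nat.mul_add_div hq, Nat.mul_add_mod, Nat.div_eq_of_lt hx,
      Nat.mod_eq_of_lt hx, add_zero, mul_comm blk K, Nat.mul_add_div hK0, Nat.mul_add_mod,
      Nat.div_eq_of_lt hk, Nat.mod_eq_of_lt hk]
    simp only [add_zero, add_assoc]
  set e : ℕ → R[X] := fun u => ∑ i ∈ Finset.range H, ∑ j ∈ Finset.range H, if i + j = u then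
      (arrPoly q fun x => a (blk * (H * q) + (i * q + x))) *
      (arrPoly q fun x => g (blk * (H * q) + (j * q + x))) else 0 with he
  have hψ : ∀ u < K, arrPoly (2 * q) (β u) = C (c * K) * e u := by
    intro u hu
    rw [hβ, arrPoly_sum]
    simp only [arrPoly_C_mul]
    rw [C_mul, mul_assoc, he, ← transform_product hK hθ hsum _ _ hu, Finset.mul_sum]
    refine Finset.sum_congr rfl fun k hk => ?_
    have hk' := Finset.mem_range.1 hk
    have hlt : blk * K + k < nb * K := by
      have : (blk + 1) * K ≤ nb * K := Nat.mul_le_mul_right _ hblk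
      rw [add_mul] at this; omega
    rw [h _ hlt, fwd a k hk', fwd g k hk']
    ring
  -- The product has only `2 * H - 1 = K - 1` coefficients in `X ^ q`, so the last block is zero and
  -- nothing overflows.
  have hlast : ∀ x < q, β (K - 1) (q + x) = 0 := by
    intro x hx
    have h0 : e (K - 1) = 0 := by
      refine Finset.sum_eq_zero fun i hi => Finset.sum_eq_zero fun j hj => ?_
      have hi' := Finset.mem_range.1 hi
      have hj' := Finset.mem_range.1 hj
      rw [if_neg (by omega)]
    have := hψ (K - 1) (by omega)
    rw [h0, mul_zero, ← arrPoly_zero (2 * q)] at this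
    exact arrPoly_inj this (by omega)
  -- The backward pass writes `u - 1` as `u + (K - 1)` without reducing it modulo `K`; periodicity
  -- makes up for this.
  have hper : ∀ u x, β (u % K) x = β u x := by
    intro u x
    refine Finset.sum_congr rfl fun k _ => ?_
    congr 1
    conv_rhs => rw [← Nat.mod_add_div u K]
    rw [mul_add, pow_add, mul_left_comm, pow_mul θ K, hθ, one_pow, mul_one]
  have key := arrPoly_overlap (U := K) hq β hlast
  have hb : arrPoly (2 * (H * q)) (fun x => BlockTransform.backward θ K q b (blk * (2 * (H * q)) + x)) =
      arrPoly (K * q) (fun z => β (z / q) (z % q) + β ((z / q + (K - 1)) % K) (q + z % q)) := by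
    rw [show 2 * (H * q) = K * q by rw [hK]; ring]
    refine arrPoly_congr fun z hz => ?_
    rw [hper, BlockTransform.backward, mul_comm blk (K * q), Nat.mul_add_div hKq, Nat.mul_add_mod,
      Nat.div_eq_of_lt hz, Nat.mod_eq_of_lt hz, add_zero, Finset.sum_add_distrib]
    simp only [hβ, add_assoc]
  rw [hb, key, Finset.sum_congr rfl (fun u hu => by rw [hψ u (Finset.mem_range.1 hu)]),
    arrPoly_mul_len, arrPoly_mul_len, Finset.sum_mul_sum]
  simp only [he, Finset.mul_sum]
  rw [Finset.sum_comm]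
  refine Finset.sum_congr rfl fun i hi => ?_
  rw [Finset.sum_comm]
  refine Finset.sum_congr rfl fun j hj => ?_
  have hi' := Finset.mem_range.1 hi
  have hj' := Finset.mem_range.1 hj
  rw [Finset.sum_eq_single (i + j)]
  · rw [if_pos rfl, add_mul, pow_add]; ring
  · intro u _ hu
    rw [if_neg (Ne.symm hu), mul_zero, mul_zero]
  · intro hn
    exact absurd (Finset.mem_range.2 (by omega)) hn

end Ring

end BlockTransform

namespace BlockTransform

open Polynomial

/-! ### Ring elements as blocks of words -/

section Words

variable {R : Type*} [CommRing R]

/-- The element of a ring with a `K`-th root `y` of `-1` given by the `j`-th block of `K` words. -/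
def rep (y : R) (K : ℕ) (F : ℕ → ℕ) (j : ℕ) : R :=
  ∑ c ∈ Finset.range K, (F (j * K + c) : R) * y ^ c

/-- The `c`-th word of a block multiplied by `y ^ (-e)`. -/
def rotWord (M K : ℕ) (F : ℕ → ℕ) (base e c : ℕ) : ℕ :=
  (1 + (M - 2) * ((c + e) % (2 * K) / K)) * F (base + (c + e) % (2 * K) % K)

theorem cast_mod_eq {M : ℕ} (hM : (M : R) = 0) (x : ℕ) : ((x % M : ℕ) : R) = x := by
  conv_rhs => rw [← Nat.mod_add_div x M]
  push_cast
  rw [hM]; ring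

/-- The sign is the natural number `1 + (M - 2) = M - 1` on the second half of a period `2 * K`;
moving by `K` exchanges the halves. -/
theorem rotWord_add {M K : ℕ} (hM : (M : R) = 0) (hM2 : 2 ≤ M) (hK : 0 < K) (F : ℕ → ℕ)
    (base e c : ℕ) :
    (rotWord M K F base e (c + K) : R) = - rotWord M K F base e c := by
  have hcast : ((M - 2 : ℕ) : R) = -2 := by rw [Nat.cast_sub hM2, hM]; simp
  have hlt : (c + e) % (2 * K) < 2 * K := Nat.mod_lt _ (by omega)
  have h1 : (c + K + e) % (2 * K) = ((c + e) % (2 * K) + K) % (2 * K) := by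
    rw [show c + K + e = (c + e) + K by ring]; simp
  unfold rotWord
  rw [h1]
  rcases lt_or_ge ((c + e) % (2 * K)) K with h | h
  · rw [Nat.mod_eq_of_lt (a := _ + K) (by omega), Nat.add_mod_right, Nat.add_div_right _ hK,
      Nat.div_eq_of_lt h]
    push_cast
    rw [hcast]; ring
  · obtain ⟨t, ht⟩ : ∃ t, (c + e) % (2 * K) = t + K := ⟨(c + e) % (2 * K) - K, by omega⟩
    rw [ht, show t + K + K = t + 2 * K by ring, Nat.add_mod_right, Nat.mod_eq_of_lt (b := 2 * K)
      (by omega), Nat.add_mod_right, Nat.add_div_right _ hK, Nat.div_eq_of_lt (by omega : t < K)]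
    push_cast
    rw [hcast]; ring

/-- `y ^ (2 * K - 1)` is the inverse of `y`. Dividing by `y` moves every word down one place and, by
`y ^ K = -1`, returns the lowest word at the top with its sign changed. Multiplying by a root of
unity is thus mere index arithmetic. -/
theorem rep_rotWord {M K : ℕ} {y : R} (hM : (M : R) = 0) (hM2 : 2 ≤ M) (hK : 0 < K)
    (hy : y ^ K = -1) (F : ℕ → ℕ) (j e : ℕ) :
    ∑ c ∈ Finset.range K, (rotWord M K F (j * K) e c : R) * y ^ c =
      (y ^ (2 * K - 1)) ^ e * rep y K F j := by
  have hinv : y ^ (2 * K - 1) * y = 1 := by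
    rw [← pow_succ, show 2 * K - 1 + 1 = K * 2 by omega, pow_mul, hy]; ring
  induction e with
  | zero =>
    rw [pow_zero, one_mul]
    refine Finset.sum_congr rfl fun c hc => ?_
    have hc' := Finset.mem_range.1 hc
    simp [rotWord, Nat.mod_eq_of_lt (show c < 2 * K by omega), Nat.div_eq_of_lt hc',
      Nat.mod_eq_of_lt hc']
  | succ e ih =>
    rw [pow_succ', mul_assoc, ← ih, Finset.mul_sum]
    obtain ⟨K, rfl⟩ : ∃ K', K = K' + 1 := ⟨K - 1, by omega⟩
    have hshift : ∀ c, rotWord M (K + 1) F (j * (K + 1)) (e + 1) c =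
        rotWord M (K + 1) F (j * (K + 1)) e (c + 1) := by
      intro c; simp only [rotWord, show c + (e + 1) = c + 1 + e by ring]
    rw [Finset.sum_range_succ, Finset.sum_range_succ']
    have h0 := rotWord_add hM hM2 hK F (j * (K + 1)) e 0
    rw [zero_add] at h0
    congr 1
    · refine Finset.sum_congr rfl fun c _ => ?_
      rw [hshift, pow_succ y c]
      linear_combination (-(rotWord M (K + 1) F (j * (K + 1)) e (c + 1) : R) * y ^ c) * hinv
    · rw [hshift, h0]
      have hy' : y ^ (2 * (K + 1) - 1) = - y ^ K := by
        rw [show 2 * (K + 1) - 1 = K + 1 + K by omega, pow_add, hy]; ring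
      rw [hy']; ring

variable {M K H q : ℕ} {y : R}

theorem rep_forward (hM : (M : R) = 0) (hM2 : 2 ≤ M) (hK : 0 < K) (hy : y ^ K = -1) (F F' : ℕ → ℕ)
    (j : ℕ) (hF : ∀ c < K, F' (j * K + c) = (∑ i ∈ Finset.range H, rotWord M K F
      ((j / q / K * (H * q) + i * q + j % q) * K) (2 * (j / q % K) * (K - i)) c) % M) :
    rep y K F' j = forward ((y ^ (2 * K - 1)) ^ 2) H K q (rep y K F) j := by
  unfold forward
  simp only [← pow_mul _ 2, ← mul_assoc 2]
  simp only [← rep_rotWord hM hM2 hK hy]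
  rw [Finset.sum_comm]
  refine Finset.sum_congr rfl fun c hc => ?_
  rw [hF c (Finset.mem_range.1 hc), cast_mod_eq hM, Nat.cast_sum, Finset.sum_mul]

theorem rep_backward (hM : (M : R) = 0) (hM2 : 2 ≤ M) (hK : 0 < K) (hy : y ^ K = -1) (F F' : ℕ → ℕ)
    (j : ℕ) (hF : ∀ c < K, F' (j * K + c) = (∑ k ∈ Finset.range K, (rotWord M K F
      (((j / (K * q) * K + k) * (2 * q) + j % (K * q) % q) * K) (2 * k * (j % (K * q) / q)) c +
      rotWord M K F (((j / (K * q) * K + k) * (2 * q) + q + j % (K * q) % q) * K)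
        (2 * k * (j % (K * q) / q + (K - 1))) c)) % M) :
    rep y K F' j = backward ((y ^ (2 * K - 1)) ^ 2) K q (rep y K F) j := by
  unfold backward
  simp only [← pow_mul _ 2, ← mul_assoc 2]
  simp only [← rep_rotWord hM hM2 hK hy, ← Finset.sum_add_distrib]
  rw [Finset.sum_comm]
  refine Finset.sum_congr rfl fun c hc => ?_
  rw [hF c (Finset.mem_range.1 hc), cast_mod_eq hM, Nat.cast_sum, Finset.sum_mul]
  simp only [Nat.cast_add, add_mul]

/-- The end of the recursion, where blocks are single ring elements. A product block has length `2`,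
so its second entry is a padding zero, supplied by the factor `1 - j % 2`. The product is a
combination of rotated copies of one factor; rotations realise negative powers of `y` only, so `y ^
a` appears as `y ^ (-(2 * K - a))`. -/
theorem blockProd_one (hM : (M : R) = 0) (hM2 : 2 ≤ M) (hK : 0 < K) (hy : y ^ K = -1)
    (F G P : ℕ → ℕ) (nb : ℕ)
    (hP : ∀ j < nb * 2, ∀ c < K, P (j * K + c) = (∑ a ∈ Finset.range K,
      F (j / 2 * K + a) * rotWord M K G (j / 2 * K) (2 * K - a) c * (1 - j % 2)) % M) :
    BlockProd (1 : R) 1 nb (rep y K F) (rep y K G) (rep y K P) := by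
  intro blk hblk
  have h1 : rep y K P (blk * 2 + 1) = 0 := by
    refine Finset.sum_eq_zero fun c hc => ?_
    rw [hP _ (by omega) c (Finset.mem_range.1 hc), show (blk * 2 + 1) % 2 = 1 by omega]
    simp
  have h0 : rep y K P (blk * 2) = rep y K F blk * rep y K G blk := by
    have : rep y K F blk * rep y K G blk = ∑ a ∈ Finset.range K, (F (blk * K + a) : R) *
        ((y ^ (2 * K - 1)) ^ (2 * K - a) * rep y K G blk) := by
      rw [rep, Finset.sum_mul]
      refine Finset.sum_congr rfl fun a ha => ?_
      have ha' := Finset.mem_range.1 ha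
      rw [mul_assoc]
      congr 2
      have h2 : y ^ (2 * K) = 1 := by rw [mul_comm, pow_mul, hy]; ring
      have h3 : y ^ a * (y ^ (2 * K - 1)) ^ a = 1 := by
        rw [← mul_pow, ← pow_succ', show 2 * K - 1 + 1 = 2 * K by omega, h2, one_pow]
      have h4 : (y ^ (2 * K - 1)) ^ (2 * K - a) * (y ^ (2 * K - 1)) ^ a = 1 := by
        rw [← pow_add, show 2 * K - a + a = 2 * K by omega, ← pow_mul, mul_comm, pow_mul, h2, one_pow]
      calc y ^ a = y ^ a * ((y ^ (2 * K - 1)) ^ (2 * K - a) * (y ^ (2 * K - 1)) ^ a) := by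
            rw [h4, mul_one]
        _ = (y ^ (2 * K - 1)) ^ (2 * K - a) * (y ^ a * (y ^ (2 * K - 1)) ^ a) := by ring
        _ = _ := by rw [h3, mul_one]
    rw [this]
    simp only [← rep_rotWord hM hM2 hK hy, Finset.mul_sum]
    rw [Finset.sum_comm]
    refine Finset.sum_congr rfl fun c hc => ?_
    rw [hP _ (by omega) c (Finset.mem_range.1 hc), cast_mod_eq hM,
      show blk * 2 % 2 = 0 by omega, show blk * 2 / 2 = blk by omega, Nat.cast_sum, Finset.sum_mul]
    simp [mul_assoc]
  simp only [arrPoly, Finset.sum_range_succ, Finset.sum_range_zero]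
  simp [h0, h1]

end Words

theorem BlockProd.congr {R : Type*} [CommRing R] {c : R} {q nb : ℕ} {a g b a' g' b' : ℕ → R}
    (h : BlockProd c q nb a g b) (ha : ∀ j < nb * q, a' j = a j) (hg : ∀ j < nb * q, g' j = g j)
    (hb : ∀ j < nb * (2 * q), b' j = b j) : BlockProd c q nb a' g' b' := by
  intro blk hblk
  have hlt : ∀ {q x : ℕ}, x < q → blk * q + x < nb * q := by
    intro q x hx
    have : (blk + 1) * q ≤ nb * q := Nat.mul_le_mul_right _ hblk
    rw [add_mul] at this; omega
  rw [arrPoly_congr fun x hx => hb _ (hlt hx), arrPoly_congr fun x hx => ha _ (hlt hx),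
    arrPoly_congr fun x hx => hg _ (hlt hx)]
  exact h blk hblk

/-- Factors of length `H` in the root have products of degree at most `2 * H - 2`, below the degree
of `f`. An identity modulo `f` is therefore an identity of polynomials, and substituting `X ^ H` for
the outer variable yields the product of the original polynomials, assembled from blocks of length
`2 * H` at distance `H`. -/
theorem recombine {M H Q S : ℕ} (hM2 : 2 ≤ M) (hH : 0 < H) (hQ : 0 < Q) (F U V : ℕ → ℕ)
    (f : (ZMod M)[X]) (hf : f = X ^ (2 * H) + 1)
    (h : BlockProd (S : AdjoinRoot f) Q 1
      (fun x => AdjoinRoot.mk f (arrPoly H fun c => (U (x * H + c) : ZMod M)))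
      (fun x => AdjoinRoot.mk f (arrPoly H fun c => (V (x * H + c) : ZMod M)))
      (rep (AdjoinRoot.root f) (2 * H) F)) (z : ℕ) (hz : z < 2 * Q * H) :
    ((F (z / H * (2 * H) + z % H) +
      F ((z / H + (2 * Q - 1)) % (2 * Q) * (2 * H) + (H + z % H)) : ℕ) : ZMod M) =
      S * (arrPoly (Q * H) (fun i => (U i : ZMod M)) *
        arrPoly (Q * H) (fun i => (V i : ZMod M))).coeff z := by
  have : Fact (1 < M) := ⟨hM2⟩
  have hfm : f.Monic := by
    rw [hf]
    have := monic_X_pow_add_C (1 : ZMod M) (show 2 * H ≠ 0 by omega)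
    rwa [C_1] at this
  have hfd : f.degree = (2 * H : ℕ) := by
    rw [hf]
    have := degree_X_pow_add_C (show 0 < 2 * H by omega) (1 : ZMod M)
    rwa [C_1] at this
  set W : ℕ → (ZMod M)[X] := fun x => arrPoly (2 * H) fun c => (F (x * (2 * H) + c) : ZMod M) with hW
  set a : ℕ → (ZMod M)[X] := fun x => arrPoly H fun c => (U (x * H + c) : ZMod M) with ha
  set g : ℕ → (ZMod M)[X] := fun x => arrPoly H fun c => (V (x * H + c) : ZMod M) with hg
  have hrep : ∀ x, rep (AdjoinRoot.root f) (2 * H) F x = AdjoinRoot.mk f (W x) := by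
    intro x
    simp [rep, hW, arrPoly]
  have hmain : arrPoly (2 * Q) W = C (C (S : ZMod M)) * (arrPoly Q a * arrPoly Q g) := by
    have h1 := h 0 one_pos
    rw [show rep (AdjoinRoot.root f) (2 * H) F = fun x => AdjoinRoot.mk f (W x) from funext hrep] at h1
    simp only [zero_mul, zero_add] at h1
    rw [← arrPoly_map, ← arrPoly_map, ← arrPoly_map] at h1
    have h2 : (arrPoly (2 * Q) W).map (AdjoinRoot.mk f) =
        (C (C (S : ZMod M)) * (arrPoly Q a * arrPoly Q g)).map (AdjoinRoot.mk f) := by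
      rw [h1]; simp [ha, hg]
    ext1 x
    have h3 := congrArg (fun p => p.coeff x) h2
    simp only [coeff_map] at h3
    rw [AdjoinRoot.mk_eq_mk] at h3
    have hd : ((arrPoly (2 * Q) W).coeff x -
        (C (C (S : ZMod M)) * (arrPoly Q a * arrPoly Q g)).coeff x).degree < f.degree := by
      rw [hfd]
      refine (degree_sub_le _ _).trans_lt (max_lt ?_ ?_)
      · rw [coeff_arrPoly]
        split_ifs
        · exact degree_arrPoly_lt _ _
        · rw [degree_zero]; exact WithBot.bot_lt_coe _
      · rw [coeff_C_mul]
        have hsm : ∀ p : (ZMod M)[X], p.degree < (2 * H : ℕ) → (C (S : ZMod M) * p).degree < (2 * H : ℕ) := by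
          intro p hp
          rw [degree_lt_iff_coeff_zero] at hp ⊢
          intro m hm
          rw [coeff_C_mul, hp m hm, mul_zero]
        apply hsm
        rw [coeff_mul]
        refine (degree_sum_le _ _).trans_lt ?_
        rw [Finset.sup_lt_iff (WithBot.bot_lt_coe _)]
        intro i _
        have hdeg : ∀ (U : ℕ → ℕ) (i : ℕ),
            ((arrPoly Q fun x => arrPoly H fun c => (U (x * H + c) : ZMod M)).coeff i).natDegree ≤
              H - 1 := by
          intro U i
          rw [coeff_arrPoly]
          split_ifs
          · rw [natDegree_le_iff_coeff_eq_zero]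
            intro m hm
            rw [coeff_arrPoly, if_neg (by omega)]
          · simp
        have := natDegree_mul_le_of_le (hdeg U i.1) (hdeg V i.2)
        exact (natDegree_le_iff_degree_le.1 this).trans_lt (by exact_mod_cast (by omega))
    by_contra hne
    exact hfm.not_dvd_of_degree_lt (sub_ne_zero.2 hne) hd h3
  have heval : ∀ U : ℕ → ℕ, eval (X ^ H) (arrPoly Q fun x => arrPoly H fun c => (U (x * H + c) : ZMod M)) =
      arrPoly (Q * H) fun i => (U i : ZMod M) := by
    intro U
    rw [arrPoly_mul_len, arrPoly, eval_finsetSum]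
    refine Finset.sum_congr rfl fun i _ => ?_
    simp only [eval_mul, eval_C, eval_pow, eval_X]
    rw [← pow_mul, mul_comm i H]; ring
  have hlast : ∀ x < H, (F ((2 * Q - 1) * (2 * H) + (H + x)) : ZMod M) = 0 := by
    intro x hx
    have h1 := congrArg (fun p => p.coeff (2 * Q - 1)) hmain
    have h2 : (arrPoly Q a * arrPoly Q g).natDegree ≤ (Q - 1) + (Q - 1) := by
      apply natDegree_mul_le_of_le <;>
      · rw [natDegree_le_iff_coeff_eq_zero]
        intro m hm
        rw [coeff_arrPoly, if_neg (by omega)]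
    simp only [coeff_C_mul] at h1
    rw [coeff_eq_zero_of_natDegree_lt (lt_of_le_of_lt h2 (by omega)), mul_zero, coeff_arrPoly,
      if_pos (by omega), ← arrPoly_zero (2 * H)] at h1
    exact arrPoly_inj h1 (by omega)
  have hover := arrPoly_overlap (U := 2 * Q) hH
    (fun x c => (F (x * (2 * H) + c) : ZMod M)) hlast
  have hev := congrArg (eval (X ^ H)) hmain
  rw [eval_mul, eval_mul, heval U, heval V, eval_C, arrPoly, eval_finsetSum] at hev
  have hsum : ∑ u ∈ Finset.range (2 * Q), X ^ (u * H) * arrPoly (2 * H)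
      (fun c => (F (u * (2 * H) + c) : ZMod M)) =
      ∑ i ∈ Finset.range (2 * Q), eval (X ^ H) (C (W i) * X ^ i) := by
    refine Finset.sum_congr rfl fun i _ => ?_
    simp only [eval_mul, eval_C, eval_pow, eval_X]
    rw [← pow_mul, mul_comm i H]; ring
  rw [hsum, hev] at hover
  have := congrArg (fun p => p.coeff z) hover
  simp only [coeff_arrPoly, if_pos hz, coeff_C_mul] at this
  rw [← this]
  push_cast
  rfl

end BlockTransform

namespace WordRAM

open BlockTransform

/-! ### Programs for single passes -/

/-- Static bounds for the arguments of `sumTo`. -/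
def small (U V e : Expr) : Bool :=
  Nat.ble (U.size 10 + V.size 10 + e.size 10 + 40) 2000 && Nat.ble (U.cost + V.cost + e.cost + 40) 300 &&
    Nat.beq (U.gcds + V.gcds + e.gcds) 0

/-- With numerical bounds for size and cost fixed once and for all, the side conditions on the
program text become a closed Boolean computation, proved by `rfl`. -/
theorem wp_sumTo_small {N : ℕ} (hN : 1 < N) {a : Fin 16} {U V : Expr} {md : ℕ} {e : Expr}
    {Q : Store → Prop} {h : Store} (u w : ℕ) (τ : ℕ → ℕ → ℕ) {T : ℕ}
    (hs : small U V e = true) (hmd : md < 14) (hmd0 : 0 < h.v md)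
    (h14 : h.v 14 = 0) (h15 : h.v 15 = 0) (h16 : h.v 16 = 0)
    (hU : ∀ z k acc B, U.eval (h.during a z k acc B) = u)
    (hV : ∀ z k acc B, V.eval (h.during a z k acc B) = w)
    (he : ∀ z < u, ∀ k < w, ∀ acc B, e.eval (h.during a z k acc B) = τ z k)
    (hu : u < N ^ 10) (hw : w < N ^ 10) (hT : (u + 1) * (w + 1) * 300 ≤ T)
    (H : Q ⟨h.v, Function.update h.arr a fun z =>
      if z < u then (∑ k ∈ Finset.range w, τ z k) % h.v md else h.arr a z⟩) :
    wp N 10 2000 (sumTo a U V md e) T 0 Q h := by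
  simp only [small, Bool.and_eq_true, Nat.ble_eq, Nat.beq_eq] at hs
  exact wp_sumTo hN u w τ T (by omega) (by omega) (by omega) (by omega) hmd hmd0 h14 h15 h16 hU hV he
    hu hw ((Nat.mul_le_mul_left _ hs.1.2).trans hT) H

theorem wp_asg_small {N : ℕ} (hN : 1 < N) {x : ℕ} {e : Expr} {Q : Store → Prop} {h : Store}
    (hs : small 0 0 e = true) (hlt : e.eval h < N ^ 10)
    (H : Q ⟨Function.update h.v x (e.eval h), h.arr⟩) :
    wp N 10 2000 (asg x e) 300 0 Q h := by
  simp only [small, Bool.and_eq_true, Nat.ble_eq, Nat.beq_eq] at hs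
  exact wp_mono (wp_asg hN (by omega) (by omega) hlt H) (by omega) (by omega) fun _ h => h

theorem wp_whl_small {N : ℕ} (hN : 1 < N) {e₁ e₂ : Expr} {c : Cmd} {T G : ℕ} {Q : Store → Prop}
    (I : ℕ → Store → Prop) (n : ℕ) {h : Store} (hs : small e₁ e₂ 0 = true) (h0 : I n h)
    (hbody : ∀ n h, I n h → e₁.eval h < e₂.eval h →
      ∃ n', n = n' + 1 ∧ wp N 10 2000 c T G (I n') h)
    (hend : ∀ n h, I n h → e₂.eval h ≤ e₁.eval h → Q h) :
    wp N 10 2000 (whl e₁ e₂ c) ((n + 1) * (T + 300)) (n * G) Q h := by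
  simp only [small, Bool.and_eq_true, Nat.ble_eq, Nat.beq_eq] at hs
  exact wp_mono (wp_whl hN (by omega) I n (by omega) (by omega) (by omega) (by omega) h0 hbody hend)
    (Nat.mul_le_mul_left _ (by omega)) le_rfl fun _ h => h

/-- The expression for `rotWord`, with `M` in variable `11` and `K` in variable `8`. -/
def rotExpr (a : Fin 16) (base e c : Expr) : Expr :=
  (1 + (.var 11 - 2) * ((c + e) % (2 * .var 8) / .var 8)) *
    .arr a (base + (c + e) % (2 * .var 8) % .var 8)

@[simp] theorem eval_rotExpr (a : Fin 16) (base e c : Expr) (h : Store) :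
    (rotExpr a base e c).eval h =
      rotWord (h.v 11) (h.v 8) (h.arr a) (base.eval h) (e.eval h) (c.eval h) := rfl

/-- A forward pass on the array `a`; the number and the length of the blocks are in the variables
`17` and `18`. -/
def forwardCmd (a : Fin 16) : Cmd :=
  .seq (sumTo 5 (.var 17 * .var 8 * .var 18 * .var 8) (.var 6) 11
    (rotExpr a ((.var 14 / .var 8 / .var 18 / .var 8 * (.var 6 * .var 18) + .var 15 * .var 18 +
        .var 14 / .var 8 % .var 18) * .var 8)
      (2 * (.var 14 / .var 8 / .var 18 % .var 8) * (.var 8 - .var 15)) (.var 14 % .var 8)))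
    (sumTo a (.var 17 * .var 8 * .var 18 * .var 8) 1 11 (.arr 5 (.var 14)))

/-- A backward pass on the array `3`. -/
def backwardCmd : Cmd :=
  .seq (sumTo 5 (.var 17 * (.var 8 * .var 18) * .var 8) (.var 8) 11
    (rotExpr 3 (((.var 14 / .var 8 / (.var 8 * .var 18) * .var 8 + .var 15) * (2 * .var 18) +
        .var 14 / .var 8 % (.var 8 * .var 18) % .var 18) * .var 8)
      (2 * .var 15 * (.var 14 / .var 8 % (.var 8 * .var 18) / .var 18)) (.var 14 % .var 8) +
    rotExpr 3 (((.var 14 / .var 8 / (.var 8 * .var 18) * .var 8 + .var 15) * (2 * .var 18) + .var 18 +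
        .var 14 / .var 8 % (.var 8 * .var 18) % .var 18) * .var 8)
      (2 * .var 15 * (.var 14 / .var 8 % (.var 8 * .var 18) / .var 18 + (.var 8 - 1)))
      (.var 14 % .var 8)))
    (sumTo 3 (.var 17 * (.var 8 * .var 18) * .var 8) 1 11 (.arr 5 (.var 14)))

/-- Pointwise products of the blocks of the arrays `3` and `4`, written to the array `3`. -/
def pointwiseCmd : Cmd :=
  .seq (sumTo 5 (.var 17 * 2 * .var 8) (.var 8) 11
    (.arr 3 (.var 14 / .var 8 / 2 * .var 8 + .var 15) *
      rotExpr 4 (.var 14 / .var 8 / 2 * .var 8) (2 * .var 8 - .var 15) (.var 14 % .var 8) *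
      (1 - .var 14 / .var 8 % 2)))
    (sumTo 3 (.var 17 * 2 * .var 8) 1 11 (.arr 5 (.var 14)))

theorem mul_add_lt_mul {j n c K : ℕ} (hj : j < n) (hc : c < K) : j * K + c < n * K := by
  have : (j + 1) * K ≤ n * K := Nat.mul_le_mul_right _ hj
  rw [add_mul] at this; omega

/-- A pass reads the array it is going to replace, so the sums are collected in the scratch array
`5` and copied afterwards; the second reduction in the copy changes nothing. -/
theorem wp_sumTo_copy {N : ℕ} (hN : 1 < N) {a : Fin 16} {U U' V : Expr} {e : Expr}
    {Q : Store → Prop} {h : Store} (u w : ℕ) (τ : ℕ → ℕ → ℕ) {E : ℕ}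
    (hs : small U V e = true) (hs' : small U' 1 (.arr 5 (.var 14)) = true) (hmd0 : 0 < h.v 11)
    (h14 : h.v 14 = 0) (h15 : h.v 15 = 0) (h16 : h.v 16 = 0) (ha : a ≠ 5)
    (hU : ∀ z k acc B, U.eval (h.during 5 z k acc B) = u)
    (hU' : ∀ z k acc B C, U'.eval (Store.during ⟨h.v, Function.update h.arr 5 C⟩ a z k acc B) = u)
    (hV : ∀ z k acc B, V.eval (h.during 5 z k acc B) = w)
    (he : ∀ z < u, ∀ k < w, ∀ acc B, e.eval (h.during 5 z k acc B) = τ z k)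
    (hu : u < N ^ 10) (hw : w < N ^ 10) (hw0 : 0 < w) (hE : (u + 1) * (w + 1) * 300 ≤ E)
    (H : ∀ arr' : Fin 16 → ℕ → ℕ, (∀ b, b ≠ a → b ≠ 5 → arr' b = h.arr b) →
      (∀ z < u, arr' a z = (∑ k ∈ Finset.range w, τ z k) % h.v 11) → Q ⟨h.v, arr'⟩) :
    wp N 10 2000 (.seq (sumTo 5 U V 11 e) (sumTo a U' 1 11 (.arr 5 (.var 14)))) (E + E) 0 Q h := by
  have h1N : 1 < N ^ 10 := Nat.one_lt_pow (by norm_num) hN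
  refine wp_seq (G₁ := 0) (G₂ := 0) (wp_sumTo_small hN u w τ hs (by norm_num) hmd0 h14 h15 h16 hU hV he hu hw hE ?_)
  refine wp_sumTo_small hN u 1 (fun z _ => (∑ k ∈ Finset.range w, τ z k) % h.v 11) hs' (by norm_num)
    hmd0 h14 h15 h16 (fun z k acc B => hU' z k acc B _) (fun _ _ _ _ => rfl) ?_ hu h1N ?_ ?_
  · intro z hz k _ acc B
    simp [Store.during, ha.symm, hz]
  · refine le_trans ?_ hE
    gcongr
    omega
  · apply H
    · intro b hb hb5
      simp [hb, hb5]
    · intro z hz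
      simp [hz]

theorem wp_forwardCmd {N : ℕ} (hN : 1 < N) {a : Fin 16} (ha : a ≠ 5) {Q : Store → Prop} {h : Store}
    {H K M nb q E : ℕ} (h6 : h.v 6 = H) (h8 : h.v 8 = K) (h11 : h.v 11 = M) (hM : 0 < M)
    (h14 : h.v 14 = 0) (h15 : h.v 15 = 0) (h16 : h.v 16 = 0) (h17 : h.v 17 = nb) (h18 : h.v 18 = q)
    (hH : 0 < H) (hu : nb * K * q * K < N ^ 10) (hHN : H < N ^ 10)
    (hE : (nb * K * q * K + 1) * (H + 1) * 300 ≤ E)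
    (hQ : ∀ arr' : Fin 16 → ℕ → ℕ, (∀ b, b ≠ a → b ≠ 5 → arr' b = h.arr b) →
      (∀ j < nb * K * q, ∀ c < K, arr' a (j * K + c) = (∑ i ∈ Finset.range H, rotWord M K (h.arr a)
        ((j / q / K * (H * q) + i * q + j % q) * K) (2 * (j / q % K) * (K - i)) c) % M) →
      Q ⟨h.v, arr'⟩) :
    wp N 10 2000 (forwardCmd a) (E + E) 0 Q h := by
  subst h6 h8 h11 h17 h18
  refine wp_sumTo_copy hN (h.v 17 * h.v 8 * h.v 18 * h.v 8) (h.v 6) (fun z i => rotWord (h.v 11) (h.v 8) (h.arr a)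
        ((z / h.v 8 / h.v 18 / h.v 8 * (h.v 6 * h.v 18) + i * h.v 18 + z / h.v 8 % h.v 18) * h.v 8)
        (2 * (z / h.v 8 / h.v 18 % h.v 8) * (h.v 8 - i)) (z % h.v 8)) rfl rfl hM h14 h15 h16 ha
    ?_ ?_ ?_ ?_ hu hHN hH hE ?_
  · intros; simp [Store.during]
  · intros; simp [Store.during]
  · intros; simp [Store.during]
  · intros; simp [Store.during, ha]
  · intro arr' h1 h2
    refine hQ arr' h1 fun j hj c hc => ?_
    rw [h2 _ (mul_add_lt_mul hj hc)]
    have e1 : (j * h.v 8 + c) / h.v 8 = j := by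
      rw [mul_comm, Nat.mul_add_div (by omega), Nat.div_eq_of_lt hc, add_zero]
    have e2 : (j * h.v 8 + c) % h.v 8 = c := by
      rw [mul_comm, Nat.mul_add_mod, Nat.mod_eq_of_lt hc]
    simp only [e1, e2]

theorem wp_backwardCmd {N : ℕ} (hN : 1 < N) {Q : Store → Prop} {h : Store}
    {K M nb q E : ℕ} (h8 : h.v 8 = K) (h11 : h.v 11 = M) (hM : 0 < M)
    (h14 : h.v 14 = 0) (h15 : h.v 15 = 0) (h16 : h.v 16 = 0) (h17 : h.v 17 = nb) (h18 : h.v 18 = q)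
    (hK : 0 < K) (hu : nb * (K * q) * K < N ^ 10) (hKN : K < N ^ 10)
    (hE : (nb * (K * q) * K + 1) * (K + 1) * 300 ≤ E)
    (hQ : ∀ arr' : Fin 16 → ℕ → ℕ, (∀ b, b ≠ 3 → b ≠ 5 → arr' b = h.arr b) →
      (∀ j < nb * (K * q), ∀ c < K, arr' 3 (j * K + c) = (∑ k ∈ Finset.range K,
      (rotWord M K (h.arr 3)
        (((j / (K * q) * K + k) * (2 * q) + j % (K * q) % q) * K) (2 * k * (j % (K * q) / q)) c +
      rotWord M K (h.arr 3) (((j / (K * q) * K + k) * (2 * q) + q + j % (K * q) % q) * K)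
        (2 * k * (j % (K * q) / q + (K - 1))) c)) % M) →
      Q ⟨h.v, arr'⟩) :
    wp N 10 2000 backwardCmd (E + E) 0 Q h := by
  subst h8 h11 h17 h18
  refine wp_sumTo_copy hN (h.v 17 * (h.v 8 * h.v 18) * h.v 8) (h.v 8) (fun z k =>
      (rotWord (h.v 11) (h.v 8) (h.arr 3)
        (((z / h.v 8 / (h.v 8 * h.v 18) * h.v 8 + k) * (2 * h.v 18) +
          z / h.v 8 % (h.v 8 * h.v 18) % h.v 18) * h.v 8)
        (2 * k * (z / h.v 8 % (h.v 8 * h.v 18) / h.v 18)) (z % h.v 8) +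
      rotWord (h.v 11) (h.v 8) (h.arr 3)
        (((z / h.v 8 / (h.v 8 * h.v 18) * h.v 8 + k) * (2 * h.v 18) + h.v 18 +
          z / h.v 8 % (h.v 8 * h.v 18) % h.v 18) * h.v 8)
        (2 * k * (z / h.v 8 % (h.v 8 * h.v 18) / h.v 18 + (h.v 8 - 1))) (z % h.v 8)))
    rfl rfl hM h14 h15 h16 (by decide) ?_ ?_ ?_ ?_ hu hKN hK hE ?_
  · intros; simp [Store.during]
  · intros; simp [Store.during]
  · intros; simp [Store.during]
  · intros; simp [Store.during]
  · intro arr' h1 h2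
    refine hQ arr' h1 fun j hj c hc => ?_
    rw [h2 _ (mul_add_lt_mul hj hc)]
    have e1 : (j * h.v 8 + c) / h.v 8 = j := by
      rw [mul_comm, Nat.mul_add_div (by omega), Nat.div_eq_of_lt hc, add_zero]
    have e2 : (j * h.v 8 + c) % h.v 8 = c := by
      rw [mul_comm, Nat.mul_add_mod, Nat.mod_eq_of_lt hc]
    simp only [e1, e2]

theorem wp_pointwiseCmd {N : ℕ} (hN : 1 < N) {Q : Store → Prop} {h : Store}
    {K M nb E : ℕ} (h8 : h.v 8 = K) (h11 : h.v 11 = M) (hM : 0 < M)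
    (h14 : h.v 14 = 0) (h15 : h.v 15 = 0) (h16 : h.v 16 = 0) (h17 : h.v 17 = nb)
    (hK : 0 < K) (hu : nb * 2 * K < N ^ 10) (hKN : K < N ^ 10)
    (hE : (nb * 2 * K + 1) * (K + 1) * 300 ≤ E)
    (hQ : ∀ arr' : Fin 16 → ℕ → ℕ, (∀ b, b ≠ 3 → b ≠ 5 → arr' b = h.arr b) →
      (∀ j < nb * 2, ∀ c < K, arr' 3 (j * K + c) = (∑ a ∈ Finset.range K,
        h.arr 3 (j / 2 * K + a) * rotWord M K (h.arr 4) (j / 2 * K) (2 * K - a) c * (1 - j % 2)) % M) →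
      Q ⟨h.v, arr'⟩) :
    wp N 10 2000 pointwiseCmd (E + E) 0 Q h := by
  subst h8 h11 h17
  refine wp_sumTo_copy hN (h.v 17 * 2 * h.v 8) (h.v 8) (fun z a =>
      h.arr 3 (z / h.v 8 / 2 * h.v 8 + a) *
        rotWord (h.v 11) (h.v 8) (h.arr 4) (z / h.v 8 / 2 * h.v 8) (2 * h.v 8 - a) (z % h.v 8) *
        (1 - z / h.v 8 % 2))
    rfl rfl hM h14 h15 h16 (by decide) ?_ ?_ ?_ ?_ hu hKN hK hE ?_
  · intros; simp [Store.during]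
  · intros; simp [Store.during]
  · intros; simp [Store.during]
  · intros; simp [Store.during]
  · intro arr' h1 h2
    refine hQ arr' h1 fun j hj c hc => ?_
    rw [h2 _ (mul_add_lt_mul hj hc)]
    have e1 : (j * h.v 8 + c) / h.v 8 = j := by
      rw [mul_comm, Nat.mul_add_div (by omega), Nat.div_eq_of_lt hc, add_zero]
    have e2 : (j * h.v 8 + c) % h.v 8 = c := by
      rw [mul_comm, Nat.mul_add_mod, Nat.mod_eq_of_lt hc]
    simp only [e1, e2]

end WordRAM

namespace BlockTransform

open Polynomial

/-- The arrays of the machine represent the abstract sequences only on the indices in use, so a pass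
has to be seen to read nothing else. -/
theorem forward_congr {R : Type*} [CommRing R] {θ : R} {H K q nb : ℕ} {a a' : ℕ → R} (hq : 0 < q)
    (h : ∀ j < nb * (H * q), a j = a' j) {j : ℕ} (hj : j < nb * K * q) :
    forward θ H K q a j = forward θ H K q a' j := by
  refine Finset.sum_congr rfl fun i hi => ?_
  rw [h]
  have h1 : j / q / K < nb := by
    rw [Nat.div_div_eq_div_mul]
    apply Nat.div_lt_of_lt_mul
    calc j < nb * K * q := hj
      _ = _ := by ring
  rw [add_assoc]
  refine WordRAM.mul_add_lt_mul h1 (WordRAM.mul_add_lt_mul (Finset.mem_range.1 hi) (Nat.mod_lt _ hq))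

/-- The array after `s` forward passes, starting from blocks of length `H ^ l`. -/
def forwardIter {R : Type*} [CommRing R] (θ : R) (H K l : ℕ) (a : ℕ → R) : ℕ → ℕ → R
  | 0 => a
  | s + 1 => forward θ H K (H ^ (l - (s + 1))) (forwardIter θ H K l a s)

end BlockTransform

namespace WordRAM

open BlockTransform

/-! ### The multiplication program -/

/-- The number and the length of the blocks, in the variables `17` and `18`. -/
def locals (v : ℕ → ℕ) (nb q : ℕ) : ℕ → ℕ :=
  fun y => if y = 17 then nb else if y = 18 then q else v y

theorem update_locals_17 (v : ℕ → ℕ) (nb q x : ℕ) :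
    Function.update (locals v nb q) 17 x = locals v x q := by
  funext y
  simp only [locals, Function.update_apply]
  split_ifs <;> rfl

theorem update_locals_18 (v : ℕ → ℕ) (nb q x : ℕ) :
    Function.update (locals v nb q) 18 x = locals v nb x := by
  funext y
  simp only [locals, Function.update_apply]
  split_ifs with h1 h2 <;> first | rfl | omega

theorem locals_zero {v : ℕ → ℕ} (h17 : v 17 = 0) (h18 : v 18 = 0) : locals v 0 0 = v := by
  funext y
  simp only [locals]
  split_ifs with h1 h2
  · rw [h1, h17]
  · rw [h2, h18]
  · rfl

/-- The variables used by the multiplication program. -/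
structure MulSetup (N l H K : ℕ) (v : ℕ → ℕ) : Prop where
  one_lt : 1 < N
  l_pos : 1 ≤ l
  two_le : 2 ≤ H
  hH : H = 2 ^ l
  hK : K = 2 * H
  h0 : v 0 = N
  h6 : v 6 = H
  h7 : v 7 = H ^ l
  h8 : v 8 = K
  h10 : v 10 = K ^ l
  h11 : v 11 = N * K ^ l
  h14 : v 14 = 0
  h15 : v 15 = 0
  h16 : v 16 = 0
  h17 : v 17 = 0
  h18 : v 18 = 0
  bound : 4 * (K ^ l * K) < N ^ 10

/-- The cost of a single pass. -/
def passCost (l K : ℕ) : ℕ := (2 * (K ^ l * K) + 1) * (K + 1) * 300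

/-- Blocks for the words of a polynomial. -/
def spreadCmd (a b : Fin 16) : Cmd :=
  sumTo b (.var 7 * .var 8) 1 11
    (.arr a (.var 14 / .var 8 * .var 6 + .var 14 % .var 8) * (1 - .var 14 % .var 8 / .var 6))

/-- All forward passes. -/
def forwardLoop : Cmd :=
  whl 1 (.var 18) (.seq (asg 18 (.var 18 / .var 6)) (.seq (forwardCmd 3) (.seq (forwardCmd 4)
    (asg 17 (.var 17 * .var 8)))))

/-- All backward passes. -/
def backwardLoop : Cmd :=
  whl 1 (.var 17) (.seq (asg 17 (.var 17 / .var 8)) (.seq backwardCmd (asg 18 (.var 18 * .var 6))))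

/-- Overlapping addition of the blocks, and division by the scaling factor. -/
def recombineCmd : Cmd :=
  sumTo 2 (2 * .var 7 * .var 6) 1 0
    ((.arr 3 (.var 14 / .var 6 * .var 8 + .var 14 % .var 6) +
      .arr 3 ((.var 14 / .var 6 + (2 * .var 7 - 1)) % (2 * .var 7) * .var 8 +
        (.var 6 + .var 14 % .var 6))) % .var 11 / .var 10)

/-- Multiplication modulo `N` of the polynomials in the arrays `0` and `1`; the result is in the
array `2`. -/
def mulCmd : Cmd :=
  .seq (spreadCmd 0 3) (.seq (spreadCmd 1 4) (.seq (asg 17 1) (.seq (asg 18 (.var 7))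
    (.seq forwardLoop (.seq pointwiseCmd (.seq backwardLoop
      (.seq recombineCmd (.seq (asg 17 0) (asg 18 0)))))))))

section

variable {N l H K : ℕ} {h : Store} {Q : Store → Prop}

/-- Bounds the number of ring elements held after `s` forward passes, so that every pass can be
charged the same `passCost`. -/
theorem MulSetup.pow_le (hv : MulSetup N l H K h.v) {s : ℕ} (hs : s ≤ l) :
    K ^ s * H ^ (l - s) ≤ K ^ l := by
  calc K ^ s * H ^ (l - s) ≤ K ^ s * K ^ (l - s) := by
        gcongr; have := hv.hK; omega
    _ = _ := by rw [← pow_add]; congr 1; omega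

theorem MulSetup.K_lt (hv : MulSetup N l H K h.v) : K < N ^ 10 := by
  have hbd := hv.bound
  have : 0 < K ^ l := by apply Nat.pow_pos; have := hv.hK; have := hv.two_le; omega
  have : K ≤ K ^ l * K := Nat.le_mul_of_pos_left _ this
  omega

theorem MulSetup.two_le_M (hv : MulSetup N l H K h.v) : 2 ≤ N * K ^ l := by
  have : 0 < K ^ l := by apply Nat.pow_pos; have := hv.hK; have := hv.two_le; omega
  have := hv.one_lt
  nlinarith

theorem passCost_ge {l K u w : ℕ} (hu : u ≤ 2 * (K ^ l * K)) (hw : w ≤ K) :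
    (u + 1) * (w + 1) * 300 ≤ passCost l K := by
  unfold passCost
  gcongr

theorem wp_spreadCmd (hv : MulSetup N l H K h.v) {a b : Fin 16} (hab : a ≠ b)
    (hQ : ∀ arr' : Fin 16 → ℕ → ℕ, (∀ c, c ≠ b → arr' c = h.arr c) →
      (∀ x < H ^ l, ∀ c < K, arr' b (x * K + c) =
        (if c < H then h.arr a (x * H + c) else 0) % (N * K ^ l)) →
      Q ⟨h.v, arr'⟩) :
    wp N 10 2000 (spreadCmd a b) (passCost l K) 0 Q h := by
  have hN := hv.one_lt
  have h2 := hv.two_le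
  have hK := hv.hK
  have hb := hv.bound
  have hD : H ^ l ≤ K ^ l := Nat.pow_le_pow_left (by omega) l
  have hDK : H ^ l * K ≤ K ^ l * K := Nat.mul_le_mul_right _ hD
  refine wp_sumTo_small hN (H ^ l * K) 1 (fun z _ =>
    h.arr a (z / K * H + z % K) * (1 - z % K / H)) rfl (by norm_num) ?_
    hv.h14 hv.h15 hv.h16 ?_ ?_ ?_ (by omega) ?_ (passCost_ge (by omega) (by omega)) ?_
  · rw [hv.h11]; have := hv.two_le_M; omega
  · intros; simp [Store.during, hv.h7, hv.h8]
  · intros; simp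
  · intros; simp [Store.during, hv.h6, hv.h8, hab]
  · exact Nat.one_lt_pow (by norm_num) hN
  · apply hQ
    · intro c hc; simp [hc]
    · intro x hx c hc
      have e1 : (x * K + c) / K = x := by
        rw [mul_comm, Nat.mul_add_div (by omega), Nat.div_eq_of_lt hc, add_zero]
      have e2 : (x * K + c) % K = c := by
        rw [mul_comm, Nat.mul_add_mod, Nat.mod_eq_of_lt hc]
      simp only [Function.update_self, mul_add_lt_mul hx hc, if_true, Finset.sum_range_one, e1, e2, hv.h11]
      split_ifs with h1
      · rw [Nat.div_eq_of_lt h1]; simp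
      · have : 1 ≤ c / H := (Nat.one_le_div_iff (by omega)).2 (by omega)
        rw [show 1 - c / H = 0 by omega]; simp

variable {R : Type*} [CommRing R] {y : R}

/-- After `s` passes there are `K ^ s` blocks of length `H ^ (l - s)`. Each pass divides the length
by `H`, and the loop stops at length `1`, which happens at `s = l`. -/
theorem wp_forwardLoop (hv : MulSetup N l H K h.v) (hM : ((N * K ^ l : ℕ) : R) = 0)
    (hy : y ^ K = -1) {a b : ℕ → R} {arr : Fin 16 → ℕ → ℕ}
    (ha : ∀ j < H ^ l, rep y K (arr 3) j = a j)
    (hb : ∀ j < H ^ l, rep y K (arr 4) j = b j)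
    (hQ : ∀ arr' : Fin 16 → ℕ → ℕ, (∀ c, c ≠ 3 → c ≠ 4 → c ≠ 5 → arr' c = arr c) →
      (∀ j < K ^ l, rep y K (arr' 3) j =
        forwardIter ((y ^ (2 * K - 1)) ^ 2) H K l a l j) →
      (∀ j < K ^ l, rep y K (arr' 4) j =
        forwardIter ((y ^ (2 * K - 1)) ^ 2) H K l b l j) →
      Q ⟨locals h.v (K ^ l) 1, arr'⟩) :
    wp N 10 2000 forwardLoop ((l + 1) * (4 * passCost l K + 900)) 0 Q
      ⟨locals h.v 1 (H ^ l), arr⟩ := by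
  have hN := hv.one_lt
  have hH2 := hv.two_le
  have hK := hv.hK
  have hbd := hv.bound
  have hKN := hv.K_lt
  have hM2 := hv.two_le_M
  have hple := fun s hs => hv.pow_le (s := s) hs
  obtain ⟨-, -, -, -, -, e0, e6, e7, e8, e10, e11, e14, e15, e16, e17, e18, -⟩ := hv
  set θ := (y ^ (2 * K - 1)) ^ 2
  refine wp_mono (wp_whl_small (G := 0) hN (T := 300 + ((passCost l K + passCost l K) +
    ((passCost l K + passCost l K) + 300)))
    (fun n h' => ∃ s arr', s + n = l ∧ h' = ⟨locals h.v (K ^ s) (H ^ (l - s)), arr'⟩ ∧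
      (∀ c, c ≠ 3 → c ≠ 4 → c ≠ 5 → arr' c = arr c) ∧
      (∀ j < K ^ s * H ^ (l - s), rep y K (arr' 3) j = forwardIter θ H K l a s j) ∧
      (∀ j < K ^ s * H ^ (l - s), rep y K (arr' 4) j = forwardIter θ H K l b s j)) l rfl ?_ ?_ ?_)
    (Nat.mul_le_mul_left _ (by omega)) (by omega) (fun _ h => h)
  · exact ⟨0, arr, by omega, by simp, fun _ _ _ _ => rfl, by simpa [forwardIter] using ha,
      by simpa [forwardIter] using hb⟩
  · rintro n h' ⟨s, arr', hs, rfl, hfr, h3, h4⟩ hlt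
    simp only [Expr.eval_one, Expr.eval_var, locals] at hlt
    norm_num at hlt
    have hsl : s < l := by
      by_contra hge
      rw [show l - s = 0 by omega] at hlt
      simp at hlt
    obtain ⟨n', rfl⟩ : ∃ n', n = n' + 1 := ⟨n - 1, by omega⟩
    refine ⟨n', rfl, ?_⟩
    have hq : H ^ (l - s) / H = H ^ (l - (s + 1)) := by
      rw [show l - s = l - (s + 1) + 1 by omega, pow_succ, Nat.mul_div_cancel _ (by omega)]
    have hHq : H * H ^ (l - (s + 1)) = H ^ (l - s) := by
      rw [← pow_succ']; congr 1; omega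
    have hqpos : 0 < H ^ (l - (s + 1)) := by apply Nat.pow_pos; omega
    have hu : K ^ s * K * H ^ (l - (s + 1)) * K ≤ K ^ l * K := by
      rw [← pow_succ]; exact Nat.mul_le_mul_right _ (hple (s + 1) hsl)
    have hu' : K ^ s * K * H ^ (l - (s + 1)) * K < N ^ 10 := by
      omega
    have hE := passCost_ge (l := l) (K := K) (w := H) (hu.trans (by omega)) (by omega)
    have hrep : ∀ (a : ℕ → R) (F F' : ℕ → ℕ),
        (∀ j < K ^ s * H ^ (l - s), rep y K F j = forwardIter θ H K l a s j) →
        (∀ j < K ^ s * K * H ^ (l - (s + 1)), ∀ c < K, F' (j * K + c) = (∑ i ∈ Finset.range H,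
          rotWord (N * K ^ l) K F ((j / H ^ (l - (s + 1)) / K * (H * H ^ (l - (s + 1))) +
            i * H ^ (l - (s + 1)) + j % H ^ (l - (s + 1))) * K)
            (2 * (j / H ^ (l - (s + 1)) % K) * (K - i)) c) % (N * K ^ l)) →
        ∀ j < K ^ (s + 1) * H ^ (l - (s + 1)), rep y K F' j = forwardIter θ H K l a (s + 1) j := by
      intro a F F' h1 h2 j hj
      rw [pow_succ] at hj
      rw [rep_forward hM hM2 (by omega) hy F F' j (h2 j hj), forwardIter]
      refine forward_congr hqpos (nb := K ^ s) ?_ hj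
      rw [hHq]
      exact h1
    refine wp_seq (G₁ := 0) (G₂ := 0) (wp_asg_small hN rfl ?_ ?_)
    · simp only [Expr.eval_div, Expr.eval_var, locals]
      norm_num
      rw [e6, hq]
      refine lt_of_le_of_lt ?_ hu'
      calc H ^ (l - (s + 1)) = 1 * 1 * H ^ (l - (s + 1)) * 1 := by ring
        _ ≤ _ := by
          gcongr
          · apply Nat.pow_pos; omega
          · omega
          · omega
    rw [update_locals_18, show (Expr.var 18 / Expr.var 6).eval ⟨locals h.v (K ^ s) (H ^ (l - s)), arr'⟩ =
      H ^ (l - (s + 1)) by simp [locals, e6, hq]]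
    refine wp_seq (G₁ := 0) (G₂ := 0) (wp_forwardCmd hN (by decide) (H := H) (K := K) (M := N * K ^ l)
      (nb := K ^ s) (q := H ^ (l - (s + 1))) ?_ ?_ ?_ (by omega) ?_ ?_ ?_ ?_ ?_ (by omega) hu' (by omega) hE ?_)
    iterate 8 simp [locals, e6, e8, e11, e14, e15, e16]
    intro arr₁ hfr₁ hF₁
    refine wp_seq (G₁ := 0) (G₂ := 0) (wp_forwardCmd hN (by decide) (H := H) (K := K) (M := N * K ^ l)
      (nb := K ^ s) (q := H ^ (l - (s + 1))) ?_ ?_ ?_ (by omega) ?_ ?_ ?_ ?_ ?_ (by omega) hu' (by omega) hE ?_)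
    iterate 8 simp [locals, e6, e8, e11, e14, e15, e16]
    intro arr₂ hfr₂ hF₂
    refine wp_asg_small hN rfl ?_ ?_
    · simp only [Expr.eval_mul, Expr.eval_var, locals]
      norm_num
      rw [e8, ← pow_succ]
      calc K ^ (s + 1) ≤ K ^ l := Nat.pow_le_pow_right (by omega) hsl
        _ ≤ K ^ l * K := Nat.le_mul_of_pos_right _ (by omega)
        _ < _ := by omega
    refine ⟨s + 1, arr₂, by omega, ?_, ?_, ?_, ?_⟩
    · rw [update_locals_17, show (Expr.var 17 * Expr.var 8).eval
        ⟨locals h.v (K ^ s) (H ^ (l - (s + 1))), arr₂⟩ = K ^ (s + 1) by simp [locals, e8, pow_succ]]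
    · intro c h3 h4 h5
      rw [hfr₂ c h4 h5]
      exact (hfr₁ c h3 h5).trans (hfr c h3 h4 h5)
    · rw [hfr₂ 3 (by decide) (by decide)]
      exact hrep a _ _ h3 hF₁
    · refine hrep b _ _ h4 ?_
      have := hfr₁ 4 (by decide) (by decide)
      simp only at this hF₂
      rwa [this] at hF₂
  · rintro n h' ⟨s, arr', hs, rfl, hfr, h3, h4⟩ hle
    simp only [Expr.eval_one, Expr.eval_var, locals] at hle
    norm_num at hle
    have hsl : s = l := by
      by_contra hne
      have : H ^ 1 ≤ H ^ (l - s) := Nat.pow_le_pow_right (by omega) (by omega)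
      rw [pow_one] at this
      omega
    subst hsl
    simp only [Nat.sub_self, pow_zero, mul_one] at h3 h4 ⊢
    exact hQ arr' hfr h3 h4

/-- The invariant compares with the forward transforms at the same level: with `K ^ s` blocks left,
array `3` holds `K ^ (l - s)` times the blockwise products of the inputs after `s` forward passes.
`BlockProd.backward` takes `s + 1` to `s`. -/
theorem wp_backwardLoop (hv : MulSetup N l H K h.v) (hM : ((N * K ^ l : ℕ) : R) = 0)
    (hy : y ^ K = -1) {a b : ℕ → R} {arr : Fin 16 → ℕ → ℕ}
    (hab : BlockProd 1 1 (K ^ l) (forwardIter ((y ^ (2 * K - 1)) ^ 2) H K l a l)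
      (forwardIter ((y ^ (2 * K - 1)) ^ 2) H K l b l) (rep y K (arr 3)))
    (hQ : ∀ arr' : Fin 16 → ℕ → ℕ, (∀ c, c ≠ 3 → c ≠ 5 → arr' c = arr c) →
      BlockProd ((K ^ l : ℕ) : R) (H ^ l) 1 a b (rep y K (arr' 3)) →
      Q ⟨locals h.v 1 (H ^ l), arr'⟩) :
    wp N 10 2000 backwardLoop ((l + 1) * (2 * passCost l K + 900)) 0 Q
      ⟨locals h.v (K ^ l) 1, arr⟩ := by
  have hN := hv.one_lt
  have hH2 := hv.two_le
  have hK := hv.hK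
  have hbd := hv.bound
  have hKN := hv.K_lt
  have hM2 := hv.two_le_M
  have hple := fun s hs => hv.pow_le (s := s) hs
  -- Here `θ = y ^ (-2)` and `2 * H = K`, so `θ ^ H` is an odd power of `y ^ K = -1`.
  have hθ : ((y ^ (2 * K - 1)) ^ 2) ^ H = -1 := by
    rw [← pow_mul, ← hK, ← pow_mul, mul_comm, pow_mul, hy]
    exact Odd.neg_one_pow ⟨K - 1, by omega⟩
  have hθK : ((y ^ (2 * K - 1)) ^ 2) ^ K = 1 := by
    rw [show K = H * 2 by omega, pow_mul, ← show K = H * 2 by omega, hθ]; ring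
  have hsum : ∀ e, ¬ K ∣ e → ∑ k ∈ Finset.range K, ((y ^ (2 * K - 1)) ^ 2) ^ (k * e) = 0 := by
    have hKl : K = 2 ^ (l + 1) := by rw [hK, hv.hH, pow_succ, mul_comm]
    generalize (y ^ (2 * K - 1)) ^ 2 = θ at *
    rw [hv.hH] at hθ
    rw [hKl]
    exact sum_pow_eq_zero l θ hθ
  obtain ⟨-, -, -, -, -, e0, e6, e7, e8, e10, e11, e14, e15, e16, e17, e18, -⟩ := hv
  set θ := (y ^ (2 * K - 1)) ^ 2
  refine wp_mono (wp_whl_small (G := 0) hN (T := 300 + ((passCost l K + passCost l K) + 300))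
    (fun s h' => ∃ arr', s ≤ l ∧ h' = ⟨locals h.v (K ^ s) (H ^ (l - s)), arr'⟩ ∧
      (∀ c, c ≠ 3 → c ≠ 5 → arr' c = arr c) ∧
      BlockProd ((K ^ (l - s) : ℕ) : R) (H ^ (l - s)) (K ^ s) (forwardIter θ H K l a s)
        (forwardIter θ H K l b s) (rep y K (arr' 3))) l rfl ?_ ?_ ?_)
    (Nat.mul_le_mul_left _ (by omega)) (by omega) (fun _ h => h)
  · exact ⟨arr, le_rfl, by simp, fun _ _ _ => rfl, by simpa using hab⟩
  · rintro s h' ⟨arr', hs, rfl, hfr, h3⟩ hlt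
    simp only [Expr.eval_one, Expr.eval_var, locals] at hlt
    norm_num at hlt
    obtain ⟨t, rfl⟩ : ∃ n', s = n' + 1 := ⟨s - 1, by
      rcases s with _ | s
      · simp at hlt
      · omega⟩
    refine ⟨t, rfl, ?_⟩
    have hnb : K ^ (t + 1) / K = K ^ t := by rw [pow_succ, Nat.mul_div_cancel _ (by omega)]
    have hHq : H * H ^ (l - (t + 1)) = H ^ (l - t) := by
      rw [← pow_succ']; congr 1; omega
    have hqpos : 0 < H ^ (l - (t + 1)) := by apply Nat.pow_pos; omega
    have hu : K ^ t * (K * H ^ (l - (t + 1))) * K ≤ K ^ l * K := by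
      rw [← mul_assoc, ← pow_succ]; exact Nat.mul_le_mul_right _ (hple (t + 1) hs)
    have hu' : K ^ t * (K * H ^ (l - (t + 1))) * K < N ^ 10 := by omega
    have hE := passCost_ge (l := l) (K := K) (w := K) (hu.trans (by omega)) le_rfl
    refine wp_seq (G₁ := 0) (G₂ := 0) (wp_asg_small hN rfl ?_ ?_)
    · simp only [Expr.eval_div, Expr.eval_var, locals]
      norm_num
      rw [e8, hnb]
      calc K ^ t ≤ K ^ l := Nat.pow_le_pow_right (by omega) (by omega)
        _ ≤ K ^ l * K := Nat.le_mul_of_pos_right _ (by omega)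
        _ < _ := by omega
    rw [update_locals_17, show (Expr.var 17 / Expr.var 8).eval
      ⟨locals h.v (K ^ (t + 1)) (H ^ (l - (t + 1))), arr'⟩ = K ^ t by simp [locals, e8, hnb]]
    refine wp_seq (G₁ := 0) (G₂ := 0) (wp_backwardCmd hN (K := K) (M := N * K ^ l)
      (nb := K ^ t) (q := H ^ (l - (t + 1))) ?_ ?_ (by omega) ?_ ?_ ?_ ?_ ?_ (by omega) hu' (by omega) hE ?_)
    iterate 7 simp [locals, e8, e11, e14, e15, e16]
    intro arr₁ hfr₁ hF₁
    refine wp_asg_small hN rfl ?_ ?_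
    · simp only [Expr.eval_mul, Expr.eval_var, locals]
      norm_num
      rw [e6, mul_comm, hHq]
      calc H ^ (l - t) ≤ K ^ (l - t) := Nat.pow_le_pow_left (by omega) _
        _ ≤ K ^ l := Nat.pow_le_pow_right (by omega) (by omega)
        _ ≤ K ^ l * K := Nat.le_mul_of_pos_right _ (by omega)
        _ < _ := by omega
    refine ⟨arr₁, by omega, ?_, ?_, ?_⟩
    · rw [update_locals_18, show (Expr.var 18 * Expr.var 6).eval
        ⟨locals h.v (K ^ t) (H ^ (l - (t + 1))), arr₁⟩ = H ^ (l - t) by simp [locals, e6, ← hHq, mul_comm]]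
    · intro c h3 h5
      exact (hfr₁ c h3 h5).trans (hfr c h3 h5)
    · rw [pow_succ] at h3
      have := BlockProd.backward hK (by omega) hqpos hθK hsum h3
      rw [hHq, show ((K ^ (l - (t + 1)) : ℕ) : R) * K = ((K ^ (l - t) : ℕ) : R) by
        rw [← Nat.cast_mul, ← pow_succ]; congr 2; omega] at this
      refine this.congr (fun _ _ => rfl) (fun _ _ => rfl) fun j hj => ?_
      refine rep_backward hM hM2 (by omega) hy _ _ j (hF₁ j ?_)
      calc j < _ := hj
        _ = _ := by rw [← hHq, hK]; ring
  · rintro s h' ⟨arr', hs, rfl, hfr, h3⟩ hle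
    simp only [Expr.eval_one, Expr.eval_var, locals] at hle
    norm_num at hle
    obtain rfl : s = 0 := by
      by_contra hne
      have : K ^ 1 ≤ K ^ s := Nat.pow_le_pow_right (by omega) (by omega)
      rw [pow_one] at this
      omega
    simp only [Nat.sub_zero, pow_zero] at h3 ⊢
    exact hQ arr' hfr h3

open Polynomial in
theorem wp_recombineCmd (hv : MulSetup N l H K h.v) {U V : ℕ → ℕ} {arr : Fin 16 → ℕ → ℕ}
    {f : (ZMod (N * K ^ l))[X]} (hf : f = X ^ (2 * H) + 1)
    (hp : BlockProd ((K ^ l : ℕ) : AdjoinRoot f) (H ^ l) 1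
      (fun x => AdjoinRoot.mk f (arrPoly H fun c => (U (x * H + c) : ZMod (N * K ^ l))))
      (fun x => AdjoinRoot.mk f (arrPoly H fun c => (V (x * H + c) : ZMod (N * K ^ l))))
      (rep (AdjoinRoot.root f) K (arr 3)))
    (hQ : ∀ arr' : Fin 16 → ℕ → ℕ, (∀ c, c ≠ 2 → arr' c = arr c) →
      (∀ z < 2 * H ^ l * H, arr' 2 z = (arrPoly (H ^ l * H) U * arrPoly (H ^ l * H) V).coeff z % N) →
      Q ⟨locals h.v 1 (H ^ l), arr'⟩) :
    wp N 10 2000 recombineCmd (passCost l K) 0 Q ⟨locals h.v 1 (H ^ l), arr⟩ := by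
  have hN := hv.one_lt
  have hH2 := hv.two_le
  have hK := hv.hK
  have hbd := hv.bound
  have hM2 := hv.two_le_M
  have hD : H ^ l ≤ K ^ l := Nat.pow_le_pow_left (by omega) l
  have hD0 : 0 < H ^ l := by apply Nat.pow_pos; omega
  have hKl0 : 0 < K ^ l := by apply Nat.pow_pos; omega
  have hu : 2 * H ^ l * H ≤ K ^ l * K := by
    calc 2 * H ^ l * H = H ^ l * (2 * H) := by ring
      _ ≤ _ := by rw [← hK]; exact Nat.mul_le_mul_right _ hD
  have key := recombine hM2 (by omega) hD0 (arr 3) U V f hf (by rw [← hK]; exact hp)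
  obtain ⟨-, -, -, -, -, e0, e6, e7, e8, e10, e11, e14, e15, e16, e17, e18, -⟩ := hv
  refine wp_sumTo_small hN (2 * H ^ l * H) 1 (fun z _ =>
    (arr 3 (z / H * K + z % H) + arr 3 ((z / H + (2 * H ^ l - 1)) % (2 * H ^ l) * K + (H + z % H)))
      % (N * K ^ l) / K ^ l) rfl (by norm_num) ?_ ?_ ?_ ?_ ?_ ?_ ?_ (by omega)
      (Nat.one_lt_pow (by norm_num) hN) (passCost_ge (by omega) (by omega)) ?_
  · simp [locals, e0]; omega
  · simp [locals, e14]
  · simp [locals, e15]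
  · simp [locals, e16]
  · intros; simp [Store.during, locals, e6, e7]
  · intros; simp
  · intros; simp [Store.during, locals, e6, e7, e8, e10, e11]
  · apply hQ
    · intro c hc; simp [hc]
    · intro z hz
      have hmap : ∀ U : ℕ → ℕ, (arrPoly (H ^ l * H) fun i => (U i : ZMod (N * K ^ l))) =
          (arrPoly (H ^ l * H) U).map (Nat.castRingHom _) := fun U => by
        rw [arrPoly_map]; rfl
      have h1 := key z hz
      rw [hmap U, hmap V, ← Polynomial.map_mul, coeff_map, eq_natCast, ← Nat.cast_mul, ← hK,
        ZMod.natCast_eq_natCast_iff'] at h1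
      simp only [Function.update_self, hz, if_true, Finset.sum_range_one]
      -- Knowing `K ^ l * x` modulo `K ^ l * N` is knowing `x` modulo `N`, by an exact integer
      -- division; this is the reason for the modulus `N * K ^ l`.
      rw [h1, mul_comm N, Nat.mul_mod_mul_left, Nat.mul_div_cancel_left _ hKl0]
      simp [locals, e0]

/-- The cost of a multiplication. -/
def mulCost (l K : ℕ) : ℕ := (l + 1) * (11 * passCost l K + 3000)

-- The ring with a `K`-th root of `-1` is `AdjoinRoot` of `X ^ (2 * H) + 1` over `ZMod (N * K ^ l)`.
-- It occurs in the proof only; the machine handles the words of its elements.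
open Polynomial in
theorem wp_mulCmd (hv : MulSetup N l H K h.v)
    (hQ : ∀ arr' : Fin 16 → ℕ → ℕ, (∀ c, c ≠ 2 → c ≠ 3 → c ≠ 4 → c ≠ 5 → arr' c = h.arr c) →
      (∀ z < 2 * H ^ l * H, arr' 2 z =
        (arrPoly (H ^ l * H) (h.arr 0) * arrPoly (H ^ l * H) (h.arr 1)).coeff z % N) →
      Q ⟨h.v, arr'⟩) :
    wp N 10 2000 mulCmd (mulCost l K) 0 Q h := by
  have hN := hv.one_lt
  have hH2 := hv.two_le
  have hK := hv.hK
  have hbd := hv.bound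
  have hM2 := hv.two_le_M
  have hD : H ^ l ≤ K ^ l := Nat.pow_le_pow_left (by omega) l
  have hKl0 : 0 < K ^ l := by apply Nat.pow_pos; omega
  have hKl : K ^ l ≤ K ^ l * K := Nat.le_mul_of_pos_right _ (by omega)
  have h1N : 1 < N ^ 10 := Nat.one_lt_pow (by norm_num) hN
  obtain ⟨f, hf⟩ : ∃ f : (ZMod (N * K ^ l))[X], f = X ^ (2 * H) + 1 := ⟨_, rfl⟩
  have hy : (AdjoinRoot.root f) ^ K = -1 := by
    have h1 := (congrArg (AdjoinRoot.mk f) hf).symm.trans AdjoinRoot.mk_self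
    rw [map_add, map_pow, AdjoinRoot.mk_X, map_one, ← hK] at h1
    exact eq_neg_of_add_eq_zero_left h1
  have hM : ((N * K ^ l : ℕ) : AdjoinRoot f) = 0 := by
    have := congrArg (AdjoinRoot.of f) (ZMod.natCast_self (N * K ^ l))
    rwa [map_natCast, map_zero] at this
  have hspread : ∀ (U F : ℕ → ℕ), (∀ x < H ^ l, ∀ c < K, F (x * K + c) =
      (if c < H then U (x * H + c) else 0) % (N * K ^ l)) → ∀ x < H ^ l,
      rep (AdjoinRoot.root f) K F x =
        AdjoinRoot.mk f (arrPoly H fun c => (U (x * H + c) : ZMod (N * K ^ l))) := by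
    intro U F hF x hx
    have h1 : rep (AdjoinRoot.root f) K F x =
        ∑ c ∈ Finset.range (H + H), ((if c < H then U (x * H + c) else 0 : ℕ) : AdjoinRoot f) *
          AdjoinRoot.root f ^ c := by
      rw [rep, ← two_mul, ← hK]
      refine Finset.sum_congr rfl fun c hc => ?_
      rw [hF x hx c (Finset.mem_range.1 hc), cast_mod_eq hM]
    rw [h1, Finset.sum_range_add, arrPoly, map_sum, add_eq_left.2]
    · refine Finset.sum_congr rfl fun c hc => ?_
      rw [if_pos (Finset.mem_range.1 hc)]
      simp
    · refine Finset.sum_eq_zero fun c _ => ?_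
      rw [if_neg (by omega)]; simp
  refine wp_mono (G := 0) (wp_seq (G₁ := 0) (G₂ := 0) (wp_spreadCmd hv (a := 0) (b := 3) (by decide) fun arr₁ hfr₁ h₁ => ?_))
    (T := passCost l K + (passCost l K + (300 + (300 + ((l + 1) * (4 * passCost l K + 900) +
      ((passCost l K + passCost l K) + ((l + 1) * (2 * passCost l K + 900) + (passCost l K +
        (300 + 300)))))))))
    ?_ le_rfl (fun _ h => h)
  · refine wp_seq (G₁ := 0) (G₂ := 0) (wp_spreadCmd (h := ⟨h.v, arr₁⟩) hv (a := 1) (b := 4) (by decide) fun arr₂ hfr₂ h₂ => ?_)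
    refine wp_seq (G₁ := 0) (G₂ := 0) (wp_asg_small hN rfl (by simpa using h1N) ?_)
    refine wp_seq (G₁ := 0) (G₂ := 0) (wp_asg_small hN rfl (by simp [hv.h7]; omega) ?_)
    have hloc : Function.update (Function.update h.v 17 1) 18 (H ^ l) = locals h.v 1 (H ^ l) := by
      conv_lhs => rw [← locals_zero hv.h17 hv.h18, update_locals_17, update_locals_18]
    rw [show Function.update (Function.update h.v 17 (Expr.eval 1 ⟨h.v, arr₂⟩)) 18
      (Expr.eval (.var 7) ⟨Function.update h.v 17 (Expr.eval 1 ⟨h.v, arr₂⟩), arr₂⟩) =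
        locals h.v 1 (H ^ l) by rw [← hloc]; simp [hv.h7]]
    refine wp_seq (G₁ := 0) (G₂ := 0) (wp_forwardLoop hv hM hy (a := fun x => AdjoinRoot.mk f (arrPoly H fun c => (h.arr 0 (x * H + c) : ZMod (N * K ^ l))))
      (b := fun x => AdjoinRoot.mk f (arrPoly H fun c => (h.arr 1 (x * H + c) : ZMod (N * K ^ l)))) ?_ ?_ ?_)
    · simp only
      rw [hfr₂ 3 (by decide)]
      exact hspread _ _ h₁
    · refine hspread _ _ ?_
      have := hfr₁ 1 (by decide)
      simp only at h₂
      rwa [this] at h₂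
    intro arr₃ hfr₃ h₃ h₃'
    refine wp_seq (G₁ := 0) (G₂ := 0) (wp_pointwiseCmd hN (K := K) (M := N * K ^ l) (nb := K ^ l)
      ?_ ?_ (by omega) ?_ ?_ ?_ ?_ (by omega) ?_ hv.K_lt (passCost_ge (u := K ^ l * 2 * K) (by linarith) le_rfl) ?_)
    iterate 6 simp [locals, hv.h8, hv.h11, hv.h14, hv.h15, hv.h16]
    · rw [mul_right_comm]; omega
    intro arr₄ hfr₄ h₄
    have hbp := (blockProd_one hM hM2 (by omega) hy _ _ _ _ h₄).congr (fun j hj => (h₃ j (by omega)).symm)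
      (fun j hj => (h₃' j (by omega)).symm) (fun _ _ => rfl)
    refine wp_seq (G₁ := 0) (G₂ := 0) (wp_backwardLoop hv hM hy hbp fun arr₅ hfr₅ h₅ => ?_)
    refine wp_seq (G₁ := 0) (G₂ := 0) (wp_recombineCmd hv hf h₅ fun arr₆ hfr₆ h₆ => ?_)
    refine wp_seq (G₁ := 0) (G₂ := 0) (wp_asg_small hN rfl (by simp; omega) ?_)
    refine wp_asg_small hN rfl (by simp; omega) ?_
    simp only [Expr.eval_zero]
    rw [update_locals_17, update_locals_18, locals_zero hv.h17 hv.h18]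
    refine hQ arr₆ (fun c h2 h3 h4 h5 => ?_) h₆
    exact (hfr₆ c h2).trans ((hfr₅ c h3 h5).trans ((hfr₄ c h3 h5).trans ((hfr₃ c h3 h4 h5).trans
      ((hfr₂ c h4).trans (hfr₁ c h3)))))
  · unfold mulCost
    have : (l + 1) * (11 * passCost l K + 3000) = (l + 1) * (4 * passCost l K + 900) +
      (l + 1) * (2 * passCost l K + 900) + (l * (5 * passCost l K + 1200)) + 5 * passCost l K + 1200 := by ring
    omega

end

end WordRAM

/-! ### Shifting polynomial sequences without division -/

namespace SeriesShift

open PowerSeries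

variable {R : Type*} [CommRing R]

/-- The sequence `e` is annihilated by the `D`-th power of the difference operator. -/
def Pol (D : ℕ) (e : ℕ → R) : Prop := ∀ j, D ≤ j → coeff j ((1 - X) ^ D * mk e) = 0

theorem coeff_one_sub_X_pow {D j : ℕ} (h : D < j) : coeff j ((1 - X : R⟦X⟧) ^ D) = 0 := by
  have : ((1 - X : R⟦X⟧) ^ D) = (((1 - Polynomial.X) ^ D : Polynomial R) : R⟦X⟧) := by simp
  rw [this, Polynomial.coeff_coe]
  apply Polynomial.coeff_eq_zero_of_natDegree_lt
  refine lt_of_le_of_lt (Polynomial.natDegree_pow_le_of_le (m := 1) D ?_) (by omega)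
  exact (Polynomial.natDegree_sub_le _ _).trans (by simp [Polynomial.natDegree_X_le])

theorem mk_eq (e : ℕ → R) : mk e = C (e 0) + X * mk fun j => e (j + 1) := by
  ext j
  rcases j with _ | j
  · simp
  · simp [coeff_succ_X_mul]

/-- `1 - X` times the generating series is `e 0` plus `X` times the series of differences. The
constant contributes `(1 - X) ^ D * e 0`, of degree at most `D`, which does not matter. -/
theorem pol_succ_iff (D : ℕ) (e : ℕ → R) : Pol (D + 1) e ↔ Pol D fun j => e (j + 1) - e j := by
  have h1 : (1 - X) ^ (D + 1) * mk e =
      (1 - X) ^ D * C (e 0) + X * ((1 - X) ^ D * mk fun j => e (j + 1) - e j) := by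
    have : (mk fun j => e (j + 1) - e j) = (mk fun j => e (j + 1)) - mk e := by ext; simp
    rw [this]
    have h2 := mk_eq e
    linear_combination (1 - X) ^ D * h2
  have h3 : ∀ j, D ≤ j → coeff (j + 1) ((1 - X) ^ (D + 1) * mk e) =
      coeff j ((1 - X) ^ D * mk fun j => e (j + 1) - e j) := by
    intro j hj
    rw [h1, map_add, coeff_succ_X_mul, coeff_mul_C, coeff_one_sub_X_pow (by omega), zero_mul, zero_add]
  constructor
  · intro h j hj
    rw [← h3 j hj]
    exact h _ (by omega)
  · intro h j hj
    obtain ⟨j, rfl⟩ : ∃ i, j = i + 1 := ⟨j - 1, by omega⟩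
    rw [h3 j (by omega)]
    exact h _ (by omega)

theorem Pol.add {D : ℕ} {e e' : ℕ → R} (h : Pol D e) (h' : Pol D e') :
    Pol D fun j => e j + e' j := by
  intro j hj
  have : (mk fun j => e j + e' j) = mk e + mk e' := by ext; simp
  rw [this, mul_add, map_add, h j hj, h' j hj, add_zero]

theorem Pol.const_mul {D : ℕ} {e : ℕ → R} (h : Pol D e) (c : R) : Pol D fun j => c * e j := by
  intro j hj
  have : (mk fun j => c * e j) = C c * mk e := by ext; simp
  rw [this, mul_left_comm, coeff_C_mul, h j hj, mul_zero]

/-- Induction on `D` through the product rule for differences: the difference of `(m * j + c) * e j`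
is `(m * j + m + c)` times the difference of `e`, plus `m * e j`. -/
theorem Pol.linear_mul {D : ℕ} {e : ℕ → R} (h : Pol D e) (m c : R) :
    Pol (D + 1) fun j => (m * j + c) * e j := by
  induction D generalizing e c with
  | zero =>
    have : ∀ j, e j = 0 := fun j => by simpa using h j (Nat.zero_le _)
    intro j _
    have h0 : (mk fun j => (m * j + c) * e j) = 0 := by ext j; simp [this]
    rw [h0, mul_zero, map_zero]
  | succ D ih =>
    rw [pol_succ_iff]
    have h1 := (ih ((pol_succ_iff D e).1 h) (m + c)).add (h.const_mul m)
    convert h1 using 2 with j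
    push_cast
    ring

theorem Pol.mono {D D' : ℕ} {e : ℕ → R} (h : Pol D e) (hD : D ≤ D') : Pol D' e := by
  induction D', hD using Nat.le_induction with
  | base => exact h
  | succ D' _ ih => simpa using ih.linear_mul 0 1

theorem Pol.shift {D : ℕ} {e : ℕ → R} (h : Pol D e) (s : ℕ) : Pol D fun j => e (s + j) := by
  induction s with
  | zero => simpa using h
  | succ s ih =>
    intro j hj
    have h1 := mk_eq fun j => e (s + j)
    have h2 := ih (j + 1) (by omega)
    rw [h1, mul_add, map_add, coeff_mul_C, coeff_one_sub_X_pow (by omega), zero_mul, zero_add,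
      mul_left_comm, coeff_succ_X_mul] at h2
    simp only [show ∀ i, s + 1 + i = s + (i + 1) by intro i; ring]
    exact h2

/-- Products of `h` values of a linear function along an arithmetic progression. -/
def apProd (m c : R) (d h : ℕ) (x : ℕ) : R :=
  ∏ i ∈ Finset.range h, (m * ((x + d * i : ℕ) : R) + c)

theorem pol_apProd (m c : R) (d h : ℕ) : Pol (h + 1) (apProd m c d h) := by
  induction h with
  | zero =>
    rw [pol_succ_iff]
    intro j _
    have : (mk fun j => apProd m c d 0 (j + 1) - apProd m c d 0 j) = 0 := by ext; simp [apProd]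
    rw [this, mul_zero, map_zero]
  | succ h ih =>
    have := ih.linear_mul m (m * ((d * h : ℕ) : R) + c)
    convert this using 2 with x
    rw [apProd, Finset.prod_range_succ, mul_comm]
    congr 1
    push_cast; ring

theorem apProd_add (m c : R) (d h h' x : ℕ) :
    apProd m c d (h + h') x = apProd m c d h x * apProd m c d h' (d * h + x) := by
  rw [apProd, Finset.prod_range_add]
  congr 1
  refine Finset.prod_congr rfl fun i _ => ?_
  push_cast; ring

/-- `(1 - X)⁻¹`. -/
noncomputable def geom (R : Type*) [CommRing R] : R⟦X⟧ := mk 1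

theorem one_sub_mul_geom : (1 - X) * geom R = 1 := by
  rw [mul_comm]; exact mk_one_mul_one_sub_eq_one R

theorem one_sub_pow_mul_geom_pow (D : ℕ) : (1 - X) ^ D * geom R ^ D = 1 := by
  rw [← mul_pow, one_sub_mul_geom, one_pow]

/-- The sequence `j ↦ j.choose (D - 1)`. -/
noncomputable def kernel (R : Type*) [CommRing R] (D j : ℕ) : R :=
  coeff j (X ^ (D - 1) * geom R ^ D)

theorem mk_kernel (D : ℕ) : mk (kernel R D) = X ^ (D - 1) * geom R ^ D := by
  ext j; simp [kernel]

theorem one_sub_pow_mul_mk_kernel (D : ℕ) : (1 - X) ^ D * mk (kernel R D) = X ^ (D - 1) := by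
  rw [mk_kernel, mul_left_comm, one_sub_pow_mul_geom_pow, mul_one]

theorem pol_kernel {D : ℕ} (hD : 0 < D) : Pol D (kernel R D) := by
  intro j hj
  rw [one_sub_pow_mul_mk_kernel, coeff_X_pow, if_neg (by omega)]

/-- For `s = 0` the numerator of the kernel is `X ^ (D - 1)`, which only moves `e`. Going from `s`
to `s + 1` drops the first term of the kernel series; that term contributes a multiple of `(1 - X) ^
D * mk e`, which has no coefficients from index `D` on. So the same coefficients are read one place
further along. Only integral binomial coefficients occur, hence the formula holds over every
commutative ring. -/
theorem coeff_kernel_mul {D : ℕ} (hD : 0 < D) {e : ℕ → R} (he : Pol D e) (s j : ℕ) :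
    coeff (D - 1 + j) ((1 - X) ^ D * mk (fun i => kernel R D (s + i)) * mk e) = e (s + j) := by
  induction s generalizing j with
  | zero =>
    simp only [zero_add]
    rw [one_sub_pow_mul_mk_kernel, coeff_X_pow_mul', if_pos (by omega)]
    simp
  | succ s ih =>
    have h1 := mk_eq fun i => kernel R D (s + i)
    have h2 := ih (j + 1)
    have h3 := he (D - 1 + (j + 1)) (by omega)
    rw [h1, mul_add, add_mul, map_add, mul_right_comm, coeff_mul_C, h3, zero_mul, zero_add,
      mul_left_comm, mul_assoc, ← add_assoc, coeff_succ_X_mul] at h2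
    simp only [show ∀ i, s + 1 + i = s + (i + 1) by intro i; ring]
    exact h2

theorem coeff_mul_congr {f f' g g' : R⟦X⟧} {n : ℕ} (hf : ∀ i < n, coeff i f = coeff i f')
    (hg : ∀ i < n, coeff i g = coeff i g') {i : ℕ} (hi : i < n) :
    coeff i (f * g) = coeff i (f' * g') := by
  rw [coeff_mul, coeff_mul]
  refine Finset.sum_congr rfl fun p hp => ?_
  have := Finset.HasAntidiagonal.mem_antidiagonal.1 hp
  rw [hf _ (by omega), hg _ (by omega)]

end SeriesShift

/-! ### Programs for power series -/

namespace WordRAM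

open BlockTransform SeriesShift

/-- `for z < U do a[z] := e mod N`. -/
def mapTo (a : Fin 16) (U e : Expr) : Cmd := sumTo a U 1 0 e

/-- The product of the polynomials whose coefficients are given by two expressions. -/
def prodCmd (e₁ e₂ : Expr) : Cmd :=
  .seq (mapTo 0 (.var 10) e₁) (.seq (mapTo 1 (.var 10) e₂) mulCmd)

/-- `e` where `i < n`, and `0` elsewhere. -/
def trunc (i n e : Expr) : Expr := e * (1 - i / n)

/-- The square of the power series in the array `a`. -/
def squareCmd (a : Fin 16) : Cmd :=
  .seq (prodCmd (.arr a (.var 14)) (.arr a (.var 14))) (mapTo a (.var 10) (.arr 2 (.var 14)))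

/-- The shift of the sequence in the array `a` by an amount encoded in the array `12`, written to
the array `13`. -/
def shiftCmd (a : Fin 16) : Cmd :=
  .seq (prodCmd (.arr 7 (.var 14)) (trunc (.var 14) (.var 7) (.arr a (.var 14))))
    (.seq (prodCmd (trunc (.var 14) (.var 7) (.arr 2 (.var 14))) (.arr 12 (.var 14)))
      (.seq (prodCmd (.arr 2 (.var 14)) (.arr 8 (.var 14)))
        (mapTo 13 (.var 7) (.arr 2 (.var 7 - 1 + .var 14)))))

/-- Numerator of the kernel sequence in the array `11`, written to the array `12`. -/
def kernelCmd : Cmd :=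
  .seq (prodCmd (.arr 7 (.var 14)) (trunc (.var 14) (.var 7) (.arr 11 (.var 14))))
    (mapTo 12 (.var 10) (trunc (.var 14) (.var 7) (.arr 2 (.var 14))))

section

variable {N l H K : ℕ} {h : Store} {Q : Store → Prop}

theorem MulSetup.n_eq (hv : MulSetup N l H K h.v) : H ^ l * H = K ^ l := by
  have h1 := hv.hH
  rw [hv.hK, mul_pow, ← h1, mul_comm]

theorem wp_mapTo (hv : MulSetup N l H K h.v) {a : Fin 16} {U e : Expr} (u : ℕ) (τ : ℕ → ℕ)
    (hs : small U 1 e = true) (hu : u ≤ 2 * (K ^ l * K))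
    (hU : ∀ st : Store, (∀ y < 14, st.v y = h.v y) → U.eval st = u)
    (he : ∀ z < u, ∀ st : Store, st.v 14 = z → (∀ y < 14, st.v y = h.v y) →
      (∀ c, c ≠ a → st.arr c = h.arr c) → e.eval st = τ z)
    (hQ : ∀ arr' : Fin 16 → ℕ → ℕ, (∀ c, c ≠ a → arr' c = h.arr c) →
      (∀ z < u, arr' a z = τ z % N) → Q ⟨h.v, arr'⟩) :
    wp N 10 2000 (mapTo a U e) (passCost l K) 0 Q h := by
  have hN := hv.one_lt
  have hbd := hv.bound
  have hd : ∀ z k acc B, ∀ y < 14, (h.during a z k acc B).v y = h.v y := by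
    intro z k acc B y hy
    simp [Store.during, show y ≠ 14 by omega, show y ≠ 15 by omega, show y ≠ 16 by omega]
  refine wp_sumTo_small hN u 1 (fun z _ => τ z) hs (by norm_num) ?_ hv.h14 hv.h15 hv.h16 ?_ ?_ ?_
    (by omega) (Nat.one_lt_pow (by norm_num) hN) (passCost_ge hu (by have := hv.hK; have := hv.two_le; omega)) ?_
  · rw [hv.h0]; omega
  · intro z k acc B
    exact hU _ (hd z k acc B)
  · intros; simp
  · intro z hz k _ acc B
    refine he z hz _ rfl (hd z k acc B) ?_
    intro c hc
    simp [Store.during, hc]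
  · apply hQ
    · intro c hc; simp [hc]
    · intro z hz; simp [hz, hv.h0]

/-- The cost of `prodCmd`. -/
def prodCost (l K : ℕ) : ℕ := passCost l K + (passCost l K + mulCost l K)

/-- Coefficients of a product below `n` depend only on those of the factors below `n`. The parameter
`n` is separate from the table length `K ^ l` because some factors are known only in their first `H
^ l` coefficients. -/
theorem wp_prodCmd (hv : MulSetup N l H K h.v) {e₁ e₂ : Expr} (τ₁ τ₂ : ℕ → ℕ)
    (f g : PowerSeries (ZMod N)) (n : ℕ) (hn : n ≤ K ^ l)
    (hs₁ : small (.var 10) 1 e₁ = true) (hs₂ : small (.var 10) 1 e₂ = true)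
    (he₁ : ∀ z < K ^ l, ∀ st : Store, st.v 14 = z → (∀ y < 14, st.v y = h.v y) →
      (∀ c, c ≠ 0 → c ≠ 1 → st.arr c = h.arr c) → e₁.eval st = τ₁ z)
    (he₂ : ∀ z < K ^ l, ∀ st : Store, st.v 14 = z → (∀ y < 14, st.v y = h.v y) →
      (∀ c, c ≠ 0 → c ≠ 1 → st.arr c = h.arr c) → e₂.eval st = τ₂ z)
    (hf : ∀ i < n, (τ₁ i : ZMod N) = PowerSeries.coeff i f)
    (hg : ∀ i < n, (τ₂ i : ZMod N) = PowerSeries.coeff i g)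
    (hQ : ∀ arr' : Fin 16 → ℕ → ℕ,
      (∀ c, c ≠ 0 → c ≠ 1 → c ≠ 2 → c ≠ 3 → c ≠ 4 → c ≠ 5 → arr' c = h.arr c) →
      (∀ z < n, (arr' 2 z : ZMod N) = PowerSeries.coeff z (f * g)) → Q ⟨h.v, arr'⟩) :
    wp N 10 2000 (prodCmd e₁ e₂) (prodCost l K) 0 Q h := by
  have hN := hv.one_lt
  have hK2 : 0 < K := by have := hv.hK; have := hv.two_le; omega
  have hKl : K ^ l ≤ K ^ l * K := Nat.le_mul_of_pos_right _ hK2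
  have hU : ∀ st : Store, (∀ y < 14, st.v y = h.v y) → (Expr.var 10).eval st = K ^ l := by
    intro st hst
    rw [Expr.eval_var, hst 10 (by norm_num), hv.h10]
  refine wp_seq (G₁ := 0) (G₂ := 0) (wp_mapTo hv (K ^ l) τ₁ hs₁ (by omega) hU ?_ fun arr₁ hfr₁ h₁ => ?_)
  · intro z hz st h14 hst harr
    exact he₁ z hz st h14 hst fun c hc _ => harr c hc
  refine wp_seq (G₁ := 0) (G₂ := 0) (wp_mapTo (h := ⟨h.v, arr₁⟩) hv (K ^ l) τ₂ hs₂ (by omega) hU ?_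
    fun arr₂ hfr₂ h₂ => ?_)
  · intro z hz st h14 hst harr
    exact he₂ z hz st h14 hst fun c hc hc' => (harr c hc').trans (hfr₁ c hc)
  refine wp_mulCmd (h := ⟨h.v, arr₂⟩) hv fun arr₃ hfr₃ h₃ => ?_
  apply hQ
  · intro c h0 h1 h2 h3 h4 h5
    exact (hfr₃ c h2 h3 h4 h5).trans ((hfr₂ c h1).trans (hfr₁ c h0))
  · intro z hz
    have hn' : H ^ l * H = K ^ l := hv.n_eq
    have hz' : z < 2 * H ^ l * H := by rw [mul_assoc, hn']; omega
    simp only at h₃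
    rw [h₃ z hz', hn', ZMod.natCast_mod]
    have hmap : ∀ U : ℕ → ℕ, (arrPoly (K ^ l) U).map (Nat.castRingHom (ZMod N)) =
        (arrPoly (K ^ l) fun i => (U i : ZMod N)) := fun U => by rw [arrPoly_map]; rfl
    have h4 := congrArg (fun p : Polynomial (ZMod N) => p.coeff z)
      (Polynomial.map_mul (Nat.castRingHom (ZMod N)) (p := arrPoly (K ^ l) (arr₂ 0)) (q := arrPoly (K ^ l) (arr₂ 1)))
    simp only [Polynomial.coeff_map, eq_natCast, hmap] at h4
    rw [h4, ← Polynomial.coeff_coe, Polynomial.coe_mul]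
    refine coeff_mul_congr (n := n) ?_ ?_ hz
    · intro i hi
      have e : arr₂ 0 = arr₁ 0 := hfr₂ 0 (by decide)
      rw [Polynomial.coeff_coe, coeff_arrPoly, if_pos (by omega), e, h₁ i (by omega), ZMod.natCast_mod, hf i hi]
    · intro i hi
      rw [Polynomial.coeff_coe, coeff_arrPoly, if_pos (by omega), h₂ i (by omega), ZMod.natCast_mod, hg i hi]

theorem wp_squareCmd (hv : MulSetup N l H K h.v) {a : Fin 16} (ha : 5 < a)
    (f : PowerSeries (ZMod N)) (hf : ∀ i < K ^ l, (h.arr a i : ZMod N) = PowerSeries.coeff i f)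
    (hQ : ∀ arr' : Fin 16 → ℕ → ℕ, (∀ c, 5 < c → c ≠ a → arr' c = h.arr c) →
      (∀ i < K ^ l, (arr' a i : ZMod N) = PowerSeries.coeff i (f * f)) → Q ⟨h.v, arr'⟩) :
    wp N 10 2000 (squareCmd a) (prodCost l K + passCost l K) 0 Q h := by
  have hK2 : 0 < K := by have := hv.hK; have := hv.two_le; omega
  have hKl : K ^ l ≤ K ^ l * K := Nat.le_mul_of_pos_right _ hK2
  have hne : ∀ c : Fin 16, 5 < c → c ≠ 0 ∧ c ≠ 1 ∧ c ≠ 2 ∧ c ≠ 3 ∧ c ≠ 4 ∧ c ≠ 5 := by decide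
  have hea : ∀ z < K ^ l, ∀ st : Store, st.v 14 = z → (∀ y < 14, st.v y = h.v y) →
      (∀ c, c ≠ 0 → c ≠ 1 → st.arr c = h.arr c) → (Expr.arr a (.var 14)).eval st = h.arr a z := by
    intro z hz st h14 hst harr
    rw [Expr.eval_arr, Expr.eval_var, h14, harr a (hne a ha).1 (hne a ha).2.1]
  refine wp_seq (G₁ := 0) (G₂ := 0) (wp_prodCmd hv (h.arr a) (h.arr a) f f (K ^ l) le_rfl rfl rfl hea hea hf hf
    fun arr₁ hfr₁ h₁ => ?_)
  refine wp_mapTo (h := ⟨h.v, arr₁⟩) hv (K ^ l) (arr₁ 2) rfl (by omega) ?_ ?_ fun arr₂ hfr₂ h₂ => ?_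
  · intro st hst
    rw [Expr.eval_var, hst 10 (by norm_num), hv.h10]
  · intro z hz st h14 hst harr
    rw [Expr.eval_arr, Expr.eval_var, h14, harr 2 (hne a ha).2.2.1.symm]
  · apply hQ
    · intro c hc hca
      obtain ⟨h0, h1, h2, h3, h4, h5⟩ := hne c hc
      exact (hfr₂ c hca).trans (hfr₁ c h0 h1 h2 h3 h4 h5)
    · intro i hi
      rw [h₂ i hi, ZMod.natCast_mod, h₁ i hi]

theorem eval_trunc {i n e : Expr} {st : Store} {z m x : ℕ} (hi : i.eval st = z) (hn : n.eval st = m)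
    (he : e.eval st = x) (hm : 0 < m) : (trunc i n e).eval st = if z < m then x else 0 := by
  simp only [trunc, Expr.eval_mul, Expr.eval_sub, Expr.eval_div, Expr.eval_one, hi, hn, he]
  split_ifs with h
  · simp [Nat.div_eq_of_lt h]
  · have : 1 ≤ z / m := (Nat.one_le_div_iff hm).2 (by omega)
    simp [show 1 - z / m = 0 by omega]

/-- By `Pol` the numerator vanishes from index `H ^ l` on, so `H ^ l` values of the sequence
determine it and the truncation is exact. -/
theorem wp_kernelCmd (hv : MulSetup N l H K h.v) (κ : ℕ → ZMod N) (hκ : Pol (H ^ l) κ)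
    (h7 : ∀ i < K ^ l, (h.arr 7 i : ZMod N) = PowerSeries.coeff i ((1 - PowerSeries.X) ^ H ^ l))
    (h11 : ∀ i < H ^ l, (h.arr 11 i : ZMod N) = κ i)
    (hQ : ∀ arr' : Fin 16 → ℕ → ℕ, (∀ c, 5 < c → c ≠ 12 → arr' c = h.arr c) →
      (∀ i < K ^ l, (arr' 12 i : ZMod N) =
        PowerSeries.coeff i ((1 - PowerSeries.X) ^ H ^ l * PowerSeries.mk κ)) → Q ⟨h.v, arr'⟩) :
    wp N 10 2000 kernelCmd (prodCost l K + passCost l K) 0 Q h := by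
  have hK2 : 0 < K := by have := hv.hK; have := hv.two_le; omega
  have hKl : K ^ l ≤ K ^ l * K := Nat.le_mul_of_pos_right _ hK2
  have hD0 : 0 < H ^ l := by have := hv.two_le; apply Nat.pow_pos; omega
  have hD : H ^ l ≤ K ^ l := Nat.pow_le_pow_left (by have := hv.hK; omega) l
  have hne : ∀ c : Fin 16, 5 < c → c ≠ 0 ∧ c ≠ 1 ∧ c ≠ 2 ∧ c ≠ 3 ∧ c ≠ 4 ∧ c ≠ 5 := by decide
  refine wp_seq (G₁ := 0) (G₂ := 0) (wp_prodCmd hv (h.arr 7) (fun z => if z < H ^ l then h.arr 11 z else 0)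
    ((1 - PowerSeries.X) ^ H ^ l) (PowerSeries.mk κ) (H ^ l) hD rfl rfl ?_ ?_ ?_ ?_
    fun arr₁ hfr₁ h₁ => ?_)
  · intro z hz st h14 hst harr
    simp [h14, harr 7]
  · intro z hz st h14 hst harr
    exact eval_trunc (by simpa) (by simp [hst 7, hv.h7]) (by simp [h14, harr 11]) hD0
  · intro i hi; exact h7 i (by omega)
  · intro i hi; simp [hi, h11 i hi]
  refine wp_mapTo (h := ⟨h.v, arr₁⟩) hv (K ^ l) (fun z => if z < H ^ l then arr₁ 2 z else 0) rfl (by omega) ?_ ?_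
    fun arr₂ hfr₂ h₂ => ?_
  · intro st hst
    rw [Expr.eval_var, hst 10 (by norm_num), hv.h10]
  · intro z hz st h14 hst harr
    exact eval_trunc (by simpa) (by simp [hst 7, hv.h7]) (by simp [h14, harr 2]) hD0
  · apply hQ
    · intro c hc hca
      obtain ⟨h0, h1, h2, h3, h4, h5⟩ := hne c hc
      exact (hfr₂ c hca).trans (hfr₁ c h0 h1 h2 h3 h4 h5)
    · intro i hi
      rw [h₂ i hi, ZMod.natCast_mod]
      split_ifs with hiD
      · exact h₁ i hiD
      · rw [hκ i (by omega), Nat.cast_zero]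

/-- The cost of `shiftCmd`. -/
def shiftCost (l K : ℕ) : ℕ := prodCost l K + (prodCost l K + (prodCost l K + passCost l K))

/-- With `D = H ^ l`, the numerator of `e` times the numerator of the kernel carries two factors `(1
- X) ^ D`. The third product, with the inverse power, removes one of them and leaves the series of
`coeff_kernel_mul`. The coefficients read have index below `2 * D ≤ K ^ l`, so truncation does no
harm. -/
theorem wp_shiftCmd (hv : MulSetup N l H K h.v) {a : Fin 16} (ha : 5 < a) (s : ℕ) (e : ℕ → ZMod N)
    (he : Pol (H ^ l) e)
    (h7 : ∀ i < K ^ l, (h.arr 7 i : ZMod N) = PowerSeries.coeff i ((1 - PowerSeries.X) ^ H ^ l))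
    (h8 : ∀ i < K ^ l, (h.arr 8 i : ZMod N) = PowerSeries.coeff i (geom (ZMod N) ^ H ^ l))
    (h12 : ∀ i < K ^ l, (h.arr 12 i : ZMod N) = PowerSeries.coeff i
      ((1 - PowerSeries.X) ^ H ^ l * PowerSeries.mk fun i => kernel (ZMod N) (H ^ l) (s + i)))
    (hae : ∀ i < H ^ l, (h.arr a i : ZMod N) = e i)
    (hQ : ∀ arr' : Fin 16 → ℕ → ℕ, (∀ c, 5 < c → c ≠ 13 → arr' c = h.arr c) →
      (∀ i < H ^ l, (arr' 13 i : ZMod N) = e (s + i)) → Q ⟨h.v, arr'⟩) :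
    wp N 10 2000 (shiftCmd a) (shiftCost l K) 0 Q h := by
  have hK2 : 0 < K := by have := hv.hK; have := hv.two_le; omega
  have hKl : K ^ l ≤ K ^ l * K := Nat.le_mul_of_pos_right _ hK2
  have hD0 : 0 < H ^ l := by have := hv.two_le; apply Nat.pow_pos; omega
  have hD : H ^ l ≤ K ^ l := Nat.pow_le_pow_left (by have := hv.hK; omega) l
  have h2D : 2 * H ^ l ≤ K ^ l := by
    have hn : H ^ l * H = K ^ l := hv.n_eq
    rw [← hn, mul_comm]
    exact Nat.mul_le_mul_left _ hv.two_le
  have hne : ∀ c : Fin 16, 5 < c → c ≠ 0 ∧ c ≠ 1 ∧ c ≠ 2 ∧ c ≠ 3 ∧ c ≠ 4 ∧ c ≠ 5 := by decide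
  set P : PowerSeries (ZMod N) := (1 - PowerSeries.X) ^ H ^ l with hP
  refine wp_seq (G₁ := 0) (G₂ := 0) (wp_prodCmd hv (h.arr 7) (fun z => if z < H ^ l then h.arr a z else 0)
    P (PowerSeries.mk e) (H ^ l) hD rfl rfl ?_ ?_ ?_ ?_ fun arr₁ hfr₁ h₁ => ?_)
  · intro z hz st h14 hst harr
    simp [h14, harr 7]
  · intro z hz st h14 hst harr
    exact eval_trunc (by simpa) (by simp [hst 7, hv.h7])
      (by simp [h14, harr a (hne a ha).1 (hne a ha).2.1]) hD0
  · intro i hi; exact h7 i (by omega)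
  · intro i hi; simp [hi, hae i hi]
  refine wp_seq (G₁ := 0) (G₂ := 0) (wp_prodCmd (h := ⟨h.v, arr₁⟩) hv (fun z => if z < H ^ l then arr₁ 2 z else 0)
    (arr₁ 12) (P * PowerSeries.mk e) (P * PowerSeries.mk fun i => kernel (ZMod N) (H ^ l) (s + i))
    (K ^ l) le_rfl rfl rfl ?_ ?_ ?_ ?_ fun arr₂ hfr₂ h₂ => ?_)
  · intro z hz st h14 hst harr
    exact eval_trunc (by simpa) (by simp [hst 7, hv.h7]) (by simp [h14, harr 2]) hD0
  · intro z hz st h14 hst harr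
    simp [h14, harr 12]
  · intro i hi
    split_ifs with hiD
    · exact h₁ i hiD
    · rw [he i (by omega), Nat.cast_zero]
  · rw [hfr₁ 12 (by decide) (by decide) (by decide) (by decide) (by decide) (by decide)]
    exact h12
  refine wp_seq (G₁ := 0) (G₂ := 0) (wp_prodCmd (h := ⟨h.v, arr₂⟩) hv (arr₂ 2) (arr₂ 8) _ (geom (ZMod N) ^ H ^ l)
    (K ^ l) le_rfl rfl rfl ?_ ?_ h₂ ?_ fun arr₃ hfr₃ h₃ => ?_)
  · intro z hz st h14 hst harr
    simp [h14, harr 2]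
  · intro z hz st h14 hst harr
    simp [h14, harr 8]
  · have e1 : arr₂ 8 = arr₁ 8 := hfr₂ 8 (by decide) (by decide) (by decide) (by decide) (by decide) (by decide)
    rw [e1, hfr₁ 8 (by decide) (by decide) (by decide) (by decide) (by decide) (by decide)]
    exact h8
  refine wp_mapTo (h := ⟨h.v, arr₃⟩) hv (H ^ l) (fun z => arr₃ 2 (H ^ l - 1 + z)) rfl (by omega) ?_ ?_
    fun arr₄ hfr₄ h₄ => ?_
  · intro st hst
    rw [Expr.eval_var, hst 7 (by norm_num), hv.h7]
  · intro z hz st h14 hst harr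
    simp [h14, harr 2, hst 7, hv.h7]
  · apply hQ
    · intro c hc hca
      obtain ⟨h0, h1, h2, h3, h4, h5⟩ := hne c hc
      exact (hfr₄ c hca).trans ((hfr₃ c h0 h1 h2 h3 h4 h5).trans
        ((hfr₂ c h0 h1 h2 h3 h4 h5).trans (hfr₁ c h0 h1 h2 h3 h4 h5)))
    · intro i hi
      rw [h₄ i hi, ZMod.natCast_mod, h₃ _ (by omega), ← coeff_kernel_mul hD0 he s i]
      congr 1
      have := one_sub_pow_mul_geom_pow (R := ZMod N) (H ^ l)
      rw [← hP] at this ⊢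
      linear_combination (P * PowerSeries.mk e * PowerSeries.mk fun i => kernel (ZMod N) (H ^ l) (s + i)) * this

end

end WordRAM

/-! ### Stages of the factorization program, and the choice of parameters -/

namespace WordRAM

open BlockTransform SeriesShift

/-- Compute the least `d` with `B ≤ m * d ^ 2`. -/
def rootCmd : Cmd := whl (.var 4 * .var 4 * .var 2) (.var 1) (asg 4 (.var 4 + 1))

/-- Compute the parameters of the multiplication. -/
def paramCmd : Cmd :=
  .seq (asg 6 2) (.seq (asg 7 2) (.seq
    (whl (.var 7) (.var 4 + 1) (.seq (asg 7 (.var 7 * (2 * (.var 6 * .var 6)))) (asg 6 (2 * .var 6))))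
    (.seq (asg 8 (2 * .var 6)) (.seq (asg 10 (.var 6 * .var 7)) (asg 11 (.var 0 * .var 10))))))

/-- Compute the powers of `1 - X` and of its inverse. -/
def powersCmd : Cmd :=
  .seq (mapTo 7 (.var 10) ((1 - .var 14) + (.var 0 - 1) * (.var 14 * (2 - .var 14))))
    (.seq (mapTo 8 (.var 10) 1) (.seq (asg 13 1)
      (whl (.var 13) (.var 7) (.seq (squareCmd 7) (.seq (squareCmd 8) (asg 13 (2 * .var 13)))))))

/-- Start values of the sequences. -/
def startCmd : Cmd :=
  .seq (mapTo 11 (.var 7) (.arr 8 (.var 4 + .var 14 + 1 - .var 7) *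
      (1 - (.var 7 - 1 - (.var 4 + .var 14)))))
    (.seq (mapTo 9 (.var 7) (.var 2 * (.var 14 + 1) + (.var 0 - (.var 2 * .var 4 * .var 4 + .var 3))))
      (.seq (mapTo 10 (.var 7) 1) (asg 12 (.var 4))))

/-- Products along arithmetic progressions, by repeated doubling. -/
def doublingCmd : Cmd :=
  whl 0 (.var 12) (.seq kernelCmd (.seq (shiftCmd 10)
    (.seq (mapTo 14 (.var 7) (.var 12 % 2 * (.arr 13 (.var 14) * .arr 9 (.var 14)) +
      (1 - .var 12 % 2) * .arr 10 (.var 14)))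
    (.seq (mapTo 10 (.var 7) (.arr 14 (.var 14)))
    (.seq (shiftCmd 9) (.seq (mapTo 14 (.var 7) (.arr 9 (.var 14) * .arr 13 (.var 14)))
    (.seq (mapTo 9 (.var 7) (.arr 14 (.var 14)))
    (.seq (shiftCmd 11) (.seq (mapTo 11 (.var 7) (.arr 13 (.var 14)))
      (asg 12 (.var 12 / 2)))))))))))

/-- Search for a nontrivial gcd. -/
def searchCmd : Cmd :=
  .seq (asg 19 0) (.seq (asg 20 1) (.seq
    (whl (.var 20) 2 (.seq (asg 20 (.bin .gcd (.arr 10 (.var 19)) (.var 0))) (asg 19 (.var 19 + 1))))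
    (.seq (asg 20 (.var 20 % .var 0)) (.seq (asg 21 0) (.seq
      (whl (.var 20) 2 (.seq (asg 21 (.var 21 + 1)) (asg 20 (.bin .gcd
        ((.var 2 * .var 19 - (.var 2 * .var 4 * .var 21 + .var 3)) +
          ((.var 2 * .var 4 * .var 21 + .var 3) - .var 2 * .var 19)) (.var 0)))))
      (asg 0 (.var 20)))))))

section

variable {N : ℕ} {h : Store} {Q : Store → Prop}

theorem wp_rootCmd (hN : 1 < N) {d : ℕ} (hd : d < N) (h4 : h.v 4 = 0)
    (hlt : ∀ d' < d, d' * d' * h.v 2 < h.v 1) (hge : h.v 1 ≤ d * d * h.v 2)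
    (hQ : Q ⟨Function.update h.v 4 d, h.arr⟩) :
    wp N 10 2000 rootCmd ((d + 1) * 600) 0 Q h := by
  have hN10 : N ≤ N ^ 10 := Nat.le_self_pow (by norm_num) N
  refine wp_mono (wp_whl_small (G := 0) (T := 300) hN (fun n h' => ∃ d', d' + n = d ∧
    h' = ⟨Function.update h.v 4 d', h.arr⟩) d rfl ?_ ?_ ?_) le_rfl (by omega) (fun _ h => h)
  · exact ⟨0, by omega, by rw [← h4, Function.update_eq_self]⟩
  · rintro n h' ⟨d', hd', rfl⟩ hlt'
    simp at hlt'
    have hdd : d' < d := by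
      by_contra hcon
      have : d = d' := by omega
      subst this
      omega
    obtain ⟨n', rfl⟩ : ∃ n', n = n' + 1 := ⟨n - 1, by omega⟩
    refine ⟨n', rfl, wp_asg_small hN rfl (by simp; omega) ⟨d' + 1, by omega, by simp⟩⟩
  · rintro n h' ⟨d', hd', rfl⟩ hle
    simp at hle
    have : d' = d := by
      by_contra hne
      have := hlt d' (by omega)
      omega
    subst this
    exact hQ

/-- The size parameter `l` belongs to `d`. -/
structure SizeFor (d l : ℕ) : Prop where
  two_le_d : 2 ≤ d
  two_le : 2 ≤ l
  lt : d < (2 ^ l) ^ l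
  ge : ∀ l' < l, 1 ≤ l' → (2 ^ l') ^ l' ≤ d

theorem SizeFor.exists {d : ℕ} (hd : 2 ≤ d) : ∃ l, SizeFor d l := by
  have hex : ∃ l, 1 ≤ l ∧ d < (2 ^ l) ^ l := by
    refine ⟨d, by omega, ?_⟩
    calc d < 2 ^ d := Nat.lt_two_pow_self
      _ ≤ _ := Nat.le_self_pow (by omega) _
  classical
  refine ⟨Nat.find hex, hd, ?_, (Nat.find_spec hex).2, ?_⟩
  · have h1 := (Nat.find_spec hex).1
    by_contra hlt
    have h2 := (Nat.find_spec hex).2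
    rw [show Nat.find hex = 1 by omega] at h2
    omega
  · intro l' hl' h1
    by_contra hcon
    exact Nat.find_min hex hl' ⟨h1, by omega⟩

theorem SizeFor.pow_le {d l : ℕ} (hs : SizeFor d l) : 2 ^ l ≤ 2 * d := by
  have h2 := hs.two_le
  have := hs.ge (l - 1) (by omega) (by omega)
  calc 2 ^ l = 2 * 2 ^ (l - 1) := by rw [← pow_succ']; congr 1; omega
    _ ≤ 2 * (2 ^ (l - 1)) ^ (l - 1) := by
      gcongr
      exact Nat.le_self_pow (by omega) _
    _ ≤ 2 * d := by omega

/-- Minimality of `l` gives `2 ^ ((l - 1) ^ 2) ≤ d`, and `l ^ 2 + 1 = 2 * l + (l - 1) ^ 2`: the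
table length exceeds `d` by at most a factor `H ^ 2 / 2`. -/
theorem SizeFor.pow_pow_le {d l : ℕ} (hs : SizeFor d l) : 2 * (2 ^ l) ^ l ≤ (2 ^ l * 2 ^ l) * d := by
  have h2 := hs.two_le
  have := hs.ge (l - 1) (by omega) (by omega)
  have e : 2 * (2 ^ l) ^ l = (2 ^ l * 2 ^ l) * (2 ^ (l - 1)) ^ (l - 1) := by
    obtain ⟨k, rfl⟩ : ∃ k, l = k + 1 := ⟨l - 1, by omega⟩
    simp only [Nat.add_sub_cancel]
    rw [← pow_mul, ← pow_mul, ← pow_add, ← pow_add, ← pow_succ']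
    congr 1; ring
  rw [e]
  exact Nat.mul_le_mul_left _ this

/-- Table sizes are bounded by powers of `d`, and `d ^ 2 < N`, so the sizes and the modulus `N * K ^
l` fit under the bound `N ^ 10` for stored values. -/
theorem SizeFor.bound {d l N : ℕ} (hs : SizeFor d l) (hN : d * d < N) :
    4 * ((2 * 2 ^ l) ^ l * (2 * 2 ^ l)) < N ^ 10 ∧ N * (2 * 2 ^ l) ^ l < N ^ 10 := by
  have h1 := hs.pow_le
  have h2 := hs.pow_pow_le
  have hd := hs.two_le_d
  generalize hH : 2 ^ l = H at *
  have hn : (2 * H) ^ l = H * H ^ l := by rw [mul_pow, hH]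
  have h3 : 2 * H ^ l ≤ 4 * d ^ 3 := by
    calc 2 * H ^ l ≤ H * H * d := h2
      _ ≤ (2 * d) * (2 * d) * d := by gcongr
      _ = _ := by ring
  have h4 : (2 * H) ^ l ≤ 4 * d ^ 4 := by
    rw [hn]
    calc H * H ^ l ≤ (2 * d) * (2 * d ^ 3) := by gcongr; omega
      _ = _ := by ring
  have h5 : 4 * ((2 * H) ^ l * (2 * H)) ≤ 2 ^ 6 * d ^ 5 := by
    calc 4 * ((2 * H) ^ l * (2 * H)) ≤ 4 * (4 * d ^ 4 * (2 * (2 * d))) := by gcongr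
      _ = _ := by ring
  constructor
  · calc _ ≤ 2 ^ 6 * d ^ 5 := h5
      _ ≤ d ^ 6 * d ^ 5 := by gcongr
      _ = d ^ 11 := by ring
      _ ≤ d ^ 20 := Nat.pow_le_pow_right (by omega) (by norm_num)
      _ = (d * d) ^ 10 := by ring
      _ < N ^ 10 := Nat.pow_lt_pow_left hN (by norm_num)
  · calc N * (2 * H) ^ l ≤ N * (d ^ 2 * d ^ 4) := by
          gcongr
          calc (2 * H) ^ l ≤ 2 ^ 2 * d ^ 4 := h4
            _ ≤ _ := by gcongr
      _ = N * (d * d) ^ 3 := by ring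
      _ < N * N ^ 3 := by
        have := Nat.pow_lt_pow_left hN (n := 3) (by norm_num)
        exact Nat.mul_lt_mul_of_pos_left this (by omega)
      _ = N ^ 4 := by ring
      _ ≤ N ^ 10 := Nat.pow_le_pow_right (by omega) (by norm_num)

theorem wp_paramCmd {d l : ℕ} (hs : SizeFor d l) (hd : d * d < N) (h0 : h.v 0 = N) (h4 : h.v 4 = d)
    (hz : ∀ y, 14 ≤ y → h.v y = 0)
    (hQ : ∀ v, MulSetup N l (2 ^ l) (2 * 2 ^ l) v → (∀ y < 5, v y = h.v y) → Q ⟨v, h.arr⟩) :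
    wp N 10 2000 paramCmd ((l + 1) * 900 + 1500) 0 Q h := by
  have hd2 := hs.two_le_d
  have hN : 1 < N := by nlinarith
  have hN10 : N ≤ N ^ 10 := Nat.le_self_pow (by norm_num) N
  have hH2 : 2 ≤ 2 ^ l := by
    calc 2 = 2 ^ 1 := rfl
      _ ≤ 2 ^ l := Nat.pow_le_pow_right (by norm_num) (by have := hs.two_le; omega)
  have hn : (2 * 2 ^ l) ^ l = 2 ^ l * (2 ^ l) ^ l := by rw [mul_pow]
  obtain ⟨hb1, hb2⟩ := hs.bound hd
  have hKl0 : 0 < (2 * 2 ^ l) ^ l := by positivity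
  have hK1 : 2 * 2 ^ l ≤ (2 * 2 ^ l) ^ l * (2 * 2 ^ l) := Nat.le_mul_of_pos_left _ hKl0
  have hK2 : (2 * 2 ^ l) ^ l ≤ (2 * 2 ^ l) ^ l * (2 * 2 ^ l) := Nat.le_mul_of_pos_right _ (by positivity)
  have hD : (2 ^ l) ^ l ≤ (2 * 2 ^ l) ^ l := Nat.pow_le_pow_left (by omega) l
  have h2N : 2 < N ^ 10 := by omega
  have key : ∀ l', l' ≤ l → (2 ^ l') ^ l' < N ^ 10 ∧ 2 ^ l' < N ^ 10 := by
    intro l' hl'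
    have h1 : 2 ^ l' ≤ 2 ^ l := Nat.pow_le_pow_right (by norm_num) hl'
    have h2 : (2 ^ l') ^ l' ≤ (2 ^ l) ^ l :=
      (Nat.pow_le_pow_left h1 l').trans (Nat.pow_le_pow_right (by omega) hl')
    omega
  refine wp_mono (T := 300 + (300 + ((l + 1) * (600 + 300) + (300 + (300 + 300))))) ?_ (by omega) le_rfl
    (fun _ h => h)
  refine wp_seq (G₁ := 0) (G₂ := 0) (wp_asg_small hN rfl (by simpa using h2N) ?_)
  refine wp_seq (G₁ := 0) (G₂ := 0) (wp_asg_small hN rfl (by simpa using h2N) ?_)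
  refine wp_seq (G₁ := 0) (G₂ := 0) (wp_mono (wp_whl_small (G := 0) (T := 300 + 300) hN
    (fun n h' => ∃ l', 1 ≤ l' ∧ l' + n = l + 1 ∧ l' ≤ l ∧
        h' = ⟨Function.update (Function.update h.v 6 (2 ^ l')) 7 ((2 ^ l') ^ l'), h.arr⟩) l rfl ?_ ?_ ?_)
    le_rfl (by omega) (fun _ h => h))
  · exact ⟨1, le_rfl, by omega, by have := hs.two_le; omega, rfl⟩
  · rintro n h' ⟨l', h1, h2, h3, rfl⟩ hlt
    simp [h4] at hlt
    have hll : l' < l := by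
      by_contra hcon
      have : l' = l := by omega
      subst this
      have := hs.lt
      omega
    have hk := key (l' + 1) hll
    -- The loop never stores `l'`: by `(l' + 1) ^ 2 = l' ^ 2 + 2 * l' + 1` the next power is
    -- obtained from the current two.
    have e1 : (2 ^ (l' + 1)) ^ (l' + 1) = (2 ^ l') ^ l' * (2 * (2 ^ l' * 2 ^ l')) := by
      rw [← pow_mul, ← pow_mul, ← pow_add, ← pow_succ', ← pow_add]
      congr 1; ring
    have e2 : 2 ^ (l' + 1) = 2 * 2 ^ l' := pow_succ' 2 l'
    rw [e1, e2] at hk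
    obtain ⟨n', rfl⟩ : ∃ n', n = n' + 1 := ⟨n - 1, by omega⟩
    refine ⟨n', rfl, wp_seq (G₁ := 0) (G₂ := 0) (wp_asg_small hN rfl (by simpa using hk.1) ?_)⟩
    refine wp_asg_small hN rfl (by simpa using hk.2) ⟨l' + 1, by omega, by omega, hll, ?_⟩
    rw [e1, e2]
    ext x
    · simp [Function.update_apply]
      split_ifs <;> simp_all
    · rfl
  · rintro n h' ⟨l', h1, h2, h3, rfl⟩ hle
    simp [h4] at hle
    have : l' = l := by
      by_contra hne
      have := hs.ge l' (by omega) h1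
      omega
    subst this
    refine wp_seq (G₁ := 0) (G₂ := 0) (wp_asg_small hN rfl (by simp; omega) ?_)
    refine wp_seq (G₁ := 0) (G₂ := 0) (wp_asg_small hN rfl (by simp [← hn]; omega) ?_)
    refine wp_asg_small hN rfl (by simpa [← hn, h0] using hb2) ?_
    refine hQ _ ?_ ?_
    · exact ⟨hN, by omega, hH2, rfl, rfl, by simp [h0], by simp, by simp, by simp, by simp [← hn],
        by simp [← hn, h0], by simp [hz], by simp [hz], by simp [hz], by simp [hz], by simp [hz], hb1⟩
    · intro y hy
      simp [show y ≠ 6 by omega, show y ≠ 7 by omega, show y ≠ 8 by omega,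
        show y ≠ 10 by omega, show y ≠ 11 by omega]

end

end WordRAM

/-! ### Initial tables -/

namespace WordRAM

open BlockTransform SeriesShift

section

variable {N l H K : ℕ} {h : Store} {Q : Store → Prop}

theorem MulSetup.update {v : ℕ → ℕ} (hv : MulSetup N l H K v) {x : ℕ}
    (hx : x = 12 ∨ x = 13 ∨ 19 ≤ x) (a : ℕ) : MulSetup N l H K (Function.update v x a) := by
  have e : ∀ y, y ≠ x → Function.update v x a y = v y := fun y hy => Function.update_of_ne hy _ _
  refine ⟨hv.one_lt, hv.l_pos, hv.two_le, hv.hH, hv.hK, ?_, ?_, ?_, ?_, ?_, ?_, ?_, ?_, ?_, ?_, ?_,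
    hv.bound⟩
  all_goals rw [e _ (by omega)]
  exacts [hv.h0, hv.h6, hv.h7, hv.h8, hv.h10, hv.h11, hv.h14, hv.h15, hv.h16, hv.h17, hv.h18]

theorem MulSetup.pow_lt (hv : MulSetup N l H K h.v) : H ^ l ≤ K ^ l ∧ 0 < H ^ l ∧
    K ^ l ≤ 2 * (K ^ l * K) ∧ 2 * H ^ l < N ^ 10 := by
  have hK2 : 0 < K := by have := hv.hK; have := hv.two_le; omega
  have hKl : K ^ l ≤ K ^ l * K := Nat.le_mul_of_pos_right _ hK2
  have hD0 : 0 < H ^ l := by have := hv.two_le; apply Nat.pow_pos; omega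
  have hD : H ^ l ≤ K ^ l := Nat.pow_le_pow_left (by have := hv.hK; omega) l
  have := hv.bound
  exact ⟨hD, hD0, by omega, by omega⟩

/-- The cost of `powersCmd`. -/
def powersCost (l K : ℕ) : ℕ := passCost l K + (passCost l K + (300 + (l * l + 1) *
  ((prodCost l K + passCost l K) + ((prodCost l K + passCost l K) + 300) + 300)))

theorem wp_powersCmd (hv : MulSetup N l H K h.v)
    (hQ : ∀ v arr', MulSetup N l H K v → (∀ y, y ≠ 13 → v y = h.v y) →
      (∀ i < K ^ l, (arr' 7 i : ZMod N) = PowerSeries.coeff i ((1 - PowerSeries.X) ^ H ^ l)) →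
      (∀ i < K ^ l, (arr' 8 i : ZMod N) = PowerSeries.coeff i (geom (ZMod N) ^ H ^ l)) → Q ⟨v, arr'⟩) :
    wp N 10 2000 powersCmd (powersCost l K) 0 Q h := by
  have hN := hv.one_lt
  obtain ⟨hD, hD0, hKl, hDN⟩ := hv.pow_lt
  have hDl : H ^ l = 2 ^ (l * l) := by rw [hv.hH, ← pow_mul]
  have hU : ∀ st : Store, (∀ y < 14, st.v y = h.v y) → (Expr.var 10).eval st = K ^ l := by
    intro st hst
    rw [Expr.eval_var, hst 10 (by norm_num), hv.h10]
  -- The coefficients `1, -1, 0, 0, …` of `1 - X`: `N - 1` stands for `-1`, and truncated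
  -- subtraction does the case distinction.
  refine wp_seq (G₁ := 0) (G₂ := 0) (wp_mapTo hv (K ^ l) (fun z => (1 - z) + (N - 1) * (z * (2 - z)))
    rfl hKl hU ?_ fun arr₁ hfr₁ h₁ => ?_)
  · intro z hz st h14 hst harr
    simp [h14, hst 0, hv.h0]
  refine wp_seq (G₁ := 0) (G₂ := 0) (wp_mapTo (h := ⟨h.v, arr₁⟩) hv (K ^ l) (fun z => 1)
    rfl hKl hU ?_ fun arr₂ hfr₂ h₂ => ?_)
  · intro z hz st h14 hst harr
    simp
  refine wp_seq (G₁ := 0) (G₂ := 0) (wp_asg_small hN rfl (by simp; omega) ?_)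
  refine wp_mono (wp_whl_small (G := 0)
    (T := (prodCost l K + passCost l K) + ((prodCost l K + passCost l K) + 300)) hN
    (fun n h' => ∃ t arr', t + n = l * l ∧ h' = ⟨Function.update h.v 13 (2 ^ t), arr'⟩ ∧
      (∀ i < K ^ l, (arr' 7 i : ZMod N) = PowerSeries.coeff i ((1 - PowerSeries.X) ^ 2 ^ t)) ∧
      (∀ i < K ^ l, (arr' 8 i : ZMod N) = PowerSeries.coeff i (geom (ZMod N) ^ 2 ^ t)))
    (l * l) rfl ?_ ?_ ?_) le_rfl (by omega) (fun _ h => h)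
  · refine ⟨0, arr₂, by omega, rfl, ?_, ?_⟩
    · intro i hi
      simp only [hfr₂ 7 (by decide)]
      rw [h₁ i hi, ZMod.natCast_mod]
      obtain ⟨N, rfl⟩ : ∃ N', N = N' + 1 := ⟨N - 1, by omega⟩
      rcases i with _ | _ | i
      · simp
      · have : ((N + 1 : ℕ) : ZMod (N + 1)) = 0 := ZMod.natCast_self _
        push_cast at this
        simp [PowerSeries.coeff_one, PowerSeries.coeff_X]
        linear_combination this
      · simp [PowerSeries.coeff_one, PowerSeries.coeff_X]
    · intro i hi
      rw [h₂ i hi, ZMod.natCast_mod]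
      simp [geom]
  · rintro n h' ⟨t, arr', ht, rfl, h7, h8⟩ hlt
    have htl : t < l * l := by
      simp [hv.h7, hDl] at hlt
      exact (Nat.pow_lt_pow_iff_right (by norm_num)).1 hlt
    have h2 : ∀ {S : Type} [Monoid S] (f : S), f ^ 2 ^ (t + 1) = f ^ 2 ^ t * f ^ 2 ^ t := by
      intro S _ f
      rw [← pow_add]; congr 1; ring
    obtain ⟨n', rfl⟩ : ∃ n', n = n' + 1 := ⟨n - 1, by omega⟩
    have hv' : MulSetup N l H K (Function.update h.v 13 (2 ^ t)) := hv.update (by omega) _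
    refine ⟨n', rfl, wp_seq (G₁ := 0) (G₂ := 0) (wp_squareCmd hv' (by decide) _ h7 fun arr₃ hfr₃ h₃ => ?_)⟩
    have h8' : ∀ i < K ^ l, (arr₃ 8 i : ZMod N) = PowerSeries.coeff i (geom (ZMod N) ^ 2 ^ t) := by
      rw [hfr₃ 8 (by decide) (by decide)]; exact h8
    refine wp_seq (G₁ := 0) (G₂ := 0) (wp_squareCmd (h := ⟨Function.update h.v 13 (2 ^ t), arr₃⟩) hv' (by decide) _ h8'
      fun arr₄ hfr₄ h₄ => ?_)
    have hlt2 : 2 * 2 ^ t < N ^ 10 := by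
      have : 2 ^ t < 2 ^ (l * l) := (Nat.pow_lt_pow_iff_right (by norm_num)).2 htl
      omega
    refine wp_asg_small hN rfl (by simpa using hlt2) ⟨t + 1, arr₄, by omega, ?_, ?_, ?_⟩
    · simp [pow_succ']
    · intro i hi
      rw [h2, ← h₃ i hi, hfr₄ 7 (by decide) (by decide)]
    · intro i hi
      rw [h2, ← h₄ i hi]
  · rintro n h' ⟨t, arr', ht, rfl, h7, h8⟩ hle
    have htl : l * l ≤ t := by
      simp [hv.h7, hDl] at hle
      exact (Nat.pow_le_pow_iff_right (by norm_num)).1 hle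
    obtain rfl : t = l * l := by omega
    rw [← hDl] at h7 h8 ⊢
    exact hQ _ _ (hv.update (by omega) _) (fun y hy => by simp [hy]) h7 h8

/-- The cost of `startCmd`. -/
def startCost (l K : ℕ) : ℕ := passCost l K + (passCost l K + (passCost l K + 300))

theorem wp_startCmd (hv : MulSetup N l H K h.v) {m r d : ℕ} (h2 : h.v 2 = m) (h3 : h.v 3 = r)
    (h4 : h.v 4 = d) (hd : d < H ^ l) (hle : m * d * d + r ≤ N)
    (h8 : ∀ i < K ^ l, (h.arr 8 i : ZMod N) = PowerSeries.coeff i (geom (ZMod N) ^ H ^ l))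
    (hQ : ∀ v arr', MulSetup N l H K v → (∀ y, y ≠ 12 → v y = h.v y) → v 12 = d →
      arr' 7 = h.arr 7 → arr' 8 = h.arr 8 →
      (∀ i < H ^ l, (arr' 9 i : ZMod N) = apProd (m : ZMod N) (m - (m * d * d + r : ℕ)) d 1 i) →
      (∀ i < H ^ l, (arr' 10 i : ZMod N) = 1) →
      (∀ i < H ^ l, (arr' 11 i : ZMod N) = kernel (ZMod N) (H ^ l) (d + i)) → Q ⟨v, arr'⟩) :
    wp N 10 2000 startCmd (startCost l K) 0 Q h := by
  have hN := hv.one_lt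
  obtain ⟨hD, hD0, hKl, hDN⟩ := hv.pow_lt
  have h2D : 2 * H ^ l ≤ K ^ l := by
    have hn : H ^ l * H = K ^ l := hv.n_eq
    rw [← hn, mul_comm]
    exact Nat.mul_le_mul_left _ hv.two_le
  have hU : ∀ st : Store, (∀ y < 14, st.v y = h.v y) → (Expr.var 7).eval st = H ^ l := by
    intro st hst
    rw [Expr.eval_var, hst 7 (by norm_num), hv.h7]
  -- With `D = H ^ l`, coefficient `d + z` of `X ^ (D - 1) * (1 - X) ^ (-D)`. The last factor is
  -- zero exactly for `d + z < D - 1`, where the truncated index would read a wrong entry.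
  refine wp_seq (G₁ := 0) (G₂ := 0) (wp_mapTo hv (H ^ l)
    (fun z => h.arr 8 (d + z + 1 - H ^ l) * (1 - (H ^ l - 1 - (d + z)))) rfl (by omega) hU ?_
    fun arr₁ hfr₁ h₁ => ?_)
  · intro z hz st h14 hst harr
    simp [h14, hst 4, hst 7, h4, hv.h7, harr 8]
  refine wp_seq (G₁ := 0) (G₂ := 0) (wp_mapTo (h := ⟨h.v, arr₁⟩) hv (H ^ l)
    (fun z => m * (z + 1) + (N - (m * d * d + r))) rfl (by omega) hU ?_ fun arr₂ hfr₂ h₂ => ?_)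
  · intro z hz st h14 hst harr
    simp [h14, hst 0, hst 2, hst 3, hst 4, h2, h3, h4, hv.h0]
  refine wp_seq (G₁ := 0) (G₂ := 0) (wp_mapTo (h := ⟨h.v, arr₂⟩) hv (H ^ l)
    (fun z => 1) rfl (by omega) hU ?_ fun arr₃ hfr₃ h₃ => ?_)
  · intro z hz st h14 hst harr
    simp
  refine wp_asg_small hN rfl (by simp [h4]; omega) ?_
  refine hQ _ _ (hv.update (by omega) _) (fun y hy => by simp [hy]) (by simp [h4]) ?_ ?_ ?_ ?_ ?_
  · exact (hfr₃ 7 (by decide)).trans ((hfr₂ 7 (by decide)).trans (hfr₁ 7 (by decide)))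
  · exact (hfr₃ 8 (by decide)).trans ((hfr₂ 8 (by decide)).trans (hfr₁ 8 (by decide)))
  · intro i hi
    simp only
    rw [hfr₃ 9 (by decide)]
    simp only
    rw [h₂ i hi, ZMod.natCast_mod]
    push_cast [Nat.cast_sub hle]
    simp [apProd]
    ring
  · intro i hi
    simp only
    rw [h₃ i hi, ZMod.natCast_mod, Nat.cast_one]
  · intro i hi
    simp only
    simp only [hfr₃ 11 (by decide), hfr₂ 11 (by decide)]
    rw [h₁ i hi, ZMod.natCast_mod, kernel,
      PowerSeries.coeff_X_pow_mul']
    split_ifs with hle'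
    · rw [show 1 - (H ^ l - 1 - (d + i)) = 1 by omega, mul_one, h8 _ (by omega)]
      congr 1; congr 1; omega
    · rw [show 1 - (H ^ l - 1 - (d + i)) = 0 by omega, mul_zero, Nat.cast_zero]

end

end WordRAM

/-! ### Doubling of the products, and the gcd search -/

namespace WordRAM

open BlockTransform SeriesShift

section

variable {N l H K : ℕ} {h : Store} {Q : Store → Prop}

/-- The cost of an iteration of `doublingCmd`. -/
def doublingCost (l K : ℕ) : ℕ :=
  (prodCost l K + passCost l K) + (shiftCost l K + (passCost l K + (passCost l K + (shiftCost l K +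
    (passCost l K + (passCost l K + (shiftCost l K + (passCost l K + 300))))))))

/-- A binary ladder on `d` from the lowest bit. Arrays `9` and `10` hold products of `2 ^ t` and `d
% 2 ^ t` factors. Both are moved by `d * 2 ^ t`: the first is doubled, and the second absorbs the
first if bit `t` of `d` is set. Moving the kernel table in array `11` by its own offset doubles that
offset, as the next round requires. -/
theorem wp_doublingBody (hv : MulSetup N l H K h.v) {m c : ZMod N} {d t : ℕ} (hd : d < H ^ l)
    (ht : 2 ^ t ≤ d) (h12 : h.v 12 = d / 2 ^ t)
    (h7 : ∀ i < K ^ l, (h.arr 7 i : ZMod N) = PowerSeries.coeff i ((1 - PowerSeries.X) ^ H ^ l))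
    (h8 : ∀ i < K ^ l, (h.arr 8 i : ZMod N) = PowerSeries.coeff i (geom (ZMod N) ^ H ^ l))
    (h9 : ∀ i < H ^ l, (h.arr 9 i : ZMod N) = apProd m c d (2 ^ t) i)
    (h10 : ∀ i < H ^ l, (h.arr 10 i : ZMod N) = apProd m c d (d % 2 ^ t) i)
    (h11 : ∀ i < H ^ l, (h.arr 11 i : ZMod N) = kernel (ZMod N) (H ^ l) (d * 2 ^ t + i))
    (hQ : ∀ arr' : Fin 16 → ℕ → ℕ, arr' 7 = h.arr 7 → arr' 8 = h.arr 8 →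
      (∀ i < H ^ l, (arr' 9 i : ZMod N) = apProd m c d (2 ^ (t + 1)) i) →
      (∀ i < H ^ l, (arr' 10 i : ZMod N) = apProd m c d (d % 2 ^ (t + 1)) i) →
      (∀ i < H ^ l, (arr' 11 i : ZMod N) = kernel (ZMod N) (H ^ l) (d * 2 ^ (t + 1) + i)) →
      Q ⟨Function.update h.v 12 (d / 2 ^ (t + 1)), arr'⟩) :
    wp N 10 2000 (.seq kernelCmd (.seq (shiftCmd 10)
      (.seq (mapTo 14 (.var 7) (.var 12 % 2 * (.arr 13 (.var 14) * .arr 9 (.var 14)) +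
        (1 - .var 12 % 2) * .arr 10 (.var 14)))
      (.seq (mapTo 10 (.var 7) (.arr 14 (.var 14)))
      (.seq (shiftCmd 9) (.seq (mapTo 14 (.var 7) (.arr 9 (.var 14) * .arr 13 (.var 14)))
      (.seq (mapTo 9 (.var 7) (.arr 14 (.var 14)))
      (.seq (shiftCmd 11) (.seq (mapTo 11 (.var 7) (.arr 13 (.var 14)))
        (asg 12 (.var 12 / 2))))))))))) (doublingCost l K) 0 Q h := by
  obtain ⟨v, arr⟩ := h
  simp only at hv h12 h7 h8 h9 h10 h11 hQ
  have hN := hv.one_lt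
  obtain ⟨hD, hD0, hKl, hDN⟩ := MulSetup.pow_lt (h := ⟨v, arr⟩) hv
  have hmod : d % 2 ^ t < 2 ^ t := Nat.mod_lt _ (by positivity)
  -- At most `2 ^ t ≤ d < H ^ l` factors, so the degree stays below the table length; this is what
  -- the choice of `l` has to ensure.
  have hP : ∀ n, n ≤ 2 ^ t → Pol (H ^ l) (apProd m c d n) := fun n hn => (pol_apProd m c d n).mono (by omega)
  have hκ : Pol (H ^ l) fun i => kernel (ZMod N) (H ^ l) (d * 2 ^ t + i) := (pol_kernel hD0).shift _
  have hU : ∀ st : Store, (∀ y < 14, st.v y = v y) → (Expr.var 7).eval st = H ^ l := by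
    intro st hst
    rw [Expr.eval_var, hst 7 (by norm_num), hv.h7]
  refine wp_seq (G₁ := 0) (G₂ := 0) (wp_kernelCmd hv _ hκ h7 h11 fun a₁ f₁ e₁ => ?_)
  refine wp_seq (G₁ := 0) (G₂ := 0) (wp_shiftCmd (h := ⟨v, a₁⟩) hv (by decide) (d * 2 ^ t) _ (hP (d % 2 ^ t) (by omega))
    ?_ ?_ e₁ ?_ fun a₂ f₂ e₂ => ?_)
  · simpa only [f₁ 7 (by decide) (by decide)] using h7
  · simpa only [f₁ 8 (by decide) (by decide)] using h8
  · simpa only [f₁ 10 (by decide) (by decide)] using h10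
  have g₂ : ∀ c, 5 < c → c ≠ 12 → c ≠ 13 → a₂ c = arr c := fun c h5 h12 h13 => (f₂ c h5 h13).trans (f₁ c h5 h12)
  refine wp_seq (G₁ := 0) (G₂ := 0) (wp_mapTo (h := ⟨v, a₂⟩) hv (H ^ l)
    (fun z => d / 2 ^ t % 2 * (a₂ 13 z * arr 9 z) + (1 - d / 2 ^ t % 2) * arr 10 z) rfl (by omega) hU ?_
    fun a₃ f₃ e₃ => ?_)
  · intro z hz st h14 hst harr
    simp [h14, hst 12, h12, harr 13, harr 9, harr 10, g₂]
  refine wp_seq (G₁ := 0) (G₂ := 0) (wp_mapTo (h := ⟨v, a₃⟩) hv (H ^ l) (fun z => a₃ 14 z) rfl (by omega) hU ?_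
    fun a₄ f₄ e₄ => ?_)
  · intro z hz st h14 hst harr
    simp [h14, harr 14]
  have g₄ : ∀ c, 5 < c → c ≠ 12 → c ≠ 13 → c ≠ 14 → c ≠ 10 → a₄ c = arr c := fun c h5 h12 h13 h14 h10 =>
    (f₄ c h10).trans ((f₃ c h14).trans (g₂ c h5 h12 h13))
  have k₄ : a₄ 12 = a₁ 12 := (f₄ 12 (by decide)).trans ((f₃ 12 (by decide)).trans (f₂ 12 (by decide) (by decide)))
  refine wp_seq (G₁ := 0) (G₂ := 0) (wp_shiftCmd (h := ⟨v, a₄⟩) hv (by decide) (d * 2 ^ t) _ (hP (2 ^ t) le_rfl)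
    ?_ ?_ ?_ ?_ fun a₅ f₅ e₅ => ?_)
  · simpa only [g₄ 7 (by decide) (by decide) (by decide) (by decide) (by decide)] using h7
  · simpa only [g₄ 8 (by decide) (by decide) (by decide) (by decide) (by decide)] using h8
  · simpa only [k₄] using e₁
  · simpa only [g₄ 9 (by decide) (by decide) (by decide) (by decide) (by decide)] using h9
  have g₅ : ∀ c, 5 < c → c ≠ 12 → c ≠ 13 → c ≠ 14 → c ≠ 10 → a₅ c = arr c := fun c h5 h12 h13 h14 h10 =>
    (f₅ c h5 h13).trans (g₄ c h5 h12 h13 h14 h10)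
  refine wp_seq (G₁ := 0) (G₂ := 0) (wp_mapTo (h := ⟨v, a₅⟩) hv (H ^ l)
    (fun z => arr 9 z * a₅ 13 z) rfl (by omega) hU ?_ fun a₆ f₆ e₆ => ?_)
  · intro z hz st h14 hst harr
    simp [h14, harr 13, harr 9, g₅]
  refine wp_seq (G₁ := 0) (G₂ := 0) (wp_mapTo (h := ⟨v, a₆⟩) hv (H ^ l) (fun z => a₆ 14 z) rfl (by omega) hU ?_
    fun a₇ f₇ e₇ => ?_)
  · intro z hz st h14 hst harr
    simp [h14, harr 14]
  have g₇ : ∀ c, 5 < c → c ≠ 12 → c ≠ 13 → c ≠ 14 → c ≠ 10 → c ≠ 9 → a₇ c = arr c :=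
    fun c h5 h12 h13 h14 h10 h9 =>
    (f₇ c h9).trans ((f₆ c h14).trans (g₅ c h5 h12 h13 h14 h10))
  have k₇ : a₇ 12 = a₁ 12 := (f₇ 12 (by decide)).trans ((f₆ 12 (by decide)).trans
    ((f₅ 12 (by decide) (by decide)).trans k₄))
  refine wp_seq (G₁ := 0) (G₂ := 0) (wp_shiftCmd (h := ⟨v, a₇⟩) hv (by decide) (d * 2 ^ t) _ hκ
    ?_ ?_ ?_ ?_ fun a₈ f₈ e₈ => ?_)
  · simpa only [g₇ 7 (by decide) (by decide) (by decide) (by decide) (by decide) (by decide)] using h7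
  · simpa only [g₇ 8 (by decide) (by decide) (by decide) (by decide) (by decide) (by decide)] using h8
  · simpa only [k₇] using e₁
  · simpa only [g₇ 11 (by decide) (by decide) (by decide) (by decide) (by decide) (by decide)] using h11
  refine wp_seq (G₁ := 0) (G₂ := 0) (wp_mapTo (h := ⟨v, a₈⟩) hv (H ^ l) (fun z => a₈ 13 z) rfl (by omega) hU ?_
    fun a₉ f₉ e₉ => ?_)
  · intro z hz st h14 hst harr
    simp [h14, harr 13]
  have g₉ : ∀ c, 5 < c → c ≠ 11 → c ≠ 13 → a₉ c = a₇ c := fun c h5 h11 h13 => (f₉ c h11).trans (f₈ c h5 h13)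
  refine wp_asg_small hN rfl ?_ ?_
  · simp only [Expr.eval_div, Expr.eval_var, Expr.eval_two, h12]
    calc d / 2 ^ t / 2 ≤ d := (Nat.div_le_self _ _).trans (Nat.div_le_self _ _)
      _ < N ^ 10 := by omega
  simp only [Expr.eval_div, Expr.eval_var, Expr.eval_two, h12]
  rw [Nat.div_div_eq_div_mul, ← pow_succ]
  apply hQ
  · rw [g₉ 7 (by decide) (by decide) (by decide), g₇ 7 (by decide) (by decide) (by decide) (by decide) (by decide) (by decide)]
  · rw [g₉ 8 (by decide) (by decide) (by decide), g₇ 8 (by decide) (by decide) (by decide) (by decide) (by decide) (by decide)]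
  · intro i hi
    rw [g₉ 9 (by decide) (by decide) (by decide), e₇ i hi, ZMod.natCast_mod, e₆ i hi, ZMod.natCast_mod]
    push_cast
    rw [h9 i hi, e₅ i hi, pow_succ, mul_two, apProd_add]
  · intro i hi
    have ea : a₉ 10 = a₄ 10 := (g₉ 10 (by decide) (by decide) (by decide)).trans ((f₇ 10 (by decide)).trans
      ((f₆ 10 (by decide)).trans (f₅ 10 (by decide) (by decide))))
    rw [ea, e₄ i hi, ZMod.natCast_mod, e₃ i hi, ZMod.natCast_mod, Nat.mod_pow_succ]
    rcases Nat.mod_two_eq_zero_or_one (d / 2 ^ t) with h | h <;> rw [h]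
    · simp [h10 i hi]
    · simp only [one_mul, Nat.sub_self, zero_mul, add_zero, mul_one]
      push_cast
      rw [e₂ i hi, h9 i hi, add_comm (d % 2 ^ t), apProd_add, mul_comm]
  · intro i hi
    rw [e₉ i hi, ZMod.natCast_mod, e₈ i hi]
    congr 1; ring

theorem wp_doublingCmd (hv : MulSetup N l H K h.v) {m c : ZMod N} {d : ℕ} (hd : d < H ^ l)
    (h12 : h.v 12 = d)
    (h7 : ∀ i < K ^ l, (h.arr 7 i : ZMod N) = PowerSeries.coeff i ((1 - PowerSeries.X) ^ H ^ l))
    (h8 : ∀ i < K ^ l, (h.arr 8 i : ZMod N) = PowerSeries.coeff i (geom (ZMod N) ^ H ^ l))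
    (h9 : ∀ i < H ^ l, (h.arr 9 i : ZMod N) = apProd m c d 1 i)
    (h10 : ∀ i < H ^ l, (h.arr 10 i : ZMod N) = 1)
    (h11 : ∀ i < H ^ l, (h.arr 11 i : ZMod N) = kernel (ZMod N) (H ^ l) (d + i))
    (hQ : ∀ v arr', (∀ y, y ≠ 12 → v y = h.v y) →
      (∀ i < H ^ l, (arr' 10 i : ZMod N) = apProd m c d d i) → Q ⟨v, arr'⟩) :
    wp N 10 2000 doublingCmd ((l * l + 1) * (doublingCost l K + 300)) 0 Q h := by
  have hN := hv.one_lt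
  have hDl : H ^ l = 2 ^ (l * l) := by rw [hv.hH, ← pow_mul]
  refine wp_mono (wp_whl_small (G := 0) (T := doublingCost l K) hN (fun n h' => ∃ t arr', t + n = l * l ∧
      h' = ⟨Function.update h.v 12 (d / 2 ^ t), arr'⟩ ∧ arr' 7 = h.arr 7 ∧ arr' 8 = h.arr 8 ∧
      (∀ i < H ^ l, (arr' 9 i : ZMod N) = apProd m c d (2 ^ t) i) ∧
      (∀ i < H ^ l, (arr' 10 i : ZMod N) = apProd m c d (d % 2 ^ t) i) ∧
      (∀ i < H ^ l, (arr' 11 i : ZMod N) = kernel (ZMod N) (H ^ l) (d * 2 ^ t + i)))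
    (l * l) rfl ?_ ?_ ?_) le_rfl (by omega) (fun _ h => h)
  · refine ⟨0, h.arr, by omega, ?_, rfl, rfl, by simpa using h9, ?_, by simpa using h11⟩
    · simp [← h12]
    · intro i hi
      rw [h10 i hi, pow_zero, Nat.mod_one, apProd, Finset.prod_range_zero]
  · rintro n h' ⟨t, arr', ht, rfl, e7, e8, e9, e10, e11⟩ hlt
    simp at hlt
    have htd : 2 ^ t ≤ d := hlt
    have htl : t < l * l := (Nat.pow_lt_pow_iff_right (by norm_num)).1 (htd.trans_lt (hDl ▸ hd))
    obtain ⟨n', rfl⟩ : ∃ n', n = n' + 1 := ⟨n - 1, by omega⟩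
    refine ⟨n', rfl, wp_doublingBody (h := ⟨Function.update h.v 12 (d / 2 ^ t), arr'⟩) (hv.update (by omega) _) hd htd (by simp) ?_ ?_ e9 e10 e11
      fun arr'' k7 k8 k9 k10 k11 => ⟨t + 1, arr'', by omega, by simp, k7.trans e7, k8.trans e8, k9, k10, k11⟩⟩
    · simpa only [e7] using h7
    · simpa only [e8] using h8
  · rintro n h' ⟨t, arr', ht, rfl, e7, e8, e9, e10, e11⟩ hle
    simp at hle
    -- The loop ends once `2 ^ t` exceeds `d`, and then `d % 2 ^ t` is all of `d`.
    rw [Nat.mod_eq_of_lt hle] at e10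
    exact hQ _ _ (fun y hy => by simp [hy]) e10

theorem wp_asg_gcd {N : ℕ} (hN : 1 < N) {x : ℕ} {e : Expr} {Q : Store → Prop} {h : Store}
    (hs : (Nat.ble (e.size 10) 2000 && Nat.ble (e.cost + 1) 300 && Nat.ble e.gcds 1) = true)
    (hlt : e.eval h < N ^ 10) (H : Q ⟨Function.update h.v x (e.eval h), h.arr⟩) :
    wp N 10 2000 (asg x e) 300 1 Q h := by
  simp only [Bool.and_eq_true, Nat.ble_eq] at hs
  exact wp_mono (wp_asg hN (by omega) (by omega) hlt H) (by omega) (by omega) fun _ h => h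

/-- The numbers inspected by the second loop of `searchCmd`. -/
def searchVal (N m d r j G i : ℕ) : ℕ :=
  if i = 0 then G % N else
    Nat.gcd ((m * j - (m * d * i + r)) + ((m * d * i + r) - m * j)) N

/-- Reducing `G` modulo `N` between the loops encodes the case distinction: a proper factor stays at
least `2` and the second loop is skipped, while `N` becomes `0` and starts it. Entry `0` of
`searchVal` is this reduced value. -/
theorem wp_searchCmd (hN : 1 < N) {m r d J I F : ℕ} (h0 : h.v 0 = N) (h2 : h.v 2 = m) (h3 : h.v 3 = r)
    (h4 : h.v 4 = d) (hJN : J < N) (hIN : I < N)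
    (hJlt : ∀ j < J, Nat.gcd (h.arr 10 j) N = 1) (hJ : 2 ≤ Nat.gcd (h.arr 10 J) N)
    (hIlt : ∀ i < I, searchVal N m d r (J + 1) (Nat.gcd (h.arr 10 J) N) i < 2)
    (hI : searchVal N m d r (J + 1) (Nat.gcd (h.arr 10 J) N) I = F) (hF : 2 ≤ F) (hFN : F < N)
    (hQ : ∀ v arr', v 0 = F → Q ⟨v, arr'⟩) :
    wp N 10 2000 searchCmd ((J + 2 + (I + 1)) * 900 + 1500) (J + 1 + I) Q h := by
  obtain ⟨v, arr⟩ := h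
  simp only at h0 h2 h3 h4 hJlt hJ hIlt hI
  have hN10 : N * 8 ≤ N ^ 10 := by
    calc N * 8 = N * 2 ^ 3 := rfl
      _ ≤ N * N ^ 3 := by gcongr; omega
      _ = N ^ 4 := by ring
      _ ≤ N ^ 10 := Nat.pow_le_pow_right (by omega) (by norm_num)
  have hg : ∀ x, Nat.gcd x N ≤ N := fun x => Nat.gcd_le_right _ (by omega)
  set S : ℕ → ℕ → ℕ → ℕ → ℕ := fun j g i => Function.update (Function.update (Function.update v 19 j) 20 g) 21 i with hS
  refine wp_mono (T := 300 + (300 + ((J + 1 + 1) * (300 + 300 + 300) + (300 + (300 + ((I + 1) * (300 + 300 + 300) + 300))))))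
    (G := 0 + (0 + ((J + 1) * (1 + 0) + (0 + (0 + (I * (0 + 1) + 0)))))) ?_ (by ring_nf; omega) (by omega) (fun _ h => h)
  refine wp_seq (wp_asg_small hN rfl (by simp; omega) ?_)
  refine wp_seq (wp_asg_small hN rfl (by simp; omega) ?_)
  refine wp_seq (wp_whl_small (T := 300 + 300) (G := 1 + 0) hN (fun n h' => ∃ j g, j + n = J + 1 ∧
    h' = ⟨Function.update (Function.update v 19 j) 20 g, arr⟩ ∧ (j = 0 ∧ g = 1 ∨ ∃ j', j = j' + 1 ∧ g = Nat.gcd (arr 10 j') N)) (J + 1) rfl ?_ ?_ ?_)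
  · exact ⟨0, 1, by omega, rfl, by simp⟩
  · rintro n h' ⟨j, g, hj, rfl, hcase⟩ hlt
    simp at hlt
    have hjJ : j ≤ J := by
      by_contra hcon
      rcases hcase with ⟨rfl, -⟩ | ⟨j', rfl, rfl⟩
      · omega
      · obtain rfl : j' = J := by omega
        omega
    obtain ⟨n', rfl⟩ : ∃ n', n = n' + 1 := ⟨n - 1, by omega⟩
    refine ⟨n', rfl, wp_seq (wp_asg_gcd hN rfl ?_ ?_)⟩
    · simp [h0]
      have := hg (arr 10 j)
      omega
    refine wp_asg_small hN rfl (by simp; omega) ⟨j + 1, Nat.gcd (arr 10 j) N, by omega, ?_, .inr ⟨j, rfl, rfl⟩⟩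
    ext x
    · simp [h0, Function.update_apply]
      split_ifs <;> simp_all
    · rfl
  · rintro n h' ⟨j, g, hj, rfl, hcase⟩ hle
    simp at hle
    obtain ⟨rfl, rfl⟩ : j = J + 1 ∧ g = Nat.gcd (arr 10 J) N := by
      rcases hcase with ⟨rfl, rfl⟩ | ⟨j', rfl, rfl⟩
      · omega
      · have : j' = J := by
          by_contra hne
          have := hJlt j' (by omega)
          omega
        subst this
        exact ⟨rfl, rfl⟩
    generalize hG : Nat.gcd (arr 10 J) N = G at *
    have hmodN : G % N < N := Nat.mod_lt _ (by omega)
    refine wp_seq (wp_asg_small hN rfl (by simp [h0]; omega) ?_)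
    refine wp_seq (wp_asg_small hN rfl (by simp; omega) ?_)
    refine wp_seq (wp_whl_small (T := 300 + 300) (G := 0 + 1) hN (fun n h' => ∃ i, i + n = I ∧
      h' = ⟨S (J + 1) (searchVal N m d r (J + 1) G i) i, arr⟩) I rfl ?_ ?_ ?_)
    · refine ⟨0, by omega, ?_⟩
      ext x
      · simp [hS, h0, searchVal, Function.update_apply]
      · rfl
    · rintro n h' ⟨i, hi, rfl⟩ hlt
      simp [hS] at hlt
      have hiI : i < I := by
        by_contra hcon
        obtain rfl : i = I := by omega
        omega
      obtain ⟨n', rfl⟩ : ∃ n', n = n' + 1 := ⟨n - 1, by omega⟩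
      refine ⟨n', rfl, wp_seq (wp_asg_small hN rfl (by simp [hS]; omega) (wp_asg_gcd hN rfl ?_ ⟨i + 1, by omega, ?_⟩))⟩
      · simp only [Expr.eval_gcd, Expr.eval_var]
        refine lt_of_le_of_lt (b := N) ?_ (by omega)
        simp [hS, h0, hg]
      · ext x
        · simp [hS, h0, h2, h3, h4, searchVal, Function.update_apply]
          split_ifs <;> simp_all
        · rfl
    · rintro n h' ⟨i, hi, rfl⟩ hle
      simp [hS] at hle
      have : i = I := by
        by_contra hne
        have := hIlt i (by omega)
        omega
      subst this
      refine wp_asg_small hN rfl (by simp [hS, hI]; omega) (hQ _ _ ?_)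
      simp [hS, hI]

end

end WordRAM

/-! ### The whole program and its cost -/

namespace WordRAM

open BlockTransform SeriesShift

/-- The factorization program. -/
def factorProgram : Program where
  main := .seq (.move 6 3) (.seq (.move 4 2) (.seq (.move 2 1) (.seq rootCmd (.seq paramCmd
    (.seq powersCmd (.seq startCmd (.seq doublingCmd searchCmd)))))))
  procs := []

/-- Bound for the number of steps of the factorization program. -/
def factorCost (d l : ℕ) : ℕ :=
  3 + ((d + 1) * 600 + (((l + 1) * 900 + 1500) + (powersCost l (2 * 2 ^ l) + (startCost l (2 * 2 ^ l) +
    ((l * l + 1) * (doublingCost l (2 * 2 ^ l) + 300) + ((2 * d + 2) * 900 + 1500))))))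

theorem factorProgram_outputs {N B m r d l J I F : ℕ} (hB : B ≤ N) (hm : m ≤ N) (hs : SizeFor d l)
    (hm2 : 1 ≤ m) (hle : m * d * d + r < N)
    (hlt : ∀ d' < d, d' * d' * m < B) (hge : B ≤ d * d * m) (Gf : ℕ → ℕ)
    (hGf : ∀ j < d, ∀ x : ℕ, (x : ZMod N) = apProd (m : ZMod N) (m - (m * d * d + r : ℕ)) d d j →
      Nat.gcd x N = Gf j)
    (hJd : J < d) (hId : I ≤ d) (hJlt : ∀ j < J, Gf j = 1) (hJ : 2 ≤ Gf J)
    (hIlt : ∀ i < I, searchVal N m d r (J + 1) (Gf J) i < 2)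
    (hI : searchVal N m d r (J + 1) (Gf J) I = F) (hF : 2 ≤ F) (hFN : F < N) :
    ∃ t g, factorProgram.Outputs (N ^ 2000) [N, B, m, r] F t g ∧ t ≤ factorCost d l ∧ g ≤ 2 * d := by
  have hd2 := hs.two_le_d
  have hdd : d * d < N := by
    calc d * d ≤ m * (d * d) := Nat.le_mul_of_pos_left _ hm2
      _ = m * d * d := by ring
      _ < N := by omega
  have hdN : d < N := lt_of_le_of_lt (Nat.le_mul_of_pos_left d (by omega : 0 < d)) hdd
  have hN : 1 < N := by omega
  have hN10 : N < N ^ 10 := by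
    calc N = N ^ 1 := (pow_one N).symm
      _ < N ^ 10 := Nat.pow_lt_pow_right hN (by norm_num)
  -- Inputs arrive in consecutive registers but variables are the even ones; moving from the last
  -- input downwards overwrites nothing that is still needed.
  set σ : State := (((initState [N, B, m, r]).setReg 6 r).setReg 4 m).setReg 2 B with hσ
  have hv0 : σ.store.v 0 = N := by simp [hσ, State.store, State.setReg, initState]
  have hv1 : σ.store.v 1 = B := by simp [hσ, State.store, State.setReg, initState]
  have hv2 : σ.store.v 2 = m := by simp [hσ, State.store, State.setReg, initState]
  have hv3 : σ.store.v 3 = r := by simp [hσ, State.store, State.setReg, initState]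
  have hv4 : ∀ y, 4 ≤ y → σ.store.v y = 0 := by
    intro y hy
    obtain ⟨y, rfl⟩ : ∃ z, y = z + 4 := ⟨y - 4, by omega⟩
    simp [hσ, State.store, State.setReg, initState, Function.update_apply,
      show 2 * (y + 4) = 2 * y + 4 + 1 + 1 + 1 + 1 by ring]
  have hbdd : σ.store.Bdd (N ^ 10) := by
    constructor
    · intro y
      rcases Nat.lt_or_ge y 4 with h | h
      · interval_cases y <;> omega
      · rw [hv4 y h]; omega
    · intro a i
      simp only [hσ, State.store, State.setReg, initState]
      omega
  have hwp : wp N 10 2000 (.seq rootCmd (.seq paramCmd (.seq powersCmd (.seq startCmd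
      (.seq doublingCmd searchCmd))))) (factorCost d l - 3) (2 * d) (fun h => h.v 0 = F) σ.store := by
    refine wp_mono (T := (d + 1) * 600 + (((l + 1) * 900 + 1500) + (powersCost l (2 * 2 ^ l) +
      (startCost l (2 * 2 ^ l) + ((l * l + 1) * (doublingCost l (2 * 2 ^ l) + 300) +
      ((J + 2 + (I + 1)) * 900 + 1500))))))
      (G := 0 + (0 + (0 + (0 + (0 + (J + 1 + I)))))) ?_ ?_ (by omega) fun _ h => h
    swap
    · have : (J + 2 + (I + 1)) * 900 ≤ (2 * d + 2) * 900 := Nat.mul_le_mul_right _ (by omega)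
      rw [factorCost, Nat.add_sub_cancel_left]
      gcongr
    refine wp_seq (wp_rootCmd hN hdN (hv4 4 le_rfl) (by rw [hv1, hv2]; exact hlt)
      (by rw [hv1, hv2]; exact hge) ?_)
    refine wp_seq (wp_paramCmd (h := ⟨Function.update σ.store.v 4 d, σ.store.arr⟩) hs hdd (by simp [hv0]) (by simp) ?_ fun v hv hvy => ?_)
    · intro y hy
      simp [show y ≠ 4 by omega, hv4 y (by omega)]
    have e0 : v 2 = m ∧ v 3 = r ∧ v 4 = d := by
      rw [hvy 2 (by norm_num), hvy 3 (by norm_num), hvy 4 (by norm_num)]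
      simp [hv2, hv3]
    refine wp_seq (wp_powersCmd hv fun v₁ a₁ hv₁ hvy₁ h7 h8 => ?_)
    have e1 : v₁ 2 = m ∧ v₁ 3 = r ∧ v₁ 4 = d := by
      rwa [hvy₁ 2 (by norm_num), hvy₁ 3 (by norm_num), hvy₁ 4 (by norm_num)]
    refine wp_seq (wp_startCmd (h := ⟨v₁, a₁⟩) hv₁ e1.1 e1.2.1 e1.2.2 hs.lt hle.le h8
      fun v₂ a₂ hv₂ hvy₂ h12 k7 k8 h9 h10 h11 => ?_)
    have e2 : v₂ 2 = m ∧ v₂ 3 = r ∧ v₂ 4 = d := by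
      rwa [hvy₂ 2 (by norm_num), hvy₂ 3 (by norm_num), hvy₂ 4 (by norm_num)]
    refine wp_seq (wp_doublingCmd (h := ⟨v₂, a₂⟩) hv₂ hs.lt h12 (by simpa only [k7] using h7)
      (by simpa only [k8] using h8) h9 h10 h11 fun v₃ a₃ hvy₃ h => ?_)
    have e3 : v₃ 2 = m ∧ v₃ 3 = r ∧ v₃ 4 = d := by
      rwa [hvy₃ 2 (by norm_num), hvy₃ 3 (by norm_num), hvy₃ 4 (by norm_num)]
    have hG : ∀ j < d, Nat.gcd (a₃ 10 j) N = Gf j := fun j hj => hGf j hj _ (h j (hj.trans hs.lt))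
    refine wp_searchCmd (h := ⟨v₃, a₃⟩) hN ((hvy₃ 0 (by norm_num)).trans hv₂.h0) e3.1 e3.2.1 e3.2.2
      (by omega) (by omega) ?_ ?_ ?_ ?_ hF hFN fun v arr' h => h
    · intro j hj
      exact (hG j (by omega)).trans (hJlt j hj)
    · simpa only [hG J hJd] using hJ
    · simpa only [hG J hJd] using hIlt
    · simpa only [hG J hJd] using hI
  obtain ⟨σ', t, g, h1, h2, h3, -, h5⟩ := hwp σ rfl hbdd
  refine ⟨1 + (1 + (1 + t)), 0 + (0 + (0 + g)), ⟨σ', .seq (.move _ 6 3) (.seq (.move _ 4 2) (.seq (.move _ 2 1) h1)), h5⟩, ?_, by omega⟩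
  have : 3 ≤ factorCost d l := Nat.le_add_right _ _
  omega

/-- With `H = 2 ^ l`, a pass costs `O(H ^ 5 * d)`, a multiplication takes `O(l + 1)` passes with `l
+ 1 ≤ H`, and the outer loops make at most `l * l + 1 ≤ H ^ 2` rounds, each with boundedly many
multiplications. -/
theorem factorCost_le {d l : ℕ} (hs : SizeFor d l) : factorCost d l ≤ 10 ^ 7 * ((2 ^ l) ^ 8 * d) := by
  have hd2 := hs.two_le_d
  have hD := hs.pow_pow_le
  have hl : l + 1 ≤ 2 ^ l := Nat.lt_two_pow_self
  have hH1 : 1 ≤ 2 ^ l := by omega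
  have hn : (2 * 2 ^ l) ^ l = 2 ^ l * (2 ^ l) ^ l := by rw [mul_pow]
  simp only [factorCost, powersCost, startCost, doublingCost, shiftCost, prodCost]
  have hpass : passCost l (2 * 2 ^ l) ≤ 2700 * ((2 ^ l) ^ 5 * d) := by
    rw [passCost, hn]
    generalize 2 ^ l = H at *
    calc (2 * (H * H ^ l * (2 * H)) + 1) * (2 * H + 1) * 300
        = (2 * (H * H * (2 * H ^ l)) + 1) * (2 * H + 1) * 300 := by ring
      _ ≤ (2 * (H * H * (H * H * d)) + H * H * (H * H * d)) * (2 * H + H) * 300 := by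
          gcongr
          have : 0 < H * H * (H * H * d) := by positivity
          omega
      _ = _ := by ring
  have hmulCost : mulCost l (2 * 2 ^ l) = (l + 1) * (11 * passCost l (2 * 2 ^ l) + 3000) := rfl
  generalize mulCost l (2 * 2 ^ l) = M at *
  generalize passCost l (2 * 2 ^ l) = P at *
  generalize 2 ^ l = H at *
  have hX : H ≤ H ^ 5 * d := by
    calc H = H ^ 1 * 1 := by ring
      _ ≤ H ^ 5 * d := Nat.mul_le_mul (Nat.pow_le_pow_right hH1 (by norm_num)) (by omega)
  have hX' : d ≤ H ^ 5 * d := Nat.le_mul_of_pos_left _ (by positivity)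
  have e8 : H ^ 8 * d = H * H * (H * (H ^ 5 * d)) := by ring
  rw [e8]
  generalize H ^ 5 * d = X at *
  have hX1 : X ≤ H * X := Nat.le_mul_of_pos_left _ hH1
  have hmul : M ≤ 33000 * (H * X) := by
    rw [hmulCost]
    calc (l + 1) * (11 * P + 3000) ≤ H * (33000 * X) := by gcongr; omega
      _ = _ := by ring
  have hll : l * l + 1 ≤ H * H := by nlinarith
  have hY : H * X ≤ H * H * (H * X) := Nat.le_mul_of_pos_left _ (by positivity)
  generalize H * X = Y at *
  have h1 : ∀ a c, a ≤ c * Y → (l * l + 1) * a ≤ c * (H * H * Y) := by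
    intro a c h
    calc (l * l + 1) * a ≤ (H * H) * (c * Y) := Nat.mul_le_mul hll h
      _ = _ := by ring
  have h2 := h1 (P + (P + M) + P + (P + (P + M) + P + 300) + 300) 100000 (by omega)
  have h3 := h1 (P + (P + M) + P + (P + (P + M) + (P + (P + M) + (P + (P + M) + P)) + (P + (P + (P + (P + M) + (P + (P + M) + (P + (P + M) + P)) + (P + (P + (P + (P + M) + (P + (P + M) + (P + (P + M) + P)) + (P + 300)))))))) + 300) 1000000 (by omega)
  generalize H * H * Y = Z at *
  omega

/-- With `u = l - 1` one has `2 ^ (u ^ 2) ≤ d`, so it suffices that `8 * u ≤ ε * u ^ 2 + 16 / ε`,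
which is `(ε * u - 4) ^ 2 ≥ 0`. -/
theorem two_pow_le_rpow {ε : ℝ} (hε : 0 < ε) {d l : ℕ} (hs : SizeFor d l) :
    (((2 ^ l) ^ 8 : ℕ) : ℝ) ≤ (2 : ℝ) ^ (8 + 16 / ε) * (d : ℝ) ^ ε := by
  have h2 := hs.two_le
  obtain ⟨u, rfl⟩ : ∃ u, l = u + 1 := ⟨l - 1, by omega⟩
  have h := hs.ge u (by omega) (by omega)
  have h' : ((2 : ℝ) ^ ((u : ℝ) * u)) ≤ d := by
    rw [← pow_mul] at h
    have : ((2 ^ (u * u) : ℕ) : ℝ) ≤ d := by exact_mod_cast h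
    rwa [← Nat.cast_mul, Real.rpow_natCast, ← Nat.cast_ofNat, ← Nat.cast_pow]
  have key : (8 : ℝ) * (u + 1) ≤ (8 + 16 / ε) + u * u * ε := by
    have : 0 ≤ (ε * u - 4) ^ 2 / ε := by positivity
    have e : (ε * u - 4) ^ 2 / ε = u * u * ε - 8 * u + 16 / ε := by field_simp; ring
    linarith
  calc (((2 ^ (u + 1)) ^ 8 : ℕ) : ℝ) = (2 : ℝ) ^ ((8 : ℝ) * (u + 1)) := by
        rw [show (8 : ℝ) * (u + 1) = ((((u + 1) * 8 : ℕ)) : ℝ) by push_cast; ring, Real.rpow_natCast, pow_mul]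
        push_cast; rfl
    _ ≤ (2 : ℝ) ^ ((8 + 16 / ε) + u * u * ε) := Real.rpow_le_rpow_of_exponent_le (by norm_num) key
    _ = (2 : ℝ) ^ (8 + 16 / ε) * ((2 : ℝ) ^ ((u : ℝ) * u)) ^ ε := by
        rw [Real.rpow_add (by norm_num), Real.rpow_mul (by norm_num)]
    _ ≤ _ := by gcongr

end WordRAM

/-! ### The digits of `p` -/

namespace DigitFactoring

open SeriesShift

/-- Let `x = √(b / m)`. From `m < p < b` follows `x > 1`, and `d < x + 1`, `r < m` give `m * d ^ 2 +
r < m * (x ^ 2 + 2 * x + 2) < 5 * m * x ^ 2 = 5 * b ≤ N`. This is the source of the constant `5`.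
The remaining bounds let the machine find `d` from the integer `⌈b⌉` alone. -/
theorem ceil_sqrt_bounds {N p m r d : ℕ} {b : ℝ} (hpb : (p : ℝ) < b) (hbN : b ≤ (N : ℝ) / 5)
    (hm : 2 ≤ m) (hmp : m < p) (hr : r < m) (hd : d = ⌈Real.sqrt (b / m)⌉₊) :
    2 ≤ d ∧ m * d * d + r < N ∧ (∀ d' < d, d' * d' * m < ⌈b⌉₊) ∧ ⌈b⌉₊ ≤ d * d * m ∧ ⌈b⌉₊ ≤ N := by
  have hm0 : (0 : ℝ) < m := by positivity
  have hmp' : (m : ℝ) < p := by exact_mod_cast hmp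
  have hr' : (r : ℝ) < m := by exact_mod_cast hr
  have hb0 : 0 < b := by linarith
  set x := Real.sqrt (b / m) with hx
  have hx0 : 0 ≤ x := Real.sqrt_nonneg _
  have hxx : m * (x * x) = b := by
    rw [hx, Real.mul_self_sqrt (by positivity)]; field_simp
  have h1x : 1 < x := by
    by_contra hcon
    have : x * x ≤ 1 := by nlinarith
    nlinarith
  have hxd : x ≤ d := hd ▸ Nat.le_ceil x
  have hdx : (d : ℝ) < x + 1 := hd ▸ Nat.ceil_lt_add_one hx0
  refine ⟨?_, ?_, ?_, ?_, ?_⟩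
  · have : (1 : ℝ) < d := by linarith
    exact_mod_cast this
  · have h1 : (d : ℝ) * d < (x + 1) * (x + 1) := by nlinarith
    have h2 : (m : ℝ) * (d * d) < m * ((x + 1) * (x + 1)) := mul_lt_mul_of_pos_left h1 hm0
    have h3 : (m : ℝ) * x < m * (x * x) := mul_lt_mul_of_pos_left (by nlinarith) hm0
    have : (m : ℝ) * d * d + r < N := by nlinarith
    exact_mod_cast this
  · intro d' hd'
    have h1 : (d' : ℝ) < x := by rw [hd] at hd'; exact Nat.lt_ceil.1 hd'
    have h0 : (0 : ℝ) ≤ d' := by positivity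
    rw [Nat.lt_ceil]
    push_cast
    have : (d' : ℝ) * d' < x * x := by nlinarith
    nlinarith
  · rw [Nat.ceil_le]
    push_cast
    have : x * x ≤ (d : ℝ) * d := by nlinarith
    nlinarith
  · rw [Nat.ceil_le]; linarith

/-- If `p / m = d * a + c` in base `d`, take `i = a + 1` and `j = d - c`: the extra `1` adds `m * d`
on the left, which pays for the complement of `c` on the right and keeps both indices in `1, …, d`.
-/
theorem exists_digits {p m r d : ℕ} (hm : 0 < m) (hd : 0 < d) (hr : r = p % m) (hp : p < d * d * m) :
    ∃ i ∈ Finset.Icc 1 d, ∃ j ∈ Finset.Icc 1 d, m * d * i + r = m * j + p := by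
  have hq : p / m < d * d := (Nat.div_lt_iff_lt_mul hm).2 hp
  have hq' : p / m / d < d := (Nat.div_lt_iff_lt_mul hd).2 hq
  have hmod := Nat.mod_lt (p / m) hd
  refine ⟨p / m / d + 1, by simp; omega, d - p / m % d, by simp; omega, ?_⟩
  have h1 := Nat.div_add_mod p m
  have h2 := Nat.div_add_mod (p / m) d
  rw [← hr] at h1
  zify [hmod.le] at *
  linear_combination h1 + m * h2

/-- Equality makes `m` divide `r < m`, so `r = 0` and `m` divides `p`, impossible for a prime `p`
and `2 ≤ m < p`. -/
theorem disjoint_values {p m r d : ℕ} (hm : 2 ≤ m) (hp : p.Prime) (hmp : m < p) (hr : r = p % m)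
    (i j : ℕ) : m * d * i + r ≠ m * j := by
  intro h
  have hrm : r < m := hr ▸ Nat.mod_lt _ (by omega)
  have h1 : m ∣ r := by
    rw [mul_assoc] at h
    exact (Nat.dvd_add_right (dvd_mul_right m (d * i))).1 (h ▸ dvd_mul_right m j)
  have h0 : r = 0 := Nat.eq_zero_of_dvd_of_lt h1 hrm
  have h2 : m ∣ p := Nat.dvd_of_mod_eq_zero (by omega)
  rcases (Nat.dvd_prime hp).1 h2 with h | h <;> omega

theorem gcdG_eq (N d m r j : ℕ) :
    gcdG N d (fun n => Polynomial.X - Polynomial.C ((m * d * n + r : ℕ) : ℤ)) (fun n => m * n) j =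
      Int.gcd (∏ i ∈ Finset.Icc 1 d, (((m * j : ℕ) : ℤ) - ((m * d * i + r : ℕ) : ℤ))) N := by
  rw [gcdG, yVal, Int.gcd_emod, Polynomial.eval_prod]
  simp

theorem gcdH_eq (N d m r j i : ℕ) :
    gcdH N (fun n => Polynomial.X - Polynomial.C ((m * d * n + r : ℕ) : ℤ)) (fun n => m * n) j i =
      Nat.gcd ((m * j - (m * d * i + r)) + ((m * d * i + r) - m * j)) N := by
  simp only [gcdH, Polynomial.eval_sub, Polynomial.eval_X, Polynomial.eval_C]
  rw [Int.gcd, Int.natAbs_natCast]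
  congr 1
  omega

/-- The factors match in reversed order, `i` with `d - i`; this turns the negative step in `b_i`
into the positive step `d` of the progression. Tables start at `0`, so entry `j` belongs to the
point `s_(j + 1)`. -/
theorem gcd_eq_of_cast_eq_apProd {N d m r j x : ℕ}
    (hx : (x : ZMod N) = apProd (m : ZMod N) (m - (m * d * d + r : ℕ)) d d j) :
    Nat.gcd x N = Int.gcd (∏ i ∈ Finset.Icc 1 d,
      (((m * (j + 1) : ℕ) : ℤ) - ((m * d * i + r : ℕ) : ℤ))) N := by
  have h : ((x : ℤ) : ZMod N) = ((∏ i ∈ Finset.Icc 1 d,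
      (((m * (j + 1) : ℕ) : ℤ) - ((m * d * i + r : ℕ) : ℤ)) : ℤ) : ZMod N) := by
    rw [Int.cast_natCast, hx, apProd, Int.cast_prod]
    refine Finset.prod_nbij' (fun i => d - i) (fun i => d - i) ?_ ?_ ?_ ?_ ?_
    · intro i hi; simp at hi ⊢; omega
    · intro i hi; simp at hi ⊢; omega
    · intro i hi; simp at hi ⊢; omega
    · intro i hi; simp at hi ⊢; omega
    · intro i hi
      have hi' : i ≤ d := by simp at hi; omega
      push_cast [Nat.cast_sub hi']
      ring
  rw [ZMod.intCast_eq_intCast_iff, Int.ModEq] at h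
  rw [← Int.gcd_emod (∏ i ∈ _, _), ← h, Int.gcd_emod]
  simp

end DigitFactoring

/-! ### The theorem -/

theorem mainTheorem2 :
    ∃ (Q : WordRAM.Program) (k : ℕ), ∀ ε : ℝ, 0 < ε → ∃ C : ℝ,
      ∀ (N p m r : ℕ) (b : ℝ), 1 < N → ¬ N.Prime → p.Prime → p ∣ N →
        (p : ℝ) < b → b ≤ (N : ℝ) / 5 → 2 ≤ m → m < p → r = p % m →
        ∀ d : ℕ, d = ⌈Real.sqrt (b / m)⌉₊ →
          DigitFactoring.IsSolution N d (fun n => m * d * n + r) (fun n => m * n) ∧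
          ∃ F t g : ℕ,
            DigitFactoring.algorithm N d
              (fun n => Polynomial.X - Polynomial.C ((m * d * n + r : ℕ) : ℤ))
              (fun n => m * n) = DigitFactoring.Outcome.factor F ∧
            F ∣ N ∧ 1 < F ∧ F < N ∧
            Q.Outputs (N ^ k) [N, ⌈b⌉₊, m, r] F t g ∧
            (t : ℝ) ≤ C * (d : ℝ) ^ (1 + ε) ∧ g ≤ 2 * d := by
  refine ⟨WordRAM.factorProgram, 2000, fun ε hε => ⟨10 ^ 7 * (2 : ℝ) ^ (8 + 16 / ε), ?_⟩⟩
  intro N p m r b hN _ hp hpN hpb hbN hm hmp hr d hd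
  have hrm : r < m := hr ▸ Nat.mod_lt _ (by omega)
  obtain ⟨hd2, hle, hlt, hge, hBN⟩ := DigitFactoring.ceil_sqrt_bounds hpb hbN hm hmp hrm hd
  have hpB : p < ⌈b⌉₊ := Nat.lt_ceil.2 hpb
  obtain ⟨i₀, hi₀, j₀, hj₀, hij⟩ := DigitFactoring.exists_digits (by omega) (by omega) hr (hpB.trans_le hge)
  have hdisj := DigitFactoring.disjoint_values (d := d) hm hp hmp hr
  have hb_lt : ∀ n ∈ Finset.Icc 1 d, m * d * n + r < N := by
    intro n hn
    have := Nat.mul_le_mul_left (m * d) (Finset.mem_Icc.1 hn).2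
    omega
  have hs_lt : ∀ n ∈ Finset.Icc 1 d, m * n < N := by
    intro n hn
    have h1 := Nat.mul_le_mul_left m (Finset.mem_Icc.1 hn).2
    have h2 : m * d ≤ m * d * d := Nat.le_mul_of_pos_right _ (by omega)
    omega
  refine ⟨⟨hb_lt, hs_lt, ?_, fun _ _ => ⟨i₀, hi₀, j₀, hj₀, p, hp, hpN, ?_⟩⟩, ?_⟩
  · rw [Set.disjoint_left]
    rintro _ ⟨i, -, rfl⟩ ⟨j, -, h⟩
    exact hdisj i j h.symm
  · simp [Nat.ModEq, hij]
  set f : ℕ → Polynomial ℤ := fun n => Polynomial.X - Polynomial.C ((m * d * n + r : ℕ) : ℤ) with hf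
  set s : ℕ → ℕ := fun n => m * n with hs
  -- `b_i` and `s_j` are distinct and below `N`, so `N` cannot divide their difference. The machine
  -- may therefore stop at the first gcd above `1` without comparing with `N`.
  have hHlt : ∀ j ∈ Finset.Icc 1 d, ∀ i ∈ Finset.Icc 1 d, DigitFactoring.gcdH N f s j i < N := by
    intro j hj i hi
    rw [DigitFactoring.gcdH_eq]
    have h1 := hdisj i j
    have h2 := hs_lt j hj
    have h3 := hb_lt i hi
    exact (Nat.gcd_le_left _ (by omega)).trans_lt (by omega)
  have hGex : DigitFactoring.gcdG N d f s j₀ ≠ 1 := by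
    intro h
    rw [DigitFactoring.gcdG_eq] at h
    have h1 : (p : ℤ) ∣ ∏ i ∈ Finset.Icc 1 d, (((m * j₀ : ℕ) : ℤ) - ((m * d * i + r : ℕ) : ℤ)) := by
      refine Dvd.dvd.trans ?_ (Finset.dvd_prod_of_mem _ hi₀)
      rw [hij]
      exact ⟨-1, by push_cast; ring⟩
    have h2 := Int.dvd_coe_gcd h1 (Int.natCast_dvd_natCast.2 hpN)
    rw [h] at h2
    exact hp.one_lt.ne' (Nat.dvd_one.1 (by exact_mod_cast h2))
  have hGN : ∀ j, DigitFactoring.gcdG N d f s j ∣ N := fun j => by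
    have := Int.gcd_dvd_right (a := DigitFactoring.yVal N d f s j) (b := N)
    exact_mod_cast this
  have hHN : ∀ j i, DigitFactoring.gcdH N f s j i ∣ N := fun j i => by
    have := Int.gcd_dvd_right (a := (f i).eval (s j : ℤ)) (b := N)
    exact_mod_cast this
  obtain ⟨j, hj⟩ : ∃ j, (List.range' 1 d).find? (fun j => decide (DigitFactoring.gcdG N d f s j ≠ 1)) = some j := by
    rw [← Option.isSome_iff_exists, List.find?_isSome]
    simp only [Finset.mem_Icc] at hj₀
    exact ⟨j₀, by simp; omega, by simpa using hGex⟩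
  have hj' := List.find?_range'_eq_some.1 hj
  simp only [List.mem_range'_1, decide_eq_true_eq, Bool.not_eq_true', decide_eq_false_iff_not, not_not] at hj'
  obtain ⟨hGj, hj1, hjmin⟩ := hj'
  obtain ⟨J, rfl⟩ : ∃ J, j = J + 1 := ⟨j - 1, by omega⟩
  have hGj2 : 2 ≤ DigitFactoring.gcdG N d f s (J + 1) := by
    have := Nat.pos_of_dvd_of_pos (hGN (J + 1)) (by omega)
    omega
  obtain ⟨l, hl⟩ := WordRAM.SizeFor.exists hd2
  -- `I` is the number of rounds of the second loop; `I = 0` means that the first gcd found is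
  -- already a proper factor.
  suffices H : ∃ I F, I ≤ d ∧ DigitFactoring.algorithm N d f s = .factor F ∧ F ∣ N ∧ 2 ≤ F ∧ F < N ∧
      (∀ i < I, WordRAM.searchVal N m d r (J + 1) (DigitFactoring.gcdG N d f s (J + 1)) i < 2) ∧
      WordRAM.searchVal N m d r (J + 1) (DigitFactoring.gcdG N d f s (J + 1)) I = F by
    obtain ⟨I, F, hI, h1, h2, h3, h4, h5, h6⟩ := H
    obtain ⟨t, g, h7, h8, h9⟩ := WordRAM.factorProgram_outputs hBN (by nlinarith) hl (by omega) hle hlt hge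
      (fun j => DigitFactoring.gcdG N d f s (j + 1)) (fun j _ x hx => (DigitFactoring.gcd_eq_of_cast_eq_apProd hx).trans (DigitFactoring.gcdG_eq ..).symm)
      (by omega) hI (fun j hj => hjmin (j + 1) (by omega) (by omega)) hGj2 h5 h6 h3 h4
    refine ⟨F, t, g, h1, h2, h3, h4, h7, ?_, h9⟩
    have hd0 : (0 : ℝ) < d := by positivity
    calc (t : ℝ) ≤ ((10 ^ 7 * ((2 ^ l) ^ 8 * d) : ℕ) : ℝ) := by exact_mod_cast h8.trans (WordRAM.factorCost_le hl)
      _ = 10 ^ 7 * ((((2 ^ l) ^ 8 : ℕ) : ℝ) * d) := by push_cast; norm_num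
      _ ≤ 10 ^ 7 * (((2 : ℝ) ^ (8 + 16 / ε) * (d : ℝ) ^ ε) * d) := by
        gcongr
        exact WordRAM.two_pow_le_rpow hε hl
      _ = 10 ^ 7 * (2 : ℝ) ^ (8 + 16 / ε) * (d : ℝ) ^ (1 + ε) := by
        rw [Real.rpow_add hd0, Real.rpow_one]; ring
  by_cases hGlt : DigitFactoring.gcdG N d f s (J + 1) < N
  · refine ⟨0, DigitFactoring.gcdG N d f s (J + 1), by omega, ?_, hGN _, hGj2, hGlt, by simp, ?_⟩
    · rw [DigitFactoring.algorithm, hj]; simp only; rw [if_pos hGlt]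
    · simp [WordRAM.searchVal, Nat.mod_eq_of_lt hGlt]
  have hGeq : DigitFactoring.gcdG N d f s (J + 1) = N :=
    le_antisymm (Nat.le_of_dvd (by omega) (hGN _)) (by omega)
  have hJmem : J + 1 ∈ Finset.Icc 1 d := by simp; omega
  -- `G = N` forces the prime `p` to divide the whole product, hence one of its factors.
  obtain ⟨i₁, hi₁, hHi₁⟩ : ∃ i ∈ Finset.Icc 1 d, 1 < DigitFactoring.gcdH N f s (J + 1) i := by
    have h1 : (p : ℤ) ∣ ∏ i ∈ Finset.Icc 1 d, (((m * (J + 1) : ℕ) : ℤ) - ((m * d * i + r : ℕ) : ℤ)) := by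
      have h2 := hGeq
      rw [DigitFactoring.gcdG_eq] at h2
      refine (Int.natCast_dvd_natCast.2 hpN).trans ?_
      have h3 := Int.gcd_dvd_left (a := ∏ i ∈ Finset.Icc 1 d, (((m * (J + 1) : ℕ) : ℤ) - ((m * d * i + r : ℕ) : ℤ))) (b := N)
      rwa [h2] at h3
    obtain ⟨i, hi, hdvd⟩ := (Nat.prime_iff_prime_int.1 hp).exists_mem_finset_dvd h1
    refine ⟨i, hi, hp.one_lt.trans_le (Nat.le_of_dvd (Nat.pos_of_dvd_of_pos (hHN _ _) (by omega)) ?_)⟩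
    have h4 : (p : ℤ) ∣ (DigitFactoring.gcdH N f s (J + 1) i : ℤ) :=
      Int.dvd_coe_gcd (by simpa [hf, hs] using hdvd) (Int.natCast_dvd_natCast.2 hpN)
    exact_mod_cast h4
  obtain ⟨i, hi⟩ : ∃ i, (List.range' 1 d).find? (fun i => decide (1 < DigitFactoring.gcdH N f s (J + 1) i ∧
      DigitFactoring.gcdH N f s (J + 1) i < N)) = some i := by
    rw [← Option.isSome_iff_exists, List.find?_isSome]
    have := hHlt _ hJmem _ hi₁
    simp only [Finset.mem_Icc] at hi₁
    exact ⟨i₁, by simp; omega, by simp [hHi₁, this]⟩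
  have hi' := List.find?_range'_eq_some.1 hi
  simp only [List.mem_range'_1, decide_eq_true_eq, Bool.not_eq_true', decide_eq_false_iff_not] at hi'
  obtain ⟨⟨hi2, hiN⟩, hi1, himin⟩ := hi'
  refine ⟨i, DigitFactoring.gcdH N f s (J + 1) i, by omega, ?_, hHN _ _, hi2, hiN, ?_, ?_⟩
  · rw [DigitFactoring.algorithm, hj]; simp only; rw [if_neg hGlt, DigitFactoring.searchH, hi]
  · intro i' hi'
    rw [WordRAM.searchVal]
    split_ifs with h0
    -- Entry `0` is `N % N = 0`, which lets the second loop start.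
    · simp [hGeq]
    · have h1 := himin i' (by omega) hi'
      have h2 := hHlt _ hJmem i' (by simp; omega)
      rw [← DigitFactoring.gcdH_eq]
      change DigitFactoring.gcdH N f s (J + 1) i' < 2
      omega
  · rw [WordRAM.searchVal, if_neg (by omega), DigitFactoring.gcdH_eq]
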